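/- Let $d\ge 1$ and $1\le M<N$ be integers. Identify bit strings $x\in\{0,1\}^N$ with subsets of the $N$ sites, write $w_x$ for the Hamming weight, $\bar x$ for the complement, and $x\cdot z=w_{x\cap z}$. Let $\alpha_x\ge 0$ $(x\in\{0,1\}^N)$ with $\sum_x\alpha_x=1$. On $(\mathbb C^d)^{\otimes M}_{\mathrm{IN}}\otimes(\mathbb C^d)^{\otimes N}_{\mathrm{OUT}}$ put $$R=\sum_x\alpha_xR_x,\qquad R_x=\tbinom{M+d-1}{M}\int\bigl((|\psi\rangle\langle\psi|)^{\otimes M}\bigr)^{T}_{\mathrm{IN}}\otimes|\psi\rangle\langle\psi|_x\otimes 1_{\bar x}\,d\psi,$$ where $d\psi$ is the uniform probability distribution on pure states of $\mathbb C^d$ and $|\psi\rangle\langle\psi|_x$ acts as $|\psi\rangle\langle\psi|$ on each site of $x$. For a completely positive trace preserving map $\mathcal E$ from operators on $(\mathbb C^d)^{\otimes M}$ to operators on $(\mathbb C^d)^{\otimes N}$ let $F_y(\mathcal E)=\int\mathrm{Tr}\bigl[(|\psi\rangle\langle\psi|_y\otimes 1_{\bar y})\,\mathcal E((|\psi\rangle\langle\psi|)^{\otimes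 M})\bigr]d\psi$. For $w_x=M$ and a symmetric vector $|\Phi\rangle\in(\mathbb C^d)^{\otimes(N-M)}$ let $|\psi_x\rangle=|B_x^{(M)}\rangle|\Phi\rangle_{\bar x}$, where $|B_x^{(M)}\rangle=\binom{M+d-1}{M}^{-1/2}\sum_m|\phi_m\rangle_{\mathrm{IN}}|\phi_m\rangle_x$ and $|\phi_m\rangle$ runs over the normalised uniform superpositions of the computational basis states of $M$ spins with a given multiset $m$ of spin values (an orthonormal basis of the symmetric subspace). For real $\beta=(\beta_x)_{w_x=M}$ let $|\chi_{\beta}(\Phi)\rangle=\sum_x\beta_x|\psi_x\rangle$. Let $G_y$ be the matrix indexed by the strings of weight $M$ with entries $$(G_y)_{x,z}=\binom{M+d-1-x\cdot z+w_{\bar x\cap\bar z\cap y}}{d-1}^{-1},$$ and let $G_0$ be the case $y=0$ (the empty set of sites). Then: 1. For every real $\beta$, every unit symmetric $\Phi$ and every $y\in\{0,1\}^N$, $\langle\chi_\beta(\Phi)|\chi_\beta(\Phi)\rangle=\beta^TG_0\beta$ and $\langle\chi_\beta(\Phi)|R_y|\chi_\beta(\Phi)\rangle=\beta^TG_y\beta$.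 2. For every $\beta\ge 0$ with $\beta^TG_0\beta=1$ there is a completely positive trace preserving $\mathcal E$ with $F_y(\mathcal E)=\beta^TG_y\beta$ for all $y\in\{0,1\}^N$. 3. There is a real $\lambda$ which is at the same time the maximum eigenvalue of $R$, the maximum of $\sum_y\alpha_yF_y(\mathcal E)$ over all completely positive trace preserving $\mathcal E$, and the maximum of $\sum_y\alpha_y\,\beta^TG_y\beta$ subject to $\beta^TG_0\beta\le 1$ and $\beta\ge 0$ (all three maxima are attained). 4. Every $\beta$ attaining the last maximum satisfies $\beta^TG_0\beta=1$, and for every unit symmetric $\Phi$ the state $|\chi_\beta(\Phi)\rangle$, which lies in the span of the $|\psi_x\rangle$, is a maximum eigenvector: $R|\chi_\beta(\Phi)\rangle=\lambda|\chi_\beta(\Phi)\rangle$. If moreover every site $n$ belongs to some $x$ with $\alpha_x>0$, then every vector $v$ with $Rv=\lambda v$ is of the form $|\chi_\beta(\Phi)\rangle$ for some symmetric (not necessarily normalised) $\Phi$. -/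

import Mathlib

open MeasureTheory Matrix
open scoped Kronecker ComplexConjugate ComplexOrder

noncomputable section

namespace Cloning

/-- Computational basis labels of `n` spins of local dimension `d`. -/
abbrev Conf (d n : ℕ) : Type := Fin n → Fin d

/-- Bit strings `x ∈ {0,1}^N` of Hamming weight `M`.  A bit string is identified throughout with the
set of sites `{n : x_n = 1}`. -/
abbrev Str (N M : ℕ) : Type := {x : Finset (Fin N) // x.card = M}

/-! ### The uniform ensemble of pure states -/

/-- Unit vectors of `ℂ^d`. -/
abbrev PureState (d : ℕ) : Type := Metric.sphere (0 : EuclideanSpace ℂ (Fin d)) 1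

/-- The uniform (unitarily invariant) probability distribution on the unit sphere of `ℂ^d`, that is,
the normalised surface measure. -/
def uniformPure (d : ℕ) : Measure (PureState d) :=
  ((volume : Measure (EuclideanSpace ℂ (Fin d))).toSphere Set.univ)⁻¹ •
    (volume : Measure (EuclideanSpace ℂ (Fin d))).toSphere

/-- The projector `|ψ⟩⟨ψ|`. -/
def proj {d : ℕ} (ψ : PureState d) : Matrix (Fin d) (Fin d) ℂ :=
  Matrix.of fun i j => ψ.1 i * conj (ψ.1 j)

/-- The tensor product `A_1 ⊗ ⋯ ⊗ A_n` of one-spin operators. -/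
def tensor {d n : ℕ} (A : Fin n → Matrix (Fin d) (Fin d) ℂ) : Matrix (Conf d n) (Conf d n) ℂ :=
  Matrix.of fun b b' => ∏ k, A k (b k) (b' k)

/-- `(|ψ⟩⟨ψ|)^{⊗ M}`, the state of `M` identical copies. -/
def copies {d : ℕ} (M : ℕ) (ψ : PureState d) : Matrix (Conf d M) (Conf d M) ℂ :=
  tensor fun _ => proj ψ

/-- `|ψ⟩⟨ψ|_y ⊗ 1_{ȳ}` on `N` spins. -/
def projOn {d N : ℕ} (y : Finset (Fin N)) (ψ : PureState d) : Matrix (Conf d N) (Conf d N) ℂ :=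
  tensor fun n => if n ∈ y then proj ψ else 1

/-! ### Cloning maps and their fidelities -/

/-- The amplification `id_k ⊗ E`. -/
def amplify {m n : Type*} (E : Matrix m m ℂ →ₗ[ℂ] Matrix n n ℂ) (k : ℕ)
    (X : Matrix (Fin k × m) (Fin k × m) ℂ) : Matrix (Fin k × n) (Fin k × n) ℂ :=
  Matrix.of fun p q => E (Matrix.of fun a a' => X (p.1, a) (q.1, a')) p.2 q.2

/-- Completely positive, trace preserving maps. -/
structure IsChannel {m n : Type*} [Fintype m] [Fintype n]
    (E : Matrix m m ℂ →ₗ[ℂ] Matrix n n ℂ) : Prop where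
  completely_positive : ∀ (k : ℕ) (X : Matrix (Fin k × m) (Fin k × m) ℂ),
    X.PosSemidef → (amplify E k X).PosSemidef
  trace_preserving : ∀ X, (E X).trace = X.trace

/-- The average fidelity of the clones on the sites `y`:
`F_y(E) = ∫ Tr[(|ψ⟩⟨ψ|_y ⊗ 1) E(|ψ⟩⟨ψ|^{⊗ M})] dψ`. -/
def fidelity {d M N : ℕ}
    (E : Matrix (Conf d M) (Conf d M) ℂ →ₗ[ℂ] Matrix (Conf d N) (Conf d N) ℂ)
    (y : Finset (Fin N)) : ℝ :=
  ∫ ψ, (projOn y ψ * E (copies M ψ)).trace.re ∂(uniformPure d)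

/-! ### The cloning operator -/

/-- `R_x = C(M+d-1, M) ∫ ((|ψ⟩⟨ψ|)^{⊗ M})^T_IN ⊗ |ψ⟩⟨ψ|_x ⊗ 1_{x̄} dψ`, on IN ⊗ OUT
(the integral of a matrix is taken entrywise). -/
def R_op (d M : ℕ) {N : ℕ} (x : Finset (Fin N)) :
    Matrix (Conf d M × Conf d N) (Conf d M × Conf d N) ℂ :=
  Matrix.of fun p q => ((M + d - 1).choose M : ℂ) *
    ∫ ψ, ((copies M ψ)ᵀ ⊗ₖ projOn x ψ) p q ∂(uniformPure d)

/-- `R = ∑_x α_x R_x`. -/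
def R_total (d M : ℕ) {N : ℕ} (α : Finset (Fin N) → ℝ) :
    Matrix (Conf d M × Conf d N) (Conf d M × Conf d N) ℂ :=
  ∑ x, (α x : ℂ) • R_op d M x

/-! ### Symmetric states, Bell states, and the special states -/

/-- Membership in the symmetric subspace of `n` spins. -/
def IsSymmetric {d n : ℕ} (Φ : Conf d n → ℂ) : Prop :=
  ∀ (π : Equiv.Perm (Fin n)) (b : Conf d n), Φ (b ∘ π) = Φ b

/-- The multiset of spin values occurring in a computational basis state. -/
def content {d n : ℕ} (b : Conf d n) : Multiset (Fin d) := Finset.univ.val.map b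

/-- The symmetric basis state `|φ_m⟩` of `n` spins: the normalised uniform superposition of all
computational basis states whose multiset of spin values is `m`. As `m` ranges over all multisets
of size `n`, these form an orthonormal basis of the symmetric subspace. -/
def symBasis {d n : ℕ} (m : Sym (Fin d) n) (b : Conf d n) : ℂ :=
  if content b = (m : Multiset (Fin d)) then
    (((Finset.univ.filter fun c : Conf d n => content c = (m : Multiset (Fin d))).card : ℝ).sqrt
      : ℂ)⁻¹
  else 0

/-- The restriction of a computational basis state to a set of `k` sites, listed in increasing
order. -/
def restr {d N k : ℕ} (x : Finset (Fin N)) (hx : x.card = k) (b : Conf d N) : Conf d k :=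
  fun i => b (x.orderEmbOfFin hx i)

theorem card_compl_str {N M : ℕ} (x : Str N M) : (x.1ᶜ).card = N - M := by
  rw [Finset.card_compl, x.2, Fintype.card_fin]

/-- The amplitudes of the Bell state
`|B^{(M)}⟩ = C(M+d-1, M)^{-1/2} ∑_m |φ_m⟩_IN |φ_m⟩` on two groups of `M` spins. -/
def bell {d : ℕ} (M : ℕ) (a c : Conf d M) : ℂ :=
  ((((M + d - 1).choose M : ℝ).sqrt : ℝ) : ℂ)⁻¹ * ∑ m : Sym (Fin d) M, symBasis m a * symBasis m c

/-- The special state `|ψ_x⟩ = |B_x^{(M)}⟩ |Φ⟩_{x̄}` on IN ⊗ OUT. -/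
def special {d M N : ℕ} (Φ : Conf d (N - M) → ℂ) (x : Str N M) : Conf d M × Conf d N → ℂ :=
  fun p => bell M p.1 (restr x.1 x.2 p.2) * Φ (restr x.1ᶜ (card_compl_str x) p.2)

/-- `|χ⟩ = ∑_x β_x |ψ_x⟩`. -/
def chi {d M N : ℕ} (β : Str N M → ℝ) (Φ : Conf d (N - M) → ℂ) : Conf d M × Conf d N → ℂ :=
  ∑ x, (β x : ℂ) • special Φ x

/-- The matrix `G_y^{(M)}`, with entries `1 / C(M+d-1-x·z+w_{x̄∩z̄∩y}, d-1)`. -/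
def G (d : ℕ) {M N : ℕ} (y : Finset (Fin N)) : Matrix (Str N M) (Str N M) ℝ :=
  Matrix.of fun x z =>
    (((M + d - 1 - (x.1 ∩ z.1).card + (x.1ᶜ ∩ z.1ᶜ ∩ y).card).choose (d - 1) : ℕ) : ℝ)⁻¹

/-- The quadratic form `βᵀ G_y β`. -/
def quad (d : ℕ) {M N : ℕ} (y : Finset (Fin N)) (β : Str N M → ℝ) : ℝ := β ⬝ᵥ (G d y *ᵥ β)

end Cloning

end

open Cloning

open MeasureTheory Matrix
open scoped Kronecker ComplexConjugate ComplexOrder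

namespace Cloning

/-! The proof is a Perron–Frobenius argument combined with unitary symmetry.

Moments of the uniform distribution count permutations, so averages of `|ψ⟩⟨ψ|^{⊗n}` are symmetric
projectors divided by their dimension. In particular the Bell state is an average of `ψ̄^{⊗M} ⊗
ψ^{⊗M}` (`bell_eq_integral`), and contracting its input half with `η^{⊗M}` places `η` on the sites
of `x` (`sum_pw_mul_special`). Symmetric vectors are spanned by product vectors, so identities about
special states need only be checked on these. This gives the matrix elements `G_y`
(`star_special_dotProduct_R_op_special`). It also gives the key structural fact
(`R_op_mulVec_special`): `R_y` sends a special state to a nonnegative combination of special states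
with the same `Φ`. Thus the cone of all `χ_β(Φ)` with `β ≥ 0` is invariant under `R`.

Let `λ` be the value of the quadratic programme, attained by compactness. On the cone the Rayleigh
quotient of `R` is at most `λ`; applied to both `w` and `Rw`, together with `R ≥ 0`, this yields
`‖Rw‖ ≤ λ‖w‖`, hence `‖R^k w‖ ≤ λ^k ‖w‖`. In the computational basis `R` has nonnegative entries and
preserves the weight (output minus input occupation numbers). If the weight is nonnegative, the cone
contains a vector positive on the whole sector; it dominates any eigenvector `v` there, and
comparing the growth of `R^k` gives `|μ| ≤ λ` (`norm_le_of_inSector`). An eigenvector in any other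
sector is moved, without changing its eigenvalue, by raising operators of `gl_d`, which commute with
`R`; as the total weight `N - M` is positive, an `sl_2` norm identity keeps the image nonzero
(`exists_raise`). So `λ - R ≥ 0`, and a maximiser `β`, which attains the Rayleigh quotient `λ`,
gives eigenvectors.

For channels, the fidelity is the pairing of `R_y` with the Choi matrix; compressing `λ - R ≥ 0` to
symmetric inputs bounds it by `λ` (`sum_mul_fidelity_le`). Conversely the vectors `χ_β(Φ)`, read as
operators from input to output with `Φ` running over a tight frame, are Kraus operators of a channel
with fidelities `βᵀ G_y β`.

If every site is tested, `R` is irreducible on each sector of nonnegative weight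
(`reach_of_weight_eq`), so the eigenvector there is unique. In a sector with a negative weight, a
maximum eigenvector could be raised to a known one that the adjoint lowering operator annihilates, a
contradiction (`nonneg_of_inSector`). -/

/-! ### Gaussian integrals and moments of the uniform distribution on the sphere. -/

open Nat in
theorem integral_monomial_gaussian (p q : ℕ) :
    ∫ z : ℂ, z ^ p * conj z ^ q * (Real.exp (-‖z‖ ^ 2) : ℂ) =
      if p = q then (Real.pi : ℂ) * (p ! : ℂ) else 0 := by
  split_ifs with h
  · subst h
    have h1 : ∀ z : ℂ, z ^ p * conj z ^ p * (Real.exp (-‖z‖ ^ 2) : ℂ) =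
        ((‖z‖ ^ ((2 * p : ℕ) : ℝ) * Real.exp (-‖z‖ ^ (2 : ℝ)) : ℝ) : ℂ) := by
      intro z
      rw [← mul_pow, Complex.mul_conj, Real.rpow_natCast, Real.rpow_two, Complex.normSq_eq_norm_sq,
        pow_mul]
      push_cast
      rfl
    simp_rw [h1]
    rw [integral_complex_ofReal, Complex.integral_rpow_mul_exp_neg_rpow (by norm_num)
      (by have : (0 : ℝ) ≤ ((2 * p : ℕ) : ℝ) := Nat.cast_nonneg _
          linarith)]
    have h2 : (((2 * p : ℕ) : ℝ) + 2) / 2 = p + 1 := by push_cast; ring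
    rw [h2, Real.Gamma_nat_eq_factorial]
    push_cast
    ring
  · have hpq : ((p : ℂ) - q) ≠ 0 := by
      rw [sub_ne_zero]
      exact_mod_cast h
    -- At this angle `e^{i(p-q)t} = -1`, so a rotation that preserves the measure changes the sign
    -- of the integrand.
    set t : ℝ := Real.pi / ((p : ℝ) - q) with ht
    set u : Circle := Circle.exp t with hu
    have hupow : (u : ℂ) ^ p * conj (u : ℂ) ^ q = -1 := by
      rw [hu, Circle.coe_exp, ← Complex.exp_conj, ← Complex.exp_nat_mul, ← Complex.exp_nat_mul,
        ← Complex.exp_add, ← Complex.exp_pi_mul_I]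
      congr 1
      simp only [map_mul, Complex.conj_ofReal, Complex.conj_I, ht]
      push_cast
      field_simp
      ring
    have h3 := (LinearIsometryEquiv.measurePreserving (rotation u)).integral_comp'
      (f := (rotation u).toHomeomorph.toMeasurableEquiv)
      (fun z : ℂ => z ^ p * conj z ^ q * (Real.exp (-‖z‖ ^ 2) : ℂ))
    have h4 : ∀ z : ℂ, (rotation u).toHomeomorph.toMeasurableEquiv z = u * z := fun z => rfl
    simp only [h4] at h3
    have h5 : ∀ z : ℂ, (u * z : ℂ) ^ p * conj (u * z : ℂ) ^ q *
        (Real.exp (-‖(u * z : ℂ)‖ ^ 2) : ℂ) =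
        -(z ^ p * conj z ^ q * (Real.exp (-‖z‖ ^ 2) : ℂ)) := by
      intro z
      rw [norm_mul, Circle.norm_coe, one_mul, map_mul, mul_pow, mul_pow]
      linear_combination (z ^ p * conj z ^ q * (Real.exp (-‖z‖ ^ 2) : ℂ)) * hupow
    simp_rw [h5, integral_neg] at h3
    exact self_eq_neg.mp h3.symm

/-- Separating the radius from the direction turns a Gaussian integral of a homogeneous function
into its integral over the sphere times an explicit radial factor. -/
theorem integral_polar {E : Type*} [NormedAddCommGroup E] [NormedSpace ℝ E] [MeasurableSpace E]
    [BorelSpace E] [FiniteDimensional ℝ E] [Nontrivial E] (μ : Measure E) [μ.IsAddHaarMeasure]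
    (f : E → ℂ) (g : ℝ → ℂ) (n : ℕ) (hf : ∀ r : ℝ, 0 < r → ∀ x, f (r • x) = (r : ℂ) ^ n * f x) :
    ∫ x, f x * g ‖x‖ ∂μ = (∫ u : Metric.sphere (0 : E) 1, f u.1 ∂μ.toSphere) *
      ∫ r in Set.Ioi (0 : ℝ), (r : ℂ) ^ (Module.finrank ℝ E - 1 + n) * g r := by
  calc
    ∫ x, f x * g ‖x‖ ∂μ = ∫ x : ({(0)}ᶜ : Set E), f x.1 * g ‖x.1‖ ∂(μ.comap (↑)) := by
      rw [integral_subtype_comap (measurableSet_singleton _).compl fun x ↦ f x * g ‖x‖,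
        restrict_compl_singleton]
    _ = ∫ x, f x.1.1 * (((x.2.1 : ℝ) : ℂ) ^ n * g x.2.1)
          ∂μ.toSphere.prod (.volumeIoiPow (Module.finrank ℝ E - 1)) := by
      rw [← μ.measurePreserving_homeomorphUnitSphereProd.integral_comp
        (Homeomorph.measurableEmbedding _)]
      refine integral_congr_ae (Filter.Eventually.of_forall fun x => ?_)
      have hx : 0 < ‖x.1‖ := norm_pos_iff.2 x.2
      have hx' : (‖x.1‖ : ℂ) ≠ 0 := by exact_mod_cast hx.ne'
      have h1 : f x.1 = (‖x.1‖ : ℂ) ^ n * f (‖x.1‖⁻¹ • x.1) := by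
        rw [← hf _ hx, smul_smul, mul_inv_cancel₀ hx.ne', one_smul]
      simp only [homeomorphUnitSphereProd_apply_snd_coe, homeomorphUnitSphereProd_apply_fst_coe]
      rw [h1]
      ring
    _ = _ := by
      rw [integral_prod_mul (fun u : Metric.sphere (0 : E) 1 => f u.1)
        (fun r : Set.Ioi (0 : ℝ) => ((r.1 : ℝ) : ℂ) ^ n * g r.1)]
      congr 1
      simp only [Measure.volumeIoiPow, ENNReal.ofReal]
      rw [integral_withDensity_eq_integral_smul,
        integral_subtype_comap measurableSet_Ioi
          fun a ↦ Real.toNNReal (a ^ (Module.finrank ℝ E - 1)) • ((a : ℂ) ^ n * g a),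
        setIntegral_congr_fun measurableSet_Ioi fun x hx ↦ ?_]
      · rw [NNReal.smul_def, Real.coe_toNNReal _ (pow_nonneg hx.out.le _), Complex.real_smul]
        push_cast
        ring
      · exact (measurable_subtype_coe.pow_const _).real_toNNReal

open Nat in
theorem integral_radial_gaussian (m : ℕ) :
    ∫ r in Set.Ioi (0 : ℝ), (r : ℂ) ^ (2 * m + 1) * (Real.exp (-r ^ 2) : ℂ) =
      (m ! : ℂ) / 2 := by
  have h1 : ∀ r ∈ Set.Ioi (0 : ℝ), (r : ℂ) ^ (2 * m + 1) * (Real.exp (-r ^ 2) : ℂ) =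
      ((r ^ ((2 * m + 1 : ℕ) : ℝ) * Real.exp (-r ^ (2 : ℝ)) : ℝ) : ℂ) := by
    intro r hr
    rw [Real.rpow_natCast, Real.rpow_two]
    push_cast
    rfl
  rw [setIntegral_congr_fun measurableSet_Ioi h1, integral_complex_ofReal,
    integral_rpow_mul_exp_neg_rpow (by norm_num)
      (by have : (0 : ℝ) ≤ ((2 * m + 1 : ℕ) : ℝ) := Nat.cast_nonneg _
          linarith)]
  have h2 : (((2 * m + 1 : ℕ) : ℝ) + 1) / 2 = m + 1 := by push_cast; ring
  rw [h2, Real.Gamma_nat_eq_factorial]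
  push_cast
  ring

instance uniformPure_isProbabilityMeasure {d : ℕ} [NeZero d] :
    IsProbabilityMeasure (uniformPure d) := by
  have : Nontrivial (EuclideanSpace ℂ (Fin d)) := inferInstance
  refine ⟨?_⟩
  rw [uniformPure, Measure.smul_apply, smul_eq_mul]
  refine ENNReal.inv_mul_cancel ?_ (measure_ne_top _ _)
  rw [Ne, Measure.measure_univ_eq_zero]
  exact Measure.toSphere_ne_zero _

/-- Continuous functions on the sphere are integrable. -/
theorem integrable_uniformPure {d : ℕ} [NeZero d] {f : PureState d → ℂ} (hf : Continuous f) :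
    Integrable f (uniformPure d) :=
  hf.integrable_of_hasCompactSupport (HasCompactSupport.of_compactSpace f)

open Nat in
/-- Moments of the uniform distribution, by exponents. -/
theorem integral_monomial_uniformPure {d : ℕ} [NeZero d] (p q : Fin d → ℕ) (n : ℕ)
    (hp : ∑ i, p i = n) (hq : ∑ i, q i = n) :
    ∫ ψ, ∏ i, (ψ.1 i ^ p i * conj (ψ.1 i) ^ q i) ∂(uniformPure d) =
      if p = q then (∏ i, ((p i) ! : ℂ)) * ((d - 1)! : ℂ) / ((n + d - 1)! : ℂ) else 0 := by
  have hd : 1 ≤ d := NeZero.one_le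
  have hdim : Module.finrank ℝ (EuclideanSpace ℂ (Fin d)) = 2 * d := by
    rw [← Module.finrank_mul_finrank ℝ ℂ (EuclideanSpace ℂ (Fin d)), Complex.finrank_real_complex]
    rw [finrank_euclideanSpace_fin]
  set e := (PiLp.continuousLinearEquiv 2 ℝ (fun _ : Fin d => ℂ)).symm with he
  have hHaar : ((volume : Measure (Fin d → ℂ)).map e).IsAddHaarMeasure :=
    e.isAddHaarMeasure_map _
  -- The Euclidean volume and the product measure are both Haar measures; their ratio need not be
  -- known, since it cancels at the end.
  set κ := Measure.addHaarScalarFactor (volume : Measure (EuclideanSpace ℂ (Fin d)))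
    ((volume : Measure (Fin d → ℂ)).map e)
  have hκ : (volume : Measure (EuclideanSpace ℂ (Fin d))) = κ • ((volume : Measure (Fin d → ℂ)).map e) :=
    Measure.isAddLeftInvariant_eq_smul _ _
  have hgauss : ∀ p q : Fin d → ℕ, ∫ x : (EuclideanSpace ℂ (Fin d)), (∏ i, (x i ^ p i * conj (x i) ^ q i)) *
      (Real.exp (-‖x‖ ^ 2) : ℂ) =
      (κ : ℂ) * ∏ i, if p i = q i then (Real.pi : ℂ) * ((p i)! : ℂ) else 0 := by
    intro p q
    rw [hκ, integral_smul_nnreal_measure,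
      show ⇑e = ⇑e.toHomeomorph from rfl, e.toHomeomorph.measurableEmbedding.integral_map]
    simp_rw [← integral_monomial_gaussian]
    rw [← integral_fintype_prod_volume_eq_prod, NNReal.smul_def, Complex.real_smul]
    congr 2
    ext z
    have h1 : ‖e z‖ ^ 2 = ∑ i, ‖z i‖ ^ 2 := EuclideanSpace.norm_sq_eq (e z)
    have h2 : ∀ i, (e z) i = z i := fun i => rfl
    simp only [ContinuousLinearEquiv.coe_toHomeomorph]
    rw [h1, ← Finset.sum_neg_distrib, Real.exp_sum, Complex.ofReal_prod]
    simp only [h2]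
    rw [← Finset.prod_mul_distrib]
  have hκ0 : (κ : ℂ) ≠ 0 := by
    intro h0
    have : κ = 0 := by exact_mod_cast h0
    rw [this, zero_smul] at hκ
    exact NeZero.ne (volume : Measure (EuclideanSpace ℂ (Fin d))) hκ
  have hpolar : ∀ (p q : Fin d → ℕ) (n : ℕ), ∑ i, p i = n → ∑ i, q i = n →
      (∫ u : Metric.sphere (0 : (EuclideanSpace ℂ (Fin d))) 1, ∏ i, (u.1 i ^ p i * conj (u.1 i) ^ q i)
        ∂(volume : Measure (EuclideanSpace ℂ (Fin d))).toSphere) * (((n + d - 1)! : ℂ) / 2) =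
      (κ : ℂ) * ∏ i, if p i = q i then (Real.pi : ℂ) * ((p i)! : ℂ) else 0 := by
    intro p q n hp hq
    -- The monomial has degree `2n` and the real dimension is `2d`, so the radial exponent is `2d -
    -- 1 + 2n = 2(n + d - 1) + 1`.
    rw [← hgauss, integral_polar volume (fun x : (EuclideanSpace ℂ (Fin d)) => ∏ i, (x i ^ p i * conj (x i) ^ q i))
      (fun r => (Real.exp (-r ^ 2) : ℂ)) (2 * n), hdim, ← integral_radial_gaussian]
    · congr 3
      ext r
      congr 2
      omega
    · intro r _ x
      have : ∀ i, ((r • x) i) ^ p i * conj ((r • x) i) ^ q i =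
          ((r : ℂ) ^ p i * (r : ℂ) ^ q i) * (x i ^ p i * conj (x i) ^ q i) := by
        intro i
        rw [PiLp.smul_apply, Complex.real_smul, map_mul, Complex.conj_ofReal]
        ring
      simp_rw [this]
      rw [Finset.prod_mul_distrib, Finset.prod_mul_distrib, Finset.prod_pow_eq_pow_sum,
        Finset.prod_pow_eq_pow_sum, hp, hq, two_mul, pow_add]
  -- The constant monomial measures the whole sphere; dividing by it normalises and removes `κ` and
  -- the powers of `π`.
  have h0 := hpolar (fun _ => 0) (fun _ => 0) 0 (by simp) (by simp)
  have h1 := hpolar p q n hp hq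
  have hf : ∀ m : ℕ, (m ! : ℂ) ≠ 0 := fun m => by exact_mod_cast m.factorial_ne_zero
  have hpi : (Real.pi : ℂ) ≠ 0 := by exact_mod_cast Real.pi_ne_zero
  simp only [pow_zero, mul_one, Finset.prod_const_one, if_true, Nat.factorial_zero, Nat.cast_one,
    integral_const, Finset.prod_const, Finset.card_univ, Fintype.card_fin, zero_add] at h0
  rw [uniformPure, integral_smul_measure]
  set s := (volume : Measure (EuclideanSpace ℂ (Fin d))).toSphere.real Set.univ with hs
  have hs' : ((((volume : Measure (EuclideanSpace ℂ (Fin d))).toSphere Set.univ)⁻¹).toReal : ℂ) = (s : ℂ)⁻¹ := by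
    rw [ENNReal.toReal_inv, hs, Measure.real]
    push_cast
    rfl
  rw [Complex.real_smul, hs']
  have h0' : (s : ℂ) * (((d - 1)! : ℂ) / 2) = κ * (Real.pi : ℂ) ^ d := by
    simpa using h0
  have hs0 : (s : ℂ) ≠ 0 := by
    intro h
    rw [h, zero_mul] at h0'
    exact (mul_ne_zero hκ0 (pow_ne_zero _ hpi)) h0'.symm
  set S := ∫ u : Metric.sphere (0 : (EuclideanSpace ℂ (Fin d))) 1, ∏ i, (u.1 i ^ p i * conj (u.1 i) ^ q i)
        ∂(volume : Measure (EuclideanSpace ℂ (Fin d))).toSphere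
  split_ifs with hpq
  · subst hpq
    simp only [if_true, Finset.prod_mul_distrib, Finset.prod_const, Finset.card_univ,
      Fintype.card_fin] at h1
    rw [inv_mul_eq_div, div_eq_div_iff hs0 (hf _)]
    linear_combination 2 * h1 - 2 * (∏ i, ((p i)! : ℂ)) * h0'
  · obtain ⟨i, hi⟩ : ∃ i, p i ≠ q i := by
      by_contra! h
      exact hpq (funext h)
    rw [Finset.prod_eq_zero (Finset.mem_univ i) (by rw [if_neg hi]), mul_zero] at h1
    have : S = 0 := by
      rcases mul_eq_zero.mp h1 with h | h
      · exact h
      · exact absurd h (div_ne_zero (hf _) two_ne_zero)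
    rw [this, mul_zero]

/-! ### Overlaps of vectors and moments as permutation counts. -/

/-- The components of a pure state. -/
abbrev vec {d : ℕ} (ψ : PureState d) : Fin d → ℂ := ψ.1.ofLp

/-- The scalar product of two one-spin vectors. -/
noncomputable def braket {d : ℕ} (θ η : Fin d → ℂ) : ℂ := ∑ s, conj (θ s) * η s

@[fun_prop]
theorem continuous_vec {d : ℕ} : Continuous (vec : PureState d → Fin d → ℂ) :=
  (PiLp.continuous_ofLp 2 _).comp continuous_subtype_val

@[fun_prop]
theorem continuous_vec_apply {d : ℕ} (s : Fin d) :
    Continuous fun ψ : PureState d => vec ψ s :=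
  (continuous_apply s).comp continuous_vec

@[fun_prop]
theorem continuous_conj_vec_apply {d : ℕ} (s : Fin d) :
    Continuous fun ψ : PureState d => conj (vec ψ s) :=
  Complex.continuous_conj.comp (continuous_vec_apply s)

@[fun_prop]
theorem continuous_braket_left {d : ℕ} (η : Fin d → ℂ) :
    Continuous fun ψ : PureState d => braket (vec ψ) η := by
  unfold braket
  fun_prop

@[fun_prop]
theorem continuous_braket_right {d : ℕ} (η : Fin d → ℂ) :
    Continuous fun ψ : PureState d => braket η (vec ψ) := by
  unfold braket
  fun_prop

theorem braket_vec_self {d : ℕ} (ψ : PureState d) : braket (vec ψ) (vec ψ) = 1 := by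
  have h : ‖ψ.1‖ = 1 := norm_eq_of_mem_sphere ψ
  have h2 := EuclideanSpace.norm_sq_eq ψ.1
  rw [h] at h2
  unfold braket
  have : ∀ s, conj (vec ψ s) * vec ψ s = ((‖ψ.1 s‖ ^ 2 : ℝ) : ℂ) := fun s => by
    rw [mul_comm, Complex.mul_conj, Complex.normSq_eq_norm_sq]
  simp_rw [this]
  rw [← Complex.ofReal_sum, ← h2]
  norm_num

theorem prod_sum_fun {R ι κ : Type*} [CommSemiring R] [Fintype ι] [DecidableEq ι] [Fintype κ]
    (f : ι → κ → R) : ∏ i, ∑ s, f i s = ∑ c : ι → κ, ∏ i, f i (c i) := by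
  rw [Finset.prod_univ_sum, Fintype.piFinset_univ]

theorem exists_perm_of_fiber_card_eq {ι κ : Type*} [Fintype ι] [DecidableEq κ] (a c : ι → κ)
    (h : ∀ s, (Finset.univ.filter fun i => a i = s).card =
      (Finset.univ.filter fun i => c i = s).card) : ∃ π : Equiv.Perm ι, a ∘ π = c := by
  have e : ∀ s, Nonempty ({i // c i = s} ≃ {i // a i = s}) := fun s =>
    ⟨Fintype.equivOfCardEq (by rw [Fintype.card_subtype, Fintype.card_subtype, h s])⟩
  exact ⟨Equiv.ofFiberEquiv fun s => (e s).some,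
    funext fun i => Equiv.ofFiberEquiv_map (fun s => (e s).some) i⟩

theorem fiber_card_comp_perm {ι κ : Type*} [Fintype ι] [DecidableEq κ] (a : ι → κ) (π : Equiv.Perm ι) (s : κ) :
    (Finset.univ.filter fun i => (a ∘ π) i = s).card =
      (Finset.univ.filter fun i => a i = s).card :=
  Finset.card_bij (fun i _ => π i) (by simp) (by simp)
    (fun i hi => ⟨π.symm i, by simpa using hi, by simp⟩)

/-- Right multiplication by `π⁻¹` maps these permutations onto the stabiliser of `a`, a product of
symmetric groups on the fibres. -/
theorem card_perm_comp_eq {ι κ : Type*} [Fintype ι] [DecidableEq ι] [Fintype κ]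
    [DecidableEq κ] (a : ι → κ) (π : Equiv.Perm ι) :
    (Finset.univ.filter fun σ : Equiv.Perm ι => a ∘ σ = a ∘ π).card =
      ∏ s, (Finset.univ.filter fun i => a i = s).card.factorial := by
  have h := DomMulAct.stabilizer_card a
  simp_rw [Fintype.card_subtype] at h
  rw [← h]
  refine Finset.card_bij (fun σ _ => σ * π⁻¹) ?_ ?_ ?_
  · intro σ hσ
    simp only [Finset.mem_filter, Finset.mem_univ, true_and] at hσ ⊢
    ext i
    have := congrFun hσ (π⁻¹ i)
    simpa using this
  · intro σ _ τ _ h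
    exact mul_right_cancel h
  · intro σ hσ
    simp only [Finset.mem_filter, Finset.mem_univ, true_and] at hσ
    refine ⟨σ * π, ?_, by simp⟩
    simp only [Finset.mem_filter, Finset.mem_univ, true_and]
    ext i
    have := congrFun hσ (π i)
    simpa using this

open Nat in
/-- Moments of the uniform distribution as a sum over permutations. -/
theorem integral_prod_mul_prod_conj {d : ℕ} [NeZero d] {ι : Type*} [Fintype ι] [DecidableEq ι]
    (a c : ι → Fin d) :
    ∫ ψ, (∏ i, vec ψ (a i)) * ∏ i, conj (vec ψ (c i)) ∂(uniformPure d) =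
      ((d - 1)! : ℂ) / ((Fintype.card ι + d - 1)! : ℂ) *
        ((Finset.univ.filter fun π : Equiv.Perm ι => a ∘ π = c).card : ℂ) := by
  have hsum : ∀ a : ι → Fin d,
      ∑ s, (Finset.univ.filter fun i => a i = s).card = Fintype.card ι := fun a => by
    rw [← Finset.card_eq_sum_card_fiberwise (f := a) (t := Finset.univ) (by simp)]
    rfl
  have hprod : ∀ (g : Fin d → ℂ) (a : ι → Fin d),
      ∏ i, g (a i) = ∏ s, g s ^ (Finset.univ.filter fun i => a i = s).card := by
    intro g a
    rw [← Finset.prod_fiberwise (s := Finset.univ) (g := a)]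
    refine Finset.prod_congr rfl fun s _ => ?_
    rw [Finset.prod_congr rfl (g := fun _ => g s), Finset.prod_const]
    intro i hi
    rw [(Finset.mem_filter.mp hi).2]
  have key := integral_monomial_uniformPure (d := d)
    (fun s => (Finset.univ.filter fun i => a i = s).card)
    (fun s => (Finset.univ.filter fun i => c i = s).card) _ (hsum a) (hsum c)
  have hint : ∀ ψ : PureState d, (∏ i, vec ψ (a i)) * ∏ i, conj (vec ψ (c i)) =
      ∏ s, (ψ.1 s ^ (Finset.univ.filter fun i => a i = s).card *
        conj (ψ.1 s) ^ (Finset.univ.filter fun i => c i = s).card) := fun ψ => by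
    rw [hprod (vec ψ), hprod (fun s => conj (vec ψ s)), Finset.prod_mul_distrib]
  simp_rw [hint]
  rw [key]
  by_cases h : ∃ π : Equiv.Perm ι, a ∘ π = c
  · obtain ⟨π, rfl⟩ := h
    rw [if_pos (funext fun s => (fiber_card_comp_perm a π s).symm), card_perm_comp_eq]
    push_cast
    ring
  · rw [if_neg (fun h' => h (exists_perm_of_fiber_card_eq a c (fun s => congrFun h' s))),
      Finset.filter_false_of_mem (fun π _ hπ => h ⟨π, hπ⟩)]
    simp

/-- Contracting all conjugated factors with a fixed vector. -/
theorem integral_prod_mul_braket_pow {d : ℕ} [NeZero d] {ι : Type*} [Fintype ι] (n : ℕ)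
    (hn : Fintype.card ι = n) (a : ι → Fin d) (η : Fin d → ℂ) :
    ∫ ψ, (∏ i, vec ψ (a i)) * braket (vec ψ) η ^ n ∂(uniformPure d) =
      ((n + d - 1).choose n : ℂ)⁻¹ * ∏ i, η (a i) := by
  classical
  have h1 : ∀ ψ : PureState d, (∏ i, vec ψ (a i)) * braket (vec ψ) η ^ n =
      ∑ c : ι → Fin d, ((∏ i, vec ψ (a i)) * ∏ i, conj (vec ψ (c i))) * ∏ i, η (c i) := by
    intro ψ
    have : braket (vec ψ) η ^ n = ∏ _i : ι, braket (vec ψ) η := by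
      rw [Finset.prod_const, Finset.card_univ, hn]
    rw [this]
    unfold braket
    rw [prod_sum_fun, Finset.mul_sum]
    refine Finset.sum_congr rfl fun c _ => ?_
    rw [Finset.prod_mul_distrib]
    ring
  simp_rw [h1]
  rw [integral_finsetSum _ fun c _ => integrable_uniformPure (by fun_prop)]
  simp_rw [integral_mul_const, integral_prod_mul_prod_conj, hn]
  have h2 : ∑ c : ι → Fin d, (((Finset.univ.filter fun π : Equiv.Perm ι => a ∘ π = c).card : ℕ) : ℂ)
      * ∏ i, η (c i) = (n.factorial : ℂ) * ∏ i, η (a i) := by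
    have : ∀ c : ι → Fin d, (((Finset.univ.filter fun π : Equiv.Perm ι => a ∘ π = c).card : ℕ) : ℂ)
      * ∏ i, η (c i) = ∑ π : Equiv.Perm ι, if a ∘ π = c then ∏ i, η (c i) else 0 := by
      intro c
      rw [← Finset.sum_filter, Finset.sum_const, nsmul_eq_mul]
    simp_rw [this]
    rw [Finset.sum_comm]
    simp only [Finset.sum_ite_eq, Finset.mem_univ, if_true, Function.comp_apply]
    have : ∀ π : Equiv.Perm ι, ∏ i, η (a (π i)) = ∏ i, η (a i) := fun π =>
      Equiv.prod_comp π (fun i => η (a i))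
    simp_rw [this]
    rw [Finset.sum_const, Finset.card_univ, Fintype.card_perm, hn, nsmul_eq_mul]
  simp_rw [mul_assoc]
  rw [← Finset.mul_sum, h2]
  have hd : 1 ≤ d := NeZero.one_le
  have hc := Nat.choose_mul_factorial_mul_factorial (n := n + d - 1) (k := n) (by omega)
  rw [show n + d - 1 - n = d - 1 by omega] at hc
  have hc' : ((n + d - 1).choose n : ℂ) * (n.factorial : ℂ) * ((d - 1).factorial : ℂ) =
    ((n + d - 1).factorial : ℂ) := by exact_mod_cast hc
  have hf : ∀ m : ℕ, (m.factorial : ℂ) ≠ 0 := fun m => by exact_mod_cast m.factorial_ne_zero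
  have hC : ((n + d - 1).choose n : ℂ) ≠ 0 := by
    exact_mod_cast (Nat.choose_pos (by omega)).ne'
  rw [← hc']
  field_simp [hf, hC]

/-! ### Invariance of the uniform distribution under isometries. -/

open scoped Pointwise in
/-- The uniform distribution is invariant under isometries. -/
theorem integral_comp_isometry {d : ℕ}
    (T : EuclideanSpace ℂ (Fin d) ≃ₗᵢ[ℝ] EuclideanSpace ℂ (Fin d))
    (T' : PureState d → PureState d) (hT' : ∀ ψ, (T' ψ).1 = T ψ.1) (f : PureState d → ℂ)
    (hf : Continuous f) :
    ∫ ψ, f (T' ψ) ∂(uniformPure d) = ∫ ψ, f ψ ∂(uniformPure d) := by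
  have hTc : Continuous T' := by
    rw [continuous_induced_rng]
    exact (T.continuous.comp continuous_subtype_val).congr fun ψ => (hT' ψ).symm
  have hmp : MeasurePreserving T' (uniformPure d) (uniformPure d) := by
    refine MeasurePreserving.smul_measure ⟨hTc.measurable, ?_⟩ _
    ext s hs
    rw [Measure.map_apply hTc.measurable hs, Measure.toSphere_apply' _ hs,
      Measure.toSphere_apply' _ (hTc.measurable hs)]
    congr 1
    -- The surface measure is defined by the volume of the cone over a set, and a linear isometry
    -- maps cones to cones.
    have hset : Set.Ioo (0 : ℝ) 1 • (Subtype.val '' (T' ⁻¹' s)) =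
        T ⁻¹' (Set.Ioo (0 : ℝ) 1 • (Subtype.val '' s)) := by
      ext x
      simp only [Set.mem_smul, Set.mem_image, Set.mem_preimage]
      constructor
      · rintro ⟨r, hr, _, ⟨ψ, hψ, rfl⟩, rfl⟩
        exact ⟨r, hr, _, ⟨T' ψ, hψ, rfl⟩, by rw [hT', map_smul]⟩
      · rintro ⟨r, hr, _, ⟨ψ, hψ, rfl⟩, hx⟩
        have hmem : T.symm ψ.1 ∈ Metric.sphere (0 : EuclideanSpace ℂ (Fin d)) 1 := by
          simp [norm_eq_of_mem_sphere ψ]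
        refine ⟨r, hr, _, ⟨⟨T.symm ψ.1, hmem⟩, ?_, rfl⟩, ?_⟩
        · have : T' ⟨T.symm ψ.1, hmem⟩ = ψ := Subtype.ext (by rw [hT']; simp)
          simpa [this] using hψ
        · apply T.injective
          rw [← hx, map_smul]
          simp
    rw [hset]
    exact (T.measurePreserving).measure_preimage_equiv (f := T.toHomeomorph.toMeasurableEquiv) _
  rw [← hmp.map_eq]
  conv_rhs => rw [integral_map hmp.measurable.aemeasurable hf.aestronglyMeasurable]
  rw [hmp.map_eq]

/-! ### Symmetric vectors and Bell states -/

/-- The product vector `φ ⊗ ⋯ ⊗ φ`. -/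
def pw {d n : ℕ} (φ : Fin d → ℂ) : Conf d n → ℂ := fun b => ∏ k, φ (b k)

/-- The square root of the dimension of the symmetric subspace. -/
noncomputable def nrm (d M : ℕ) : ℂ := ((((M + d - 1).choose M : ℝ).sqrt : ℝ) : ℂ)

theorem choose_ne_zero (d n : ℕ) [NeZero d] : ((n + d - 1).choose n : ℂ) ≠ 0 := by
  have hd : 1 ≤ d := NeZero.one_le
  exact_mod_cast (Nat.choose_pos (by omega)).ne'

theorem nrm_mul_self (d M : ℕ) : nrm d M * nrm d M = ((M + d - 1).choose M : ℂ) := by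
  rw [nrm, ← Complex.ofReal_mul, Real.mul_self_sqrt (Nat.cast_nonneg _)]
  simp

theorem nrm_ne_zero (d M : ℕ) [NeZero d] : nrm d M ≠ 0 := by
  intro h
  have := nrm_mul_self d M
  rw [h, zero_mul] at this
  exact choose_ne_zero d M this.symm

theorem conj_nrm (d M : ℕ) : conj (nrm d M) = nrm d M := Complex.conj_ofReal _

-- The dimension of the symmetric subspace times the moment constant is `1/n!`: the rescaled average
-- of `|ψ⟩⟨ψ|^{⊗n}` is the mean of all permutations, the symmetric projector.
open Nat in
theorem choose_mul_moment (d n : ℕ) [NeZero d] :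
    ((n + d - 1).choose n : ℂ) * (((d - 1)! : ℂ) / ((n + d - 1)! : ℂ)) = (n ! : ℂ)⁻¹ := by
  have hd : 1 ≤ d := NeZero.one_le
  have hc := Nat.choose_mul_factorial_mul_factorial (n := n + d - 1) (k := n) (by omega)
  rw [show n + d - 1 - n = d - 1 by omega] at hc
  have hc' : ((n + d - 1).choose n : ℂ) * (n ! : ℂ) * ((d - 1)! : ℂ) = ((n + d - 1)! : ℂ) := by
    exact_mod_cast hc
  have hf : ∀ m : ℕ, (m ! : ℂ) ≠ 0 := fun m => by exact_mod_cast m.factorial_ne_zero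
  have hC := choose_ne_zero d n
  rw [← hc']
  field_simp [hf, hC]

theorem content_eq_iff {d n : ℕ} (a c : Conf d n) :
    content a = content c ↔ ∃ π : Equiv.Perm (Fin n), a ∘ π = c := by
  have hcount : ∀ (a : Conf d n) s, (content a).count s =
      (Finset.univ.filter fun i => a i = s).card := by
    intro a s
    rw [content, Multiset.count_map, Finset.card_def, Finset.filter_val]
    simp_rw [eq_comm]
  constructor
  · intro h
    exact exists_perm_of_fiber_card_eq a c fun s => by rw [← hcount, ← hcount, h]
  · rintro ⟨π, rfl⟩
    ext s
    rw [hcount, hcount, fiber_card_comp_perm]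

-- Orbit–stabiliser: the permutations are fibred over the orbit of `a` with fibres of equal size.
open Nat in
theorem card_content_mul {d n : ℕ} (a c : Conf d n) (h : content a = content c) :
    (Finset.univ.filter fun c : Conf d n => content c = content a).card *
      (Finset.univ.filter fun π : Equiv.Perm (Fin n) => a ∘ π = c).card = n ! := by
  have h1 : ∀ e ∈ (Finset.univ.filter fun c : Conf d n => content c = content a),
      (Finset.univ.filter fun π : Equiv.Perm (Fin n) => a ∘ π = e).card =
      (Finset.univ.filter fun π : Equiv.Perm (Fin n) => a ∘ π = c).card := by
    intro e he
    obtain ⟨π, rfl⟩ := (content_eq_iff a e).mp (Finset.mem_filter.mp he).2.symm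
    obtain ⟨σ, rfl⟩ := (content_eq_iff a c).mp h
    rw [card_perm_comp_eq, card_perm_comp_eq]
  rw [← smul_eq_mul, ← Finset.sum_const, ← Finset.sum_congr rfl h1,
    ← Finset.card_eq_sum_card_fiberwise (f := fun π : Equiv.Perm (Fin n) => a ∘ π)
      (s := Finset.univ)]
  · rw [Finset.card_univ, Fintype.card_perm, Fintype.card_fin]
  · intro π _
    simpa using ((content_eq_iff a (a ∘ π)).mpr ⟨π, rfl⟩).symm

theorem card_content {d n : ℕ} (b : Conf d n) : (content b).card = n := by simp [content]

/-- Only the multiset of `a` contributes to the sum over `m`, leaving the inverse orbit size when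
the multisets agree. The integral counts permutations instead, and orbit–stabiliser identifies the
two. Everything later uses the Bell state in this averaged form. -/
theorem bell_eq_integral {d M : ℕ} [NeZero d] (a c : Conf d M) :
    bell M a c = nrm d M *
      ∫ ψ, (∏ k, conj (vec ψ (a k))) * ∏ k, vec ψ (c k) ∂(uniformPure d) := by
  have hsum : ∑ m : Sym (Fin d) M, symBasis m a * symBasis m c = if content a = content c then
      ((Finset.univ.filter fun e : Conf d M => content e = content a).card : ℂ)⁻¹ else 0 := by
    obtain ⟨m₀, hm₀⟩ : ∃ m : Sym (Fin d) M, (m : Multiset (Fin d)) = content a :=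
      ⟨Sym.mk (content a) (card_content a), rfl⟩
    refine (Finset.sum_eq_single m₀
      ?_ (fun h => absurd (Finset.mem_univ _) h)).trans ?_
    rotate_left
    · unfold symBasis
      simp only [hm₀, if_true]
      by_cases h : content a = content c
      · rw [if_pos h.symm, if_pos h, ← mul_inv, ← Complex.ofReal_mul,
          Real.mul_self_sqrt (Nat.cast_nonneg _)]
        simp
      · rw [if_neg (Ne.symm h), if_neg h, mul_zero]
    · intro m _ hm
      unfold symBasis
      rw [if_neg, zero_mul]
      intro h
      exact hm (Sym.coe_injective (h.symm.trans hm₀.symm))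
  simp_rw [mul_comm (∏ k, conj (vec _ (a k)))]
  rw [bell, hsum, integral_prod_mul_prod_conj, Fintype.card_fin]
  have hn := nrm_ne_zero d M
  have hC := choose_mul_moment d M
  rw [← nrm_mul_self] at hC
  change (nrm d M)⁻¹ * _ = _
  rw [inv_mul_eq_iff_eq_mul₀ hn, ← mul_assoc, ← mul_assoc, hC]
  by_cases h : content a = content c
  · have h1 := card_content_mul c a h.symm
    rw [if_pos h, h]
    have hf : (M.factorial : ℂ) ≠ 0 := by exact_mod_cast M.factorial_ne_zero
    rw [← h1] at hf ⊢
    push_cast at hf ⊢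
    rw [mul_inv, inv_mul_cancel_right₀ (right_ne_zero_of_mul hf)]
  · rw [if_neg h, Finset.filter_false_of_mem, Finset.card_empty, Nat.cast_zero, mul_zero]
    intro π _ hπ
    exact h ((content_eq_iff c a).mpr ⟨π, hπ⟩).symm

theorem prod_comp_perm {d n : ℕ} (η : Fin d → ℂ) (a : Conf d n) (π : Equiv.Perm (Fin n)) :
    ∏ k, η ((a ∘ π) k) = ∏ k, η (a k) :=
  Equiv.prod_comp π fun k => η (a k)

theorem bell_comp_left {d M : ℕ} [NeZero d] (c : Conf d M) :
    IsSymmetric fun a => bell M a c := by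
  intro π a
  have h : ∀ ψ : PureState d, ∏ k, conj (vec ψ ((a ∘ π) k)) = ∏ k, conj (vec ψ (a k)) :=
    fun ψ => prod_comp_perm (fun s => conj (vec ψ s)) a π
  simp only [bell_eq_integral, h]

theorem bell_comm {d M : ℕ} (a c : Conf d M) : bell M a c = bell M c a := by
  simp only [bell, mul_comm (symBasis _ a)]

theorem conj_bell {d M : ℕ} (a c : Conf d M) : conj (bell M a c) = bell M a c := by
  have h : ∀ (m : Sym (Fin d) M) a, conj (symBasis m a) = symBasis m a := by
    intro m a
    unfold symBasis
    split_ifs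
    · rw [map_inv₀, Complex.conj_ofReal]
    · simp
  simp [bell, h]

/-- Symmetric vectors are reproduced by the kernel of the symmetric projector. -/
theorem IsSymmetric.reproducing {d n : ℕ} [NeZero d] {F : Conf d n → ℂ} (hF : IsSymmetric F)
    (a : Conf d n) :
    ((n + d - 1).choose n : ℂ) * ∫ ψ, (∏ k, vec ψ (a k)) * ∑ c : Conf d n,
      (∏ k, conj (vec ψ (c k))) * F c ∂(uniformPure d) = F a := by
  simp_rw [Finset.mul_sum, ← mul_assoc]
  rw [integral_finsetSum _ fun c _ => integrable_uniformPure (by fun_prop)]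
  simp_rw [integral_mul_const, integral_prod_mul_prod_conj, Fintype.card_fin, mul_assoc]
  rw [← Finset.mul_sum, ← mul_assoc, choose_mul_moment]
  have : ∀ c : Conf d n, ((Finset.univ.filter fun π : Equiv.Perm (Fin n) => a ∘ π = c).card : ℂ) *
      F c = ∑ π : Equiv.Perm (Fin n), if a ∘ π = c then F c else 0 := by
    intro c
    rw [← Finset.sum_filter, Finset.sum_const, nsmul_eq_mul]
  simp_rw [this]
  rw [Finset.sum_comm]
  simp only [Finset.sum_ite_eq, Finset.mem_univ, if_true, hF _ a]
  rw [Finset.sum_const, Finset.card_univ, Fintype.card_perm, Fintype.card_fin, nsmul_eq_mul,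
    inv_mul_cancel_left₀]
  exact_mod_cast n.factorial_ne_zero

/-- A symmetric vector is determined by its contractions with product vectors. -/
theorem IsSymmetric.ext_of_contract {d n : ℕ} [NeZero d] {F F' : Conf d n → ℂ}
    (hF : IsSymmetric F) (hF' : IsSymmetric F')
    (h : ∀ η : Fin d → ℂ, ∑ a, pw η a * F a = ∑ a, pw η a * F' a) : F = F' := by
  ext a
  rw [← hF.reproducing, ← hF'.reproducing]
  have : ∀ ψ : PureState d, ∑ c : Conf d n, (∏ k, conj (vec ψ (c k))) * F c =
    ∑ c : Conf d n, (∏ k, conj (vec ψ (c k))) * F' c := fun ψ => h fun s => conj (vec ψ s)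
  simp_rw [this]

/-- The symmetric subspace is spanned by product vectors. -/
theorem IsSymmetric.mem_span {d n : ℕ} [NeZero d] {Φ : Conf d n → ℂ} (hΦ : IsSymmetric Φ) :
    Φ ∈ Submodule.span ℂ (Set.range (pw : (Fin d → ℂ) → Conf d n → ℂ)) := by
  by_contra hmem
  -- A functional that kills all product vectors kills `Φ`, because the reproducing formula writes
  -- `Φ` as an average of them.
  obtain ⟨f, hf, hbot⟩ := Submodule.exists_dual_map_eq_bot_of_notMem hmem inferInstance
  refine hf ?_
  have hf' : ∀ F : Conf d n → ℂ, f F = ∑ b, F b * f (Pi.single b 1) := by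
    intro F
    conv_lhs => rw [← Finset.univ_sum_single F]
    rw [map_sum]
    refine Finset.sum_congr rfl fun b _ => ?_
    rw [← mul_one (F b), ← smul_eq_mul, Pi.single_smul, map_smul, smul_eq_mul, smul_eq_mul, mul_one]
  have hzero : ∀ φ : Fin d → ℂ, ∑ b, pw φ b * f (Pi.single b 1) = 0 := by
    intro φ
    rw [← hf']
    have : f (pw φ) ∈ (Submodule.span ℂ (Set.range (pw : (Fin d → ℂ) → Conf d n → ℂ))).map f :=
      Submodule.mem_map_of_mem (Submodule.subset_span ⟨φ, rfl⟩)
    rw [hbot] at this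
    exact (Submodule.mem_bot ℂ).mp this
  rw [hf', Finset.sum_congr rfl fun b _ =>
    congrArg (· * f (Pi.single b 1)) (hΦ.reproducing b).symm]
  simp_rw [mul_assoc (_ : ℂ) (∫ _, _ ∂_)]
  rw [← Finset.mul_sum]
  simp_rw [← integral_mul_const]
  rw [← integral_finsetSum _ fun c _ => integrable_uniformPure (by fun_prop)]
  have : ∀ ψ : PureState d, ∑ b : Conf d n, (∏ k, vec ψ (b k)) *
      (∑ c : Conf d n, (∏ k, conj (vec ψ (c k))) * Φ c) * f (Pi.single b 1) = 0 := by
    intro ψ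
    have h := hzero (vec ψ)
    simp_rw [mul_right_comm _ (∑ c : Conf d n, _ : ℂ)]
    rw [← Finset.sum_mul]
    unfold pw at h
    rw [h, zero_mul]
  simp_rw [this]
  simp

/-- Contraction of one half of a Bell state with a product vector. -/
theorem sum_pw_mul_bell {d M : ℕ} [NeZero d] (η : Fin d → ℂ) (c : Conf d M) :
    ∑ a, pw η a * bell M a c = (nrm d M)⁻¹ * pw η c := by
  simp_rw [bell_eq_integral, mul_left_comm _ (nrm d M)]
  rw [← Finset.mul_sum]
  simp_rw [← integral_const_mul]
  rw [← integral_finsetSum _ fun c _ => integrable_uniformPure (by fun_prop)]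
  have : ∀ ψ : PureState d, ∑ a : Conf d M, pw η a * ((∏ k, conj (vec ψ (a k))) *
      ∏ k, vec ψ (c k)) = (∏ k, vec ψ (c k)) * braket (vec ψ) η ^ M := by
    intro ψ
    have hb : braket (vec ψ) η ^ M = ∏ _i : Fin M, braket (vec ψ) η := by simp
    rw [hb]
    unfold braket
    rw [prod_sum_fun, Finset.mul_sum]
    refine Finset.sum_congr rfl fun a _ => ?_
    rw [Finset.prod_mul_distrib, pw]
    ring
  simp_rw [this]
  rw [integral_prod_mul_braket_pow M (Fintype.card_fin M), ← nrm_mul_self, ← mul_assoc, mul_inv,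
    mul_inv_cancel_left₀ (nrm_ne_zero d M), pw]

/-! ### Action of the cloning operator on special states -/

/-- The product vector with `η` on the sites in `x` and `φ` elsewhere. -/
def mix {d N : ℕ} (x : Finset (Fin N)) (η φ : Fin d → ℂ) : Conf d N → ℂ :=
  fun b => ∏ n, (if n ∈ x then η else φ) (b n)

theorem mix_eq_mul {d N : ℕ} (x : Finset (Fin N)) (η φ : Fin d → ℂ) (b : Conf d N) :
    mix x η φ b = (∏ n ∈ x, η (b n)) * ∏ n ∈ xᶜ, φ (b n) := by
  unfold mix
  rw [← Finset.prod_mul_prod_compl x]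
  congr 1
  · exact Finset.prod_congr rfl fun n hn => by rw [if_pos hn]
  · exact Finset.prod_congr rfl fun n hn => by rw [if_neg (Finset.mem_compl.mp hn)]

theorem prod_restr {d N k : ℕ} (x : Finset (Fin N)) (hx : x.card = k) (b : Conf d N)
    (f : Fin d → ℂ) : ∏ i, f (restr x hx b i) = ∏ n ∈ x, f (b n) := by
  conv_rhs => rw [← Finset.map_orderEmbOfFin_univ x hx]
  rw [Finset.prod_map]
  rfl

theorem special_pw {d M N : ℕ} (φ : Fin d → ℂ) (x : Str N M) (a : Conf d M) (b : Conf d N) :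
    special (pw φ) x (a, b) = bell M a (restr x.1 x.2 b) * ∏ n ∈ x.1ᶜ, φ (b n) := by
  rw [special, pw, prod_restr]

/-- This is teleportation: contracting the input with `η^{⊗M}` places `η` on the sites of `x`, so
that only product vectors on the output remain to be handled. -/
theorem sum_pw_mul_special {d M N : ℕ} [NeZero d] (η φ : Fin d → ℂ) (x : Str N M)
    (b : Conf d N) :
    ∑ a, pw η a * special (pw φ) x (a, b) = (nrm d M)⁻¹ * mix x.1 η φ b := by
  simp_rw [special_pw, ← mul_assoc]
  rw [← Finset.sum_mul, sum_pw_mul_bell, mix_eq_mul, pw, prod_restr, mul_assoc]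

theorem tensor_mulVec_mix {d N : ℕ} (A : Fin N → Matrix (Fin d) (Fin d) ℂ) (x : Finset (Fin N))
    (η φ : Fin d → ℂ) (b : Conf d N) :
    (tensor A *ᵥ mix x η φ) b = ∏ n, (A n *ᵥ (if n ∈ x then η else φ)) (b n) := by
  simp only [mulVec, dotProduct, tensor, of_apply, mix]
  rw [prod_sum_fun]
  exact Finset.sum_congr rfl fun c _ => Finset.prod_mul_distrib.symm

theorem proj_mulVec {d : ℕ} (ψ : PureState d) (η : Fin d → ℂ) (s : Fin d) :
    (proj ψ *ᵥ η) s = braket (vec ψ) η * vec ψ s := by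
  simp only [mulVec, dotProduct, proj, of_apply, braket, Finset.sum_mul]
  exact Finset.sum_congr rfl fun i _ => by ring

/-- Sites of `y ∩ z` already carry `ψ` and are unchanged; each site of `y \ z` costs one overlap and
carries `ψ` afterwards. -/
theorem projOn_mulVec_mix {d N : ℕ} (y z : Finset (Fin N)) (ψ : PureState d) (φ : Fin d → ℂ)
    (b : Conf d N) : (projOn y ψ *ᵥ mix z (vec ψ) φ) b =
      braket (vec ψ) φ ^ (y \ z).card * mix (y ∪ z) (vec ψ) φ b := by
  rw [projOn, tensor_mulVec_mix]
  have h : ∀ n, ((if n ∈ y then proj ψ else 1) *ᵥ (if n ∈ z then vec ψ else φ)) (b n) =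
      (if n ∈ y \ z then braket (vec ψ) φ else 1) *
        (if n ∈ y ∪ z then vec ψ else φ) (b n) := by
    intro n
    by_cases hy : n ∈ y <;> by_cases hz : n ∈ z <;>
      simp [hy, hz, proj_mulVec, braket_vec_self]
  simp_rw [h]
  rw [Finset.prod_mul_distrib, mix, Finset.prod_ite_mem, Finset.univ_inter, Finset.prod_const]

theorem copies_apply {d M : ℕ} (ψ : PureState d) (a c : Conf d M) :
    copies M ψ a c = pw (vec ψ) a * ∏ k, conj (vec ψ (c k)) := by
  simp only [copies, tensor, proj, of_apply, pw, Finset.prod_mul_distrib]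

theorem continuous_copies_apply {d M : ℕ} (a c : Conf d M) :
    Continuous fun ψ : PureState d => copies M ψ a c := by
  simp_rw [copies_apply, pw]
  fun_prop

theorem continuous_projOn_apply {d N : ℕ} (y : Finset (Fin N)) (b b' : Conf d N) :
    Continuous fun ψ : PureState d => projOn y ψ b b' := by
  simp only [projOn, tensor, of_apply]
  refine continuous_finsetProd _ fun n _ => ?_
  split_ifs
  · simp only [proj, of_apply]
    fun_prop
  · exact continuous_const

theorem continuous_kernel_apply {d M N : ℕ} (y : Finset (Fin N)) (p q : Conf d M × Conf d N) :
    Continuous fun ψ : PureState d => ((copies M ψ)ᵀ ⊗ₖ projOn y ψ) p q :=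
  (continuous_copies_apply q.1 p.1).mul (continuous_projOn_apply y p.2 q.2)

theorem R_op_mulVec {d M N : ℕ} [NeZero d] (y : Finset (Fin N))
    (v : Conf d M × Conf d N → ℂ) (p : Conf d M × Conf d N) :
    (R_op d M y *ᵥ v) p = ((M + d - 1).choose M : ℂ) *
      ∫ ψ, (((copies M ψ)ᵀ ⊗ₖ projOn y ψ) *ᵥ v) p ∂(uniformPure d) := by
  simp only [mulVec, dotProduct, R_op, of_apply]
  rw [integral_finsetSum _ fun q _ =>
    (integrable_uniformPure (continuous_kernel_apply y p q)).mul_const _, Finset.mul_sum]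
  refine Finset.sum_congr rfl fun q _ => ?_
  rw [integral_mul_const, mul_assoc]

/-- The input factor has rank one, so the kernel sees `v` only through its contraction with
`ψ^{⊗M}`. -/
theorem kernel_mulVec {d M N : ℕ} (y : Finset (Fin N)) (ψ : PureState d)
    (v : Conf d M × Conf d N → ℂ) (a : Conf d M) (b : Conf d N) :
    (((copies M ψ)ᵀ ⊗ₖ projOn y ψ) *ᵥ v) (a, b) = (∏ k, conj (vec ψ (a k))) *
      (projOn y ψ *ᵥ fun b' => ∑ a', pw (vec ψ) a' * v (a', b')) b := by
  simp only [mulVec, dotProduct, kroneckerMap_apply, transpose_apply, copies_apply,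
    Fintype.sum_prod_type, Finset.mul_sum]
  rw [Finset.sum_comm]
  refine Finset.sum_congr rfl fun b' _ => Finset.sum_congr rfl fun a' _ => by ring

theorem R_op_mulVec_special_pw {d M N : ℕ} [NeZero d] (y : Finset (Fin N)) (z : Str N M)
    (φ : Fin d → ℂ) (a : Conf d M) (b : Conf d N) :
    (R_op d M y *ᵥ special (pw φ) z) (a, b) = nrm d M *
      ∫ ψ, (∏ k, conj (vec ψ (a k))) * (braket (vec ψ) φ ^ (y \ z.1).card *
        mix (y ∪ z.1) (vec ψ) φ b) ∂(uniformPure d) := by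
  rw [R_op_mulVec]
  simp_rw [kernel_mulVec, sum_pw_mul_special]
  have : ∀ ψ : PureState d, (projOn y ψ *ᵥ fun b' => (nrm d M)⁻¹ * mix z.1 (vec ψ) φ b') b =
      (nrm d M)⁻¹ * (braket (vec ψ) φ ^ (y \ z.1).card * mix (y ∪ z.1) (vec ψ) φ b) := by
    intro ψ
    rw [← projOn_mulVec_mix]
    exact congrFun (mulVec_smul (projOn y ψ) (nrm d M)⁻¹ (mix z.1 (vec ψ) φ)) b
  simp_rw [this, mul_left_comm _ (nrm d M)⁻¹]
  rw [integral_const_mul, ← nrm_mul_self, mul_assoc, mul_inv_cancel_left₀ (nrm_ne_zero d M)]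

theorem continuous_mix_apply {d N : ℕ} (x : Finset (Fin N)) (φ : Fin d → ℂ) (b : Conf d N) :
    Continuous fun ψ : PureState d => mix x (vec ψ) φ b := by
  simp_rw [mix_eq_mul]
  fun_prop

/-- The inner product factorises over the sites, which fall into four classes according to
membership in `x` and `Y`. -/
theorem star_mix_dotProduct_mix {d N : ℕ} (x Y : Finset (Fin N)) (η θ η' θ' : Fin d → ℂ) :
    ∑ b, conj (mix x η θ b) * mix Y η' θ' b =
      braket η η' ^ (x ∩ Y).card * braket η θ' ^ (x \ Y).card *
        (braket θ η' ^ (Y \ x).card * braket θ θ' ^ (xᶜ ∩ Yᶜ).card) := by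
  have h1 : ∑ b, conj (mix x η θ b) * mix Y η' θ' b =
      ∏ n, braket (if n ∈ x then η else θ) (if n ∈ Y then η' else θ') := by
    unfold braket
    rw [prod_sum_fun]
    refine Finset.sum_congr rfl fun b _ => ?_
    rw [mix, mix, map_prod, Finset.prod_mul_distrib]
  have h2 : ∀ n, braket (if n ∈ x then η else θ) (if n ∈ Y then η' else θ') =
      ((if n ∈ x ∩ Y then braket η η' else 1) * (if n ∈ x \ Y then braket η θ' else 1)) *
      ((if n ∈ Y \ x then braket θ η' else 1) * (if n ∈ xᶜ ∩ Yᶜ then braket θ θ' else 1)) := by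
    intro n
    by_cases hx : n ∈ x <;> by_cases hY : n ∈ Y <;> simp [hx, hY]
  rw [h1]
  simp_rw [h2]
  simp only [Finset.prod_mul_distrib, Finset.prod_ite_mem, Finset.univ_inter, Finset.prod_const]

theorem integral_braket_pow_mul {d : ℕ} [NeZero d] (n : ℕ) (θ φ : Fin d → ℂ) :
    ∫ ψ, braket θ (vec ψ) ^ n * braket (vec ψ) φ ^ n ∂(uniformPure d) =
      ((n + d - 1).choose n : ℂ)⁻¹ * braket θ φ ^ n := by
  have h : ∀ η : Fin d → ℂ, braket θ η ^ n = ∑ c : Fin n → Fin d, (∏ i, conj (θ (c i))) *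
      ∏ i, η (c i) := by
    intro η
    have hb : braket θ η ^ n = ∏ _i : Fin n, braket θ η := by simp
    rw [hb]
    unfold braket
    rw [prod_sum_fun]
    exact Finset.sum_congr rfl fun c _ => Finset.prod_mul_distrib
  simp_rw [h, Finset.sum_mul]
  rw [integral_finsetSum _ fun c _ => integrable_uniformPure (by fun_prop), Finset.mul_sum]
  refine Finset.sum_congr rfl fun c _ => ?_
  simp_rw [mul_assoc]
  rw [integral_const_mul, integral_prod_mul_braket_pow n (Fintype.card_fin n)]
  ring

/-- Matrix elements of the cloning operator between special states with product vectors. -/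
theorem star_special_dotProduct_R_op_special_pw {d M N : ℕ} [NeZero d] (y : Finset (Fin N))
    (x z : Str N M) (θ φ : Fin d → ℂ) :
    star (special (pw θ) x) ⬝ᵥ (R_op d M y *ᵥ special (pw φ) z) =
      (G d y x z : ℂ) * braket θ φ ^ (N - M) := by
  have hd : 1 ≤ d := NeZero.one_le
  set Y := y ∪ z.1 with hY
  set k := (y \ z.1).card with hk
  have hM : M = x.1.card := x.2.symm
  have hn1 : (Y \ x.1).card = M - (x.1 ∩ z.1).card + (x.1ᶜ ∩ z.1ᶜ ∩ y).card := by
    have e : Y \ x.1 = (z.1 \ x.1) ∪ (x.1ᶜ ∩ z.1ᶜ ∩ y) := by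
      ext n
      simp only [hY, Finset.mem_sdiff, Finset.mem_union, Finset.mem_inter, Finset.mem_compl]
      tauto
    rw [e, Finset.card_union_of_disjoint, Finset.card_sdiff, z.2]
    rw [Finset.disjoint_left]
    intro n
    simp only [Finset.mem_sdiff, Finset.mem_inter, Finset.mem_compl]
    tauto
  have hle : (x.1 ∩ z.1).card ≤ M := by
    conv_rhs => rw [hM]
    exact Finset.card_le_card Finset.inter_subset_left
  -- The overlap `⟨ψ|φ⟩` occurs `|x \ Y|` times in the inner product and `k` times from the action
  -- of `R_y`. The total must match the number of factors `⟨θ|ψ⟩` for the moment formula to apply.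
  have hn2 : (x.1 \ Y).card + k = (Y \ x.1).card := by
    have h1 := Finset.card_sdiff_add_card Y x.1
    have h2 := Finset.card_sdiff_add_card x.1 Y
    have h3 : Y.card = k + M := by rw [hY, ← Finset.card_sdiff_add_card, z.2]
    rw [Finset.union_comm] at h2
    have h4 := x.2
    omega
  have hn3 : (Y \ x.1).card + (x.1ᶜ ∩ Yᶜ).card = N - M := by
    have e : x.1ᶜ = (Y \ x.1) ∪ (x.1ᶜ ∩ Yᶜ) := by
      ext n
      simp only [Finset.mem_sdiff, Finset.mem_union, Finset.mem_inter, Finset.mem_compl]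
      tauto
    rw [← card_compl_str x]
    conv_rhs => rw [e]
    rw [Finset.card_union_of_disjoint]
    rw [Finset.disjoint_left]
    intro n
    simp only [Finset.mem_sdiff, Finset.mem_inter, Finset.mem_compl]
    tauto
  set n := (Y \ x.1).card with hn
  have hstep : star (special (pw θ) x) ⬝ᵥ (R_op d M y *ᵥ special (pw φ) z) =
      ∫ ψ, ∑ b, conj (mix x.1 (vec ψ) θ b) * (braket (vec ψ) φ ^ k * mix Y (vec ψ) φ b)
        ∂(uniformPure d) := by
    rw [integral_finsetSum]
    swap
    · intro b _
      refine integrable_uniformPure ?_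
      have h1 := continuous_mix_apply (d := d) x.1 θ b
      have h2 := continuous_mix_apply (d := d) Y φ b
      have h3 : Continuous fun ψ : PureState d => conj (mix x.1 (vec ψ) θ b) :=
        Complex.continuous_conj.comp h1
      fun_prop
    simp only [dotProduct, Fintype.sum_prod_type, Pi.star_apply]
    rw [Finset.sum_comm]
    refine Finset.sum_congr rfl fun b _ => ?_
    simp_rw [R_op_mulVec_special_pw, mul_left_comm _ (nrm d M)]
    rw [← Finset.mul_sum]
    simp_rw [← integral_const_mul]
    rw [← integral_finsetSum]
    swap
    · intro a _
      refine integrable_uniformPure ?_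
      have h2 := continuous_mix_apply (d := d) Y φ b
      fun_prop
    rw [← integral_const_mul]
    congr 1
    ext ψ
    have hc := congrArg conj (sum_pw_mul_special (vec ψ) θ x b)
    rw [map_mul, map_inv₀, conj_nrm, map_sum] at hc
    rw [Finset.mul_sum, mul_comm (conj (mix _ _ _ b)), ← mul_inv_cancel_left₀ (nrm_ne_zero d M)
      (_ * conj (mix x.1 (vec ψ) θ b))]
    rw [mul_left_comm _ _ (conj (mix x.1 (vec ψ) θ b)), ← hc, Finset.mul_sum, Finset.mul_sum]
    refine Finset.sum_congr rfl fun a _ => ?_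
    rw [map_mul, pw, map_prod]
    simp only [Complex.star_def]
    ring
  rw [hstep]
  have hint : ∀ ψ : PureState d, ∑ b, conj (mix x.1 (vec ψ) θ b) *
      (braket (vec ψ) φ ^ k * mix Y (vec ψ) φ b) = (braket θ (vec ψ) ^ n *
        braket (vec ψ) φ ^ n) * braket θ φ ^ (x.1ᶜ ∩ Yᶜ).card := by
    intro ψ
    simp_rw [mul_left_comm _ (braket (vec ψ) φ ^ k)]
    rw [← Finset.mul_sum, star_mix_dotProduct_mix, braket_vec_self, one_pow]
    have e : braket (vec ψ) φ ^ n = braket (vec ψ) φ ^ (x.1 \ Y).card * braket (vec ψ) φ ^ k := by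
      rw [← pow_add, hn2]
    rw [e, hn]
    ring
  simp_rw [hint]
  rw [integral_mul_const, integral_braket_pow_mul, ← hn3, G, of_apply]
  -- The denominator of `G_y` is the dimension of the symmetric subspace of `n` spins, the constant
  -- produced by the moment formula.
  have hch : (M + d - 1 - (x.1 ∩ z.1).card + (x.1ᶜ ∩ z.1ᶜ ∩ y).card).choose (d - 1) =
      (n + d - 1).choose n := by
    rw [show M + d - 1 - (x.1 ∩ z.1).card + (x.1ᶜ ∩ z.1ᶜ ∩ y).card = n + d - 1 by omega]
    exact Nat.choose_symm_of_eq_add (by omega)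
  rw [hch]
  push_cast
  ring

theorem special_add {d M N : ℕ} (Φ Ψ : Conf d (N - M) → ℂ) (x : Str N M) :
    special (Φ + Ψ) x = special Φ x + special Ψ x := by
  ext p
  simp [special, mul_add]

theorem special_smul {d M N : ℕ} (c : ℂ) (Φ : Conf d (N - M) → ℂ) (x : Str N M) :
    special (c • Φ) x = c • special Φ x := by
  ext p
  simp [special, mul_left_comm]

theorem special_zero {d M N : ℕ} (x : Str N M) :
    special (0 : Conf d (N - M) → ℂ) x = 0 := by
  ext p
  simp [special]

theorem star_pw_dotProduct_pw {d n : ℕ} (θ φ : Fin d → ℂ) :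
    star (pw θ : Conf d n → ℂ) ⬝ᵥ pw φ = braket θ φ ^ n := by
  have hb : braket θ φ ^ n = ∏ _i : Fin n, braket θ φ := by simp
  rw [hb]
  unfold braket
  rw [prod_sum_fun]
  simp only [dotProduct, Pi.star_apply, pw, star_prod, ← Finset.prod_mul_distrib, Complex.star_def]

/-- Matrix elements of the cloning operator between special states. -/
theorem star_special_dotProduct_R_op_special {d M N : ℕ} [NeZero d] (y : Finset (Fin N))
    (x z : Str N M) {Θ Φ : Conf d (N - M) → ℂ} (hΘ : IsSymmetric Θ) (hΦ : IsSymmetric Φ) :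
    star (special Θ x) ⬝ᵥ (R_op d M y *ᵥ special Φ z) = (G d y x z : ℂ) * (star Θ ⬝ᵥ Φ) := by
  -- Both sides are sesquilinear in `Θ` and `Φ`, so two inductions over spans reduce to product
  -- vectors.
  have hΦ' := hΦ.mem_span
  have hΘ' := hΘ.mem_span
  clear hΦ hΘ
  induction hΦ' using Submodule.span_induction with
  | mem _ h =>
    obtain ⟨φ, rfl⟩ := h
    induction hΘ' using Submodule.span_induction with
    | mem _ h =>
      obtain ⟨θ, rfl⟩ := h
      rw [star_special_dotProduct_R_op_special_pw, star_pw_dotProduct_pw]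
    | zero => simp [special_zero]
    | add _ _ _ _ h1 h2 => simp only [special_add, star_add, add_dotProduct, h1, h2, mul_add]
    | smul c _ _ h1 =>
      simp only [special_smul, star_smul, smul_dotProduct, h1, smul_eq_mul]
      ring
  | zero => simp [special_zero]
  | add _ _ _ _ h1 h2 =>
    simp only [special_add, mulVec_add, dotProduct_add, h1, h2, mul_add]
  | smul c _ _ h1 =>
    simp only [special_smul, mulVec_smul, dotProduct_smul, h1, smul_eq_mul]
    ring

theorem chi_apply {d M N : ℕ} (β : Str N M → ℝ) (Φ : Conf d (N - M) → ℂ)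
    (p : Conf d M × Conf d N) : chi β Φ p = ∑ x, (β x : ℂ) * special Φ x p := by
  simp [chi, Finset.sum_apply]

theorem star_chi_dotProduct_R_op {d M N : ℕ} [NeZero d] (y : Finset (Fin N))
    (β : Str N M → ℝ) {Φ : Conf d (N - M) → ℂ} (hΦ : IsSymmetric Φ) :
    star (chi β Φ) ⬝ᵥ (R_op d M y *ᵥ chi β Φ) = (quad d y β : ℂ) * (star Φ ⬝ᵥ Φ) := by
  have h1 : R_op d M y *ᵥ chi β Φ = ∑ z, (β z : ℂ) • (R_op d M y *ᵥ special Φ z) := by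
    rw [chi, ← mulVecLin_apply, map_sum]
    exact Finset.sum_congr rfl fun z _ => by rw [map_smul, mulVecLin_apply]
  rw [h1, chi, star_sum, sum_dotProduct]
  simp_rw [dotProduct_sum, star_smul, smul_dotProduct, dotProduct_smul,
    star_special_dotProduct_R_op_special y _ _ hΦ hΦ]
  generalize star Φ ⬝ᵥ Φ = s
  simp only [quad, dotProduct, mulVec, Complex.ofReal_sum, Complex.ofReal_mul, Finset.sum_mul,
    Finset.mul_sum, smul_eq_mul, Complex.star_def, Complex.conj_ofReal]
  exact Finset.sum_congr rfl fun x _ => Finset.sum_congr rfl fun z _ => by ring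

/-! ### The operator for the empty set of sites -/

theorem projOn_empty {d N : ℕ} (ψ : PureState d) :
    projOn (∅ : Finset (Fin N)) ψ = 1 := by
  ext b b'
  simp only [projOn, tensor, of_apply, Finset.notMem_empty, if_false]
  by_cases h : b = b'
  · subst h; simp
  · rw [one_apply_ne h]
    obtain ⟨n, hn⟩ := Function.ne_iff.mp h
    exact Finset.prod_eq_zero (Finset.mem_univ n) (one_apply_ne hn)

/-- With no tested site the average is the symmetric projector on the input tensored with the
identity. Norms of special states thereby become the case `y = ∅` of the matrix elements. -/
theorem R_op_empty_apply {d M N : ℕ} [NeZero d] (p q : Conf d M × Conf d N) :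
    R_op d M (∅ : Finset (Fin N)) p q = nrm d M * bell M p.1 q.1 *
      (1 : Matrix (Conf d N) (Conf d N) ℂ) p.2 q.2 := by
  rw [R_op, of_apply]
  simp_rw [projOn_empty, kroneckerMap_apply, transpose_apply, copies_apply]
  rw [integral_mul_const, bell_eq_integral, ← nrm_mul_self]
  simp_rw [pw, mul_comm (∏ k, vec _ (q.1 k))]
  ring

theorem R_op_empty_mulVec {d M N : ℕ} [NeZero d] (v : Conf d M × Conf d N → ℂ)
    (a : Conf d M) (b : Conf d N) :
    (R_op d M (∅ : Finset (Fin N)) *ᵥ v) (a, b) =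
      nrm d M * ∑ a', bell M a a' * v (a', b) := by
  simp only [mulVec, dotProduct, R_op_empty_apply, Fintype.sum_prod_type, Finset.mul_sum]
  refine Finset.sum_congr rfl fun a' _ => ?_
  rw [Finset.sum_eq_single b]
  · simp [mul_assoc]
  · intro b' _ hb
    rw [one_apply_ne (Ne.symm hb)]
    ring
  · simp

theorem sum_pw_mul_R_op_empty_mulVec {d M N : ℕ} [NeZero d] (v : Conf d M × Conf d N → ℂ)
    (η : Fin d → ℂ) (b : Conf d N) :
    ∑ a, pw η a * (R_op d M (∅ : Finset (Fin N)) *ᵥ v) (a, b) = ∑ a, pw η a * v (a, b) := by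
  simp_rw [R_op_empty_mulVec, mul_left_comm _ (nrm d M)]
  rw [← Finset.mul_sum]
  simp_rw [Finset.mul_sum, ← mul_assoc]
  rw [Finset.sum_comm]
  refine Finset.sum_congr rfl fun a _ => ?_
  simp_rw [mul_assoc]
  rw [← Finset.mul_sum]
  simp_rw [← mul_assoc]
  rw [← Finset.sum_mul, sum_pw_mul_bell, ← mul_assoc, mul_inv_cancel_left₀ (nrm_ne_zero d M)]

/-- The kernel of `R_y` depends only on contractions with `ψ^{⊗M}`, which the symmetric projector on
the input does not change. -/
theorem R_op_mul_R_op_empty {d M N : ℕ} [NeZero d] (y : Finset (Fin N)) :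
    R_op d M y * R_op d M ∅ = R_op d M y := by
  refine ext_of_mulVec_single fun q => ?_
  rw [← mulVec_mulVec]
  ext ⟨a, b⟩
  rw [R_op_mulVec, R_op_mulVec]
  simp_rw [kernel_mulVec, sum_pw_mul_R_op_empty_mulVec]

/-- A vector is symmetric in the input sites. -/
def InSymmetric {d M N : ℕ} (v : Conf d M × Conf d N → ℂ) : Prop :=
  ∀ b, IsSymmetric fun a => v (a, b)

theorem inSymmetric_special {d M N : ℕ} [NeZero d] (Φ : Conf d (N - M) → ℂ) (x : Str N M) :
    InSymmetric (special Φ x) := by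
  intro b π a
  exact congrArg (· * _) (bell_comp_left (restr x.1 x.2 b) π a)

theorem inSymmetric_R_op_mulVec {d M N : ℕ} [NeZero d] (y : Finset (Fin N))
    (v : Conf d M × Conf d N → ℂ) : InSymmetric (R_op d M y *ᵥ v) := by
  intro b π a
  simp only [R_op_mulVec, kernel_mulVec]
  have h : ∀ ψ : PureState d, ∏ k, conj (vec ψ ((a ∘ π) k)) = ∏ k, conj (vec ψ (a k)) :=
    fun ψ => prod_comp_perm (fun s => conj (vec ψ s)) a π
  simp_rw [h]

theorem inSymmetric_chi {d M N : ℕ} [NeZero d] (β : Str N M → ℝ) (Φ : Conf d (N - M) → ℂ) :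
    InSymmetric (chi β Φ) := by
  intro b π a
  simp only [chi_apply]
  exact Finset.sum_congr rfl fun x _ => congrArg _ (inSymmetric_special Φ x b π a)

theorem InSymmetric.R_op_empty_mulVec {d M N : ℕ} [NeZero d] {v : Conf d M × Conf d N → ℂ}
    (hv : InSymmetric v) : R_op d M (∅ : Finset (Fin N)) *ᵥ v = v := by
  ext ⟨a, b⟩
  exact congrFun ((inSymmetric_R_op_mulVec ∅ v b).ext_of_contract (hv b)
    fun η => sum_pw_mul_R_op_empty_mulVec v η b) a

theorem star_chi_dotProduct_chi {d M N : ℕ} [NeZero d]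
    (β : Str N M → ℝ) {Φ : Conf d (N - M) → ℂ} (hΦ : IsSymmetric Φ) :
    star (chi β Φ) ⬝ᵥ chi β Φ = (quad d ∅ β : ℂ) * (star Φ ⬝ᵥ Φ) := by
  rw [← star_chi_dotProduct_R_op ∅ β hΦ, (inSymmetric_chi β Φ).R_op_empty_mulVec]

/-! ### Invariance of the cone of special states -/

/-- Polarisation: contract the moment formula on the sites `Y` with `tη + φ`, and compare the
coefficients of `t^M`. On the right, expanding `∏ (tη + φ)` produces the subsets of `Y` of size `M`.
-/
theorem integral_braket_pow_mul_braket_pow_mul_prod {d N : ℕ} [NeZero d] (Y : Finset (Fin N))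
    (M k : ℕ) (hY : Y.card = M + k) (η φ : Fin d → ℂ) (b : Conf d N) :
    ((M + k).choose M : ℂ) * ∫ ψ, braket (vec ψ) η ^ M * (braket (vec ψ) φ ^ k *
      ∏ n ∈ Y, vec ψ (b n)) ∂(uniformPure d) = ((M + k + d - 1).choose (M + k) : ℂ)⁻¹ *
      ∑ x ∈ Y.powersetCard M, (∏ n ∈ x, η (b n)) * ∏ n ∈ Y \ x, φ (b n) := by
  set I : ℕ → ℂ := fun j => ∫ ψ, braket (vec ψ) η ^ j * (braket (vec ψ) φ ^ (M + k - j) *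
      ∏ n ∈ Y, vec ψ (b n)) ∂(uniformPure d) with hI
  set c : ℂ := ((M + k + d - 1).choose (M + k) : ℂ)⁻¹
  let P : Polynomial ℂ := ∑ j ∈ Finset.range (M + k + 1),
    Polynomial.monomial j (((M + k).choose j : ℂ) * I j)
  let Q : Polynomial ℂ := ∑ x ∈ Y.powerset,
    Polynomial.monomial x.card (c * ((∏ n ∈ x, η (b n)) * ∏ n ∈ Y \ x, φ (b n)))
  have hPQ : P = Q := by
    refine Polynomial.funext fun t => ?_
    have h1 := integral_prod_mul_braket_pow (d := d) (ι := Y) (M + k)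
      (by rw [Fintype.card_coe, hY]) (fun n => b n.1) (t • η + φ)
    simp only [P, Q, Polynomial.eval_finsetSum, Polynomial.eval_monomial]
    have h2 : ∀ f : Fin d → ℂ, ∏ n : Y, f (b n.1) = ∏ n ∈ Y, f (b n) := fun f =>
      Finset.prod_coe_sort Y fun n => f (b n)
    simp_rw [h2] at h1
    have h3 : ∀ ψ : PureState d, (∏ n ∈ Y, vec ψ (b n)) *
        braket (vec ψ) (t • η + φ) ^ (M + k) = ∑ j ∈ Finset.range (M + k + 1),
          ((M + k).choose j : ℂ) * t ^ j * (braket (vec ψ) η ^ j *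
            (braket (vec ψ) φ ^ (M + k - j) * ∏ n ∈ Y, vec ψ (b n))) := by
      intro ψ
      have : braket (vec ψ) (t • η + φ) = t * braket (vec ψ) η + braket (vec ψ) φ := by
        simp only [braket, Pi.add_apply, Pi.smul_apply, smul_eq_mul, mul_add,
          Finset.sum_add_distrib, Finset.mul_sum]
        congr 1
        exact Finset.sum_congr rfl fun s _ => by ring
      rw [this, add_pow, Finset.mul_sum]
      exact Finset.sum_congr rfl fun j _ => by rw [mul_pow]; ring
    simp_rw [h3] at h1
    rw [integral_finsetSum _ fun j _ => integrable_uniformPure (by fun_prop)] at h1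
    simp_rw [integral_const_mul] at h1
    rw [Finset.sum_congr rfl fun j _ => by rw [mul_right_comm], h1]
    simp only [Pi.add_apply, Pi.smul_apply, smul_eq_mul]
    rw [Finset.prod_add, Finset.mul_sum]
    refine Finset.sum_congr rfl fun x _ => ?_
    rw [Finset.prod_mul_distrib, Finset.prod_const]
    ring
  have hcoeff := congrArg (fun p => Polynomial.coeff p M) hPQ
  simp only [P, Q, Polynomial.finsetSum_coeff, Polynomial.coeff_monomial] at hcoeff
  rw [Finset.sum_ite_eq' (Finset.range (M + k + 1)) M, if_pos (by simp), ← Finset.sum_filter]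
    at hcoeff
  rw [← Finset.powersetCard_eq_filter, ← Finset.mul_sum] at hcoeff
  rw [← hcoeff, hI]
  simp

/-- The coefficient in the expansion of `R_y |ψ_z⟩` into special states. -/
noncomputable def coneCoeff (d M k : ℕ) : ℝ :=
  (M + d - 1).choose M / ((M + k + d - 1).choose (M + k) * (M + k).choose M)

theorem coneCoeff_nonneg (d M k : ℕ) : 0 ≤ coneCoeff d M k := by
  unfold coneCoeff
  positivity

/-- After contraction of the input with `η^{⊗M}`, the average over `ψ` distributes the `M` copies of
`η` and `|y \ z|` copies of `φ` symmetrically over `y ∪ z`. Each placement of `η` is the contraction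
of one special state, and all have the same weight. That this weight is nonnegative is the source of
the invariant cone. -/
theorem R_op_mulVec_special {d M N : ℕ} [NeZero d] (y : Finset (Fin N)) (z : Str N M)
    {Φ : Conf d (N - M) → ℂ} (hΦ : IsSymmetric Φ) :
    R_op d M y *ᵥ special Φ z = ∑ x : Str N M,
      (if x.1 ⊆ y ∪ z.1 then (coneCoeff d M (y \ z.1).card : ℂ) else 0) • special Φ x := by
  have hΦ' := hΦ.mem_span
  clear hΦ
  induction hΦ' using Submodule.span_induction with
  | zero => simp [special_zero]
  | add _ _ _ _ h1 h2 =>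
    simp only [special_add, mulVec_add, h1, h2, smul_add, Finset.sum_add_distrib]
  | smul c _ _ h1 =>
    simp only [special_smul, mulVec_smul, h1, Finset.smul_sum]
    exact Finset.sum_congr rfl fun x _ => smul_comm _ _ _
  | mem _ h =>
    obtain ⟨φ, rfl⟩ := h
    set k := (y \ z.1).card with hk
    set Y := y ∪ z.1 with hYdef
    have hY : Y.card = M + k := by rw [hYdef, ← Finset.card_sdiff_add_card, z.2, add_comm]
    ext ⟨a, b⟩
    have hsym2 : IsSymmetric fun a => (∑ x : Str N M,
        (if x.1 ⊆ Y then (coneCoeff d M k : ℂ) else 0) • special (pw φ) x) (a, b) := by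
      intro π a
      simp only [Finset.sum_apply, Pi.smul_apply]
      exact Finset.sum_congr rfl fun x _ => congrArg _ (inSymmetric_special (pw φ) x b π a)
    -- Both sides are symmetric in the input, so they may be compared after contraction with product
    -- vectors.
    refine congrFun ((inSymmetric_R_op_mulVec y (special (pw φ) z) b).ext_of_contract hsym2
      fun η => ?_) a
    have hL : ∑ a, pw η a * (R_op d M y *ᵥ special (pw φ) z) (a, b) = nrm d M *
        ((∫ ψ, braket (vec ψ) η ^ M * (braket (vec ψ) φ ^ k * ∏ n ∈ Y, vec ψ (b n))
          ∂(uniformPure d)) * ∏ n ∈ Yᶜ, φ (b n)) := by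
      simp_rw [R_op_mulVec_special_pw, mul_left_comm _ (nrm d M)]
      rw [← Finset.mul_sum]
      simp_rw [← integral_const_mul]
      rw [← integral_finsetSum, ← integral_mul_const]
      swap
      · intro a _
        have h2 := continuous_mix_apply (d := d) Y φ b
        exact integrable_uniformPure (by fun_prop)
      congr 2
      ext ψ
      have hb : braket (vec ψ) η ^ M = ∑ a : Conf d M, pw η a * ∏ k, conj (vec ψ (a k)) := by
        have : braket (vec ψ) η ^ M = ∏ _i : Fin M, braket (vec ψ) η := by simp
        rw [this]
        unfold braket
        rw [prod_sum_fun]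
        exact Finset.sum_congr rfl fun a _ => by rw [Finset.prod_mul_distrib, pw, mul_comm]
      rw [hb, Finset.sum_mul, Finset.sum_mul, mix_eq_mul]
      exact Finset.sum_congr rfl fun a _ => by ring
    have hR : ∑ a, pw η a * (∑ x : Str N M, (if x.1 ⊆ Y then (coneCoeff d M k : ℂ) else 0) •
        special (pw φ) x) (a, b) = (nrm d M)⁻¹ * (coneCoeff d M k *
          ((∑ x ∈ Y.powersetCard M, (∏ n ∈ x, η (b n)) * ∏ n ∈ Y \ x, φ (b n)) *
            ∏ n ∈ Yᶜ, φ (b n))) := by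
      simp only [Finset.sum_apply, Pi.smul_apply, smul_eq_mul, Finset.mul_sum]
      rw [Finset.sum_comm]
      simp_rw [mul_left_comm (pw η _), ← Finset.mul_sum, sum_pw_mul_special]
      rw [Finset.sum_mul, Finset.mul_sum, Finset.mul_sum]
      have hset : (Finset.univ.filter fun x : Str N M => x.1 ⊆ Y).map
          (Function.Embedding.subtype _) = Y.powersetCard M := by
        ext x
        simp only [Finset.mem_map, Finset.mem_filter, Finset.mem_univ, true_and,
          Function.Embedding.subtype_apply, Finset.mem_powersetCard]
        constructor
        · rintro ⟨w, hw, rfl⟩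
          exact ⟨hw, w.2⟩
        · rintro ⟨h1, h2⟩
          exact ⟨⟨x, h2⟩, h1, rfl⟩
      rw [← hset, Finset.sum_map, Finset.sum_filter]
      refine Finset.sum_congr rfl fun x _ => ?_
      split_ifs with hx
      · rw [mix_eq_mul, Function.Embedding.subtype_apply]
        have hc : ∏ n ∈ x.1ᶜ, φ (b n) = (∏ n ∈ Y \ x.1, φ (b n)) * ∏ n ∈ Yᶜ, φ (b n) := by
          rw [← Finset.prod_union]
          · congr 1
            ext n
            have := @hx n
            simp only [Finset.mem_compl, Finset.mem_union, Finset.mem_sdiff]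
            tauto
          · rw [Finset.disjoint_left]
            intro n
            simp only [Finset.mem_compl, Finset.mem_sdiff]
            tauto
        rw [hc]
        ring
      · simp
    rw [hL, hR]
    have hI := integral_braket_pow_mul_braket_pow_mul_prod Y M k hY η φ b
    have hb : ((M + k).choose M : ℂ) ≠ 0 := by
      exact_mod_cast (Nat.choose_pos (by omega)).ne'
    rw [eq_comm, inv_mul_eq_iff_eq_mul₀ (nrm_ne_zero d M), ← mul_assoc, ← mul_assoc, nrm_mul_self,
      coneCoeff, ← mul_assoc]
    congr 1
    rw [← mul_right_inj' hb, mul_left_comm _ ((M + d - 1).choose M : ℂ), hI]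
    have hC := choose_ne_zero d (M + k)
    push_cast
    field_simp

/-- The cone of special states with nonnegative coefficients is invariant under `R`. -/
theorem exists_R_total_mulVec_chi {d M N : ℕ} [NeZero d] {α : Finset (Fin N) → ℝ}
    (hα : ∀ x, 0 ≤ α x) {β : Str N M → ℝ} (hβ : ∀ x, 0 ≤ β x) :
    ∃ γ : Str N M → ℝ, (∀ x, 0 ≤ γ x) ∧ ∀ Φ : Conf d (N - M) → ℂ, IsSymmetric Φ →
      R_total d M α *ᵥ chi β Φ = chi γ Φ := by
  refine ⟨fun x => ∑ y, ∑ z, α y * (β z *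
    (if x.1 ⊆ y ∪ z.1 then coneCoeff d M (y \ z.1).card else 0)), fun x => ?_, fun Φ hΦ => ?_⟩
  · refine Finset.sum_nonneg fun y _ => Finset.sum_nonneg fun z _ =>
      mul_nonneg (hα y) (mul_nonneg (hβ z) ?_)
    split_ifs
    · exact coneCoeff_nonneg _ _ _
    · exact le_rfl
  · have h1 : ∀ y, R_op d M y *ᵥ chi β Φ = ∑ z, (β z : ℂ) • (R_op d M y *ᵥ special Φ z) := by
      intro y
      rw [chi, ← mulVecLin_apply, map_sum]
      exact Finset.sum_congr rfl fun z _ => by rw [map_smul, mulVecLin_apply]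
    rw [R_total, sum_mulVec]
    simp_rw [smul_mulVec, h1, R_op_mulVec_special _ _ hΦ]
    ext p
    simp only [Finset.sum_apply, Pi.smul_apply, smul_eq_mul, chi_apply, Complex.ofReal_sum,
      Complex.ofReal_mul, Finset.mul_sum, Finset.sum_mul, apply_ite Complex.ofReal,
      Complex.ofReal_zero]
    rw [Finset.sum_comm (s := Finset.univ (α := Str N M)) (t := Finset.univ)]
    refine Finset.sum_congr rfl fun y _ => ?_
    rw [Finset.sum_comm]
    exact Finset.sum_congr rfl fun x _ => Finset.sum_congr rfl fun z _ => by ring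

/-! ### Channels and their fidelities -/

/-- The map with Kraus operators `K`. -/
noncomputable def krausMap {m n J : Type*} [Fintype m] [Fintype J] (K : J → Matrix n m ℂ) :
    Matrix m m ℂ →ₗ[ℂ] Matrix n n ℂ where
  toFun X := ∑ j, K j * X * (K j)ᴴ
  map_add' X Y := by simp only [Matrix.mul_add, Matrix.add_mul, Finset.sum_add_distrib]
  map_smul' c X := by simp [Finset.smul_sum]

theorem isChannel_krausMap {m n J : Type*} [Fintype m] [Fintype n] [Fintype J] [DecidableEq m]
    (K : J → Matrix n m ℂ) (hK : ∑ j, (K j)ᴴ * K j = 1) : IsChannel (krausMap K) := by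
  refine ⟨fun k X hX => ?_, fun X => ?_⟩
  · have h : amplify (krausMap K) k X = ∑ j, ((1 : Matrix (Fin k) (Fin k) ℂ) ⊗ₖ K j) * X *
        ((1 : Matrix (Fin k) (Fin k) ℂ) ⊗ₖ K j)ᴴ := by
      ext ⟨i, b⟩ ⟨i', b'⟩
      simp only [amplify, krausMap, of_apply, LinearMap.coe_mk, AddHom.coe_mk, Matrix.sum_apply]
      refine Finset.sum_congr rfl fun j _ => ?_
      simp only [Matrix.mul_apply, conjTranspose_apply, kroneckerMap_apply, of_apply,
        Fintype.sum_prod_type, one_apply, ite_mul, one_mul, zero_mul]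
      rw [Finset.sum_comm]
      refine Finset.sum_congr rfl fun a _ => ?_
      rw [Finset.sum_eq_single i']
      · rw [if_pos rfl]
        congr 1
        simp only [Finset.sum_ite_irrel, Finset.sum_const_zero, Finset.sum_ite_eq,
          Finset.mem_univ, if_true]
      · intro i'' _ hi
        rw [if_neg (Ne.symm hi)]
        simp
      · simp
    rw [h]
    exact posSemidef_sum _ fun j _ => hX.mul_mul_conjTranspose_same _
  · simp only [krausMap, LinearMap.coe_mk, AddHom.coe_mk, trace_sum]
    simp_rw [fun j => trace_mul_comm (K j * X) (K j)ᴴ, ← Matrix.mul_assoc, ← trace_sum,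
      ← Finset.sum_mul, hK, Matrix.one_mul]

/-- The Choi matrix of a map. -/
noncomputable def choi {m n : Type*} [DecidableEq m] (E : Matrix m m ℂ →ₗ[ℂ] Matrix n n ℂ) :
    Matrix (m × n) (m × n) ℂ :=
  Matrix.of fun p q => E (Matrix.single p.1 q.1 1) p.2 q.2

/-- The Choi matrix is the amplified map applied to the projector of the unnormalised maximally
entangled vector `w`, with the ancilla reindexed by `Fin k`. -/
theorem posSemidef_choi {m n : Type*} [Fintype m] [Fintype n] [DecidableEq m]
    {E : Matrix m m ℂ →ₗ[ℂ] Matrix n n ℂ} (hE : IsChannel E) : (choi E).PosSemidef := by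
  let e := Fintype.equivFin m
  let w : Fin (Fintype.card m) × m → ℂ := fun p => if e.symm p.1 = p.2 then 1 else 0
  have h := (hE.completely_positive _ _ (posSemidef_vecMulVec_self_star w)).submatrix
    (fun p : m × n => (e p.1, p.2))
  convert h using 1
  ext p q
  simp only [choi, amplify, of_apply, submatrix_apply]
  refine congrFun (congrFun (congrArg E ?_) p.2) q.2
  ext a a'
  simp only [w, single_apply, vecMulVec_apply, of_apply, Equiv.symm_apply_apply, Pi.star_apply]
  by_cases h1 : p.1 = a <;> by_cases h2 : q.1 = a' <;> simp [h1, h2]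

/-- Expanding the input state in matrix units pairs it with the Choi matrix through its transpose;
this is why `R_x` contains a transpose. -/
theorem trace_projOn_mul {d M N : ℕ}
    (E : Matrix (Conf d M) (Conf d M) ℂ →ₗ[ℂ] Matrix (Conf d N) (Conf d N) ℂ)
    (y : Finset (Fin N)) (ψ : PureState d) :
    (projOn y ψ * E (copies M ψ)).trace = (((copies M ψ)ᵀ ⊗ₖ projOn y ψ) * choi E).trace := by
  have h : E (copies M ψ) = ∑ a, ∑ a', copies M ψ a a' • E (Matrix.single a a' 1) := by
    conv_lhs => rw [matrix_eq_sum_single (copies M ψ)]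
    simp only [map_sum]
    refine Finset.sum_congr rfl fun a _ => Finset.sum_congr rfl fun a' _ => ?_
    rw [← map_smul, smul_single, smul_eq_mul, mul_one]
  rw [h]
  simp only [trace, diag_apply, Matrix.mul_apply, Matrix.sum_apply, Matrix.smul_apply,
    Fintype.sum_prod_type, kroneckerMap_apply, transpose_apply, choi, of_apply, smul_eq_mul,
    Finset.mul_sum]
  rw [Finset.sum_comm (s := Finset.univ (α := Conf d M))]
  refine Finset.sum_congr rfl fun b _ => ?_
  rw [Finset.sum_comm]
  exact Finset.sum_congr rfl fun c _ => Finset.sum_congr rfl fun c' _ =>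
    Finset.sum_congr rfl fun b' _ => by ring

theorem continuous_trace_kernel_mul {d M N : ℕ} (y : Finset (Fin N))
    (J : Matrix (Conf d M × Conf d N) (Conf d M × Conf d N) ℂ) :
    Continuous fun ψ : PureState d => (((copies M ψ)ᵀ ⊗ₖ projOn y ψ) * J).trace := by
  simp only [trace, diag_apply, Matrix.mul_apply]
  exact continuous_finsetSum _ fun p _ => continuous_finsetSum _ fun q _ =>
    (continuous_kernel_apply y p q).mul continuous_const

theorem trace_R_op_mul {d M N : ℕ} [NeZero d] (y : Finset (Fin N))
    (J : Matrix (Conf d M × Conf d N) (Conf d M × Conf d N) ℂ) :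
    (R_op d M y * J).trace = ((M + d - 1).choose M : ℂ) *
      ∫ ψ, (((copies M ψ)ᵀ ⊗ₖ projOn y ψ) * J).trace ∂(uniformPure d) := by
  simp only [trace, diag_apply, Matrix.mul_apply]
  have hi : ∀ p q, Integrable (fun ψ : PureState d =>
      ((copies M ψ)ᵀ ⊗ₖ projOn y ψ) p q * J q p) (uniformPure d) := fun p q =>
    (integrable_uniformPure (continuous_kernel_apply y p q)).mul_const _
  rw [integral_finsetSum _ fun p _ => integrable_finsetSum _ fun q _ => hi p q, Finset.mul_sum]
  refine Finset.sum_congr rfl fun p _ => ?_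
  rw [integral_finsetSum _ fun q _ => hi p q, Finset.mul_sum]
  refine Finset.sum_congr rfl fun q _ => ?_
  rw [integral_mul_const, ← mul_assoc, R_op, of_apply]

theorem choose_mul_fidelity {d M N : ℕ} [NeZero d]
    (E : Matrix (Conf d M) (Conf d M) ℂ →ₗ[ℂ] Matrix (Conf d N) (Conf d N) ℂ)
    (y : Finset (Fin N)) :
    ((M + d - 1).choose M : ℝ) * fidelity E y = (R_op d M y * choi E).trace.re := by
  rw [trace_R_op_mul, fidelity]
  simp_rw [trace_projOn_mul]
  have h : ∫ ψ, (((copies M ψ)ᵀ ⊗ₖ projOn y ψ) * choi E).trace.re ∂(uniformPure d) =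
      (∫ ψ, (((copies M ψ)ᵀ ⊗ₖ projOn y ψ) * choi E).trace ∂(uniformPure d)).re :=
    Complex.reCLM.integral_comp_comm
      (integrable_uniformPure (continuous_trace_kernel_mul y (choi E)))
  rw [h, ← Complex.ofReal_natCast, Complex.re_ofReal_mul]

theorem trace_copies {d M : ℕ} (ψ : PureState d) : (copies M ψ).trace = 1 := by
  have h : (copies M ψ).trace = star (pw (vec ψ) : Conf d M → ℂ) ⬝ᵥ pw (vec ψ) := by
    simp only [trace, diag_apply, copies_apply, dotProduct, Pi.star_apply, pw, star_prod,
      Complex.star_def]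
    exact Finset.sum_congr rfl fun a _ => mul_comm _ _
  rw [h, star_pw_dotProduct_pw, braket_vec_self, one_pow]

theorem fidelity_empty {d M N : ℕ} [NeZero d]
    {E : Matrix (Conf d M) (Conf d M) ℂ →ₗ[ℂ] Matrix (Conf d N) (Conf d N) ℂ}
    (hE : IsChannel E) : fidelity E ∅ = 1 := by
  simp [fidelity, projOn_empty, hE.trace_preserving, trace_copies]

/-! ### Kraus operators built from the special states. -/

theorem sum_bell_mul_bell {d n : ℕ} [NeZero d] (e e' : Conf d n) :
    ∑ c, bell n e c * bell n c e' = (nrm d n)⁻¹ * bell n e e' := by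
  have h : ∀ c, bell n e c * bell n c e' = nrm d n * ∫ ψ, (∏ k, conj (vec ψ (e k))) *
      (pw (vec ψ) c * bell n c e') ∂(uniformPure d) := by
    intro c
    rw [bell_eq_integral e c, mul_assoc, ← integral_mul_const]
    simp_rw [pw, mul_assoc]
  simp_rw [h]
  rw [← Finset.mul_sum, ← integral_finsetSum]
  · simp_rw [← Finset.mul_sum, sum_pw_mul_bell, mul_left_comm _ (nrm d n)⁻¹, pw]
    rw [integral_const_mul, mul_left_comm, bell_eq_integral e e']
  · intro c _
    simp_rw [pw]
    exact integrable_uniformPure (by fun_prop)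

theorem integral_conj_pw_mul_pw {d n : ℕ} [NeZero d] (e e' : Conf d n) :
    ∫ φ, conj (pw (vec φ) e) * pw (vec φ) e' ∂(uniformPure d) = (nrm d n)⁻¹ * bell n e e' := by
  rw [bell_eq_integral, inv_mul_cancel_left₀ (nrm_ne_zero d n)]
  simp_rw [pw, map_prod]

theorem continuous_pw_apply {d n : ℕ} (e : Conf d n) :
    Continuous fun φ : PureState d => pw (vec φ) e := by
  simp_rw [pw]
  fun_prop

/-- The columns of the Bell kernel and the uniformly distributed product states resolve the same
operator, the symmetric projector divided by its dimension. A finite Kraus sum can therefore be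
computed as an average over `φ`. -/
theorem sum_conj_chi_bell_mul_chi_bell {d M N : ℕ} [NeZero d] (β : Str N M → ℝ)
    (p q : Conf d M × Conf d N) :
    ∑ c, conj (chi β (fun e => bell (N - M) e c) p) * chi β (fun e => bell (N - M) e c) q =
      ∫ φ, conj (chi β (pw (vec φ)) p) * chi β (pw (vec φ)) q ∂(uniformPure d) := by
  simp only [chi_apply, special, map_sum, map_mul, Finset.sum_mul_sum, conj_bell]
  have hi : ∀ x z : Str N M, Integrable (fun φ : PureState d =>
      conj (β x : ℂ) * (bell M p.1 (restr x.1 x.2 p.2) *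
        conj (pw (vec φ) (restr x.1ᶜ (card_compl_str x) p.2))) *
      ((β z : ℂ) * (bell M q.1 (restr z.1 z.2 q.2) *
        pw (vec φ) (restr z.1ᶜ (card_compl_str z) q.2)))) (uniformPure d) := by
    intro x z
    refine integrable_uniformPure ?_
    have h1 := continuous_pw_apply (d := d) (restr x.1ᶜ (card_compl_str x) p.2)
    have h2 := continuous_pw_apply (d := d) (restr z.1ᶜ (card_compl_str z) q.2)
    have h3 := Complex.continuous_conj.comp h1
    simp only [Function.comp_def] at h3
    fun_prop
  rw [integral_finsetSum _ fun x _ => integrable_finsetSum _ fun z _ => hi x z, Finset.sum_comm]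
  refine Finset.sum_congr rfl fun x _ => ?_
  rw [integral_finsetSum _ fun z _ => hi x z, Finset.sum_comm]
  refine Finset.sum_congr rfl fun z _ => ?_
  have h1 : ∀ c : Conf d (N - M), (conj (β x : ℂ) * (bell M p.1 (restr x.1 x.2 p.2) *
        bell (N - M) (restr x.1ᶜ (card_compl_str x) p.2) c)) *
      ((β z : ℂ) * (bell M q.1 (restr z.1 z.2 q.2) *
        bell (N - M) (restr z.1ᶜ (card_compl_str z) q.2) c)) =
      (conj (β x : ℂ) * bell M p.1 (restr x.1 x.2 p.2) * ((β z : ℂ) *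
        bell M q.1 (restr z.1 z.2 q.2))) *
      (bell (N - M) (restr x.1ᶜ (card_compl_str x) p.2) c *
        bell (N - M) c (restr z.1ᶜ (card_compl_str z) q.2)) := by
    intro c
    rw [bell_comm c]
    ring
  have h2 : ∀ φ : PureState d, (conj (β x : ℂ) * (bell M p.1 (restr x.1 x.2 p.2) *
        conj (pw (vec φ) (restr x.1ᶜ (card_compl_str x) p.2)))) *
      ((β z : ℂ) * (bell M q.1 (restr z.1 z.2 q.2) *
        pw (vec φ) (restr z.1ᶜ (card_compl_str z) q.2))) =
      (conj (β x : ℂ) * bell M p.1 (restr x.1 x.2 p.2) * ((β z : ℂ) *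
        bell M q.1 (restr z.1 z.2 q.2))) *
      (conj (pw (vec φ) (restr x.1ᶜ (card_compl_str x) p.2)) *
        pw (vec φ) (restr z.1ᶜ (card_compl_str z) q.2)) := by
    intro φ
    ring
  simp_rw [h1, h2]
  rw [← Finset.mul_sum, sum_bell_mul_bell, integral_const_mul, integral_conj_pw_mul_pw]

/-- The symmetric projector on the input sites. -/
noncomputable def symProj (d M : ℕ) : Matrix (Conf d M) (Conf d M) ℂ :=
  Matrix.of fun a a' => nrm d M * bell M a a'

theorem symProj_mul_self (d M : ℕ) [NeZero d] : symProj d M * symProj d M = symProj d M := by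
  ext a a'
  simp only [symProj, Matrix.mul_apply, of_apply]
  have h : ∀ c, nrm d M * bell M a c * (nrm d M * bell M c a') =
      nrm d M * nrm d M * (bell M a c * bell M c a') := fun c => by ring
  simp_rw [h]
  rw [← Finset.mul_sum, sum_bell_mul_bell, mul_assoc, mul_inv_cancel_left₀ (nrm_ne_zero d M)]

theorem conjTranspose_symProj (d M : ℕ) : (symProj d M)ᴴ = symProj d M := by
  ext a a'
  simp [symProj, conj_nrm, conj_bell, bell_comm a]

/-- The vector `|χ⟩` as a matrix from the input to the output sites. -/
noncomputable def chiMat {d M N : ℕ} (β : Str N M → ℝ) (Φ : Conf d (N - M) → ℂ) :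
    Matrix (Conf d N) (Conf d M) ℂ :=
  Matrix.of fun b a => chi β Φ (a, b)

theorem chiMat_pw_mulVec_pw {d M N : ℕ} [NeZero d] (β : Str N M → ℝ) (η φ : Fin d → ℂ)
    (b : Conf d N) :
    (chiMat β (pw φ) *ᵥ pw η) b = (nrm d M)⁻¹ * ∑ x, (β x : ℂ) * mix x.1 η φ b := by
  simp_rw [mulVec, dotProduct, chiMat, of_apply, mul_comm _ (pw η _), chi_apply, Finset.mul_sum]
  rw [Finset.sum_comm]
  refine Finset.sum_congr rfl fun x _ => ?_
  simp_rw [mul_left_comm (pw η _)]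
  rw [← Finset.mul_sum, sum_pw_mul_special]
  ring

/-- Sites of `x ∩ z` give `⟨θ|η⟩` directly, and averaging over `φ` turns the remaining overlaps into
`⟨θ|η⟩^{M - x·z}`. Every pair thus yields the same power `M`, which makes the Kraus sum a multiple
of the symmetric projector. -/
theorem quad_empty_eq {d M N : ℕ} [NeZero d] (β : Str N M → ℝ) (θ η : Fin d → ℂ) :
    ∫ φ, ∑ b, conj (∑ x, (β x : ℂ) * mix x.1 θ (vec φ) b) *
      (∑ z, (β z : ℂ) * mix z.1 η (vec φ) b) ∂(uniformPure d) =
      (quad d (∅ : Finset (Fin N)) β : ℂ) * braket θ η ^ M := by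
  have hd : 1 ≤ d := NeZero.one_le
  have hpt : ∀ φ : PureState d, ∑ b, conj (∑ x, (β x : ℂ) * mix x.1 θ (vec φ) b) *
      (∑ z, (β z : ℂ) * mix z.1 η (vec φ) b) = ∑ x : Str N M, ∑ z : Str N M,
        ((β x : ℂ) * β z * braket θ η ^ (x.1 ∩ z.1).card) *
        (braket θ (vec φ) ^ (M - (x.1 ∩ z.1).card) *
          braket (vec φ) η ^ (M - (x.1 ∩ z.1).card)) := by
    intro φ
    simp_rw [map_sum, Finset.sum_mul_sum]
    rw [Finset.sum_comm]
    refine Finset.sum_congr rfl fun x _ => ?_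
    rw [Finset.sum_comm]
    refine Finset.sum_congr rfl fun z _ => ?_
    simp_rw [map_mul, Complex.conj_ofReal, mul_mul_mul_comm]
    rw [← Finset.mul_sum, star_mix_dotProduct_mix, braket_vec_self, one_pow, Finset.card_sdiff,
      Finset.card_sdiff, x.2, z.2, Finset.inter_comm z.1 x.1]
    ring
  simp_rw [hpt]
  have hi : ∀ x z : Str N M, Integrable (fun φ : PureState d =>
        ((β x : ℂ) * β z * braket θ η ^ (x.1 ∩ z.1).card) *
        (braket θ (vec φ) ^ (M - (x.1 ∩ z.1).card) *
          braket (vec φ) η ^ (M - (x.1 ∩ z.1).card))) (uniformPure d) := fun x z =>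
    integrable_uniformPure (by fun_prop)
  rw [integral_finsetSum _ fun x _ => integrable_finsetSum _ fun z _ => hi x z]
  simp only [quad, dotProduct, mulVec, Complex.ofReal_sum, Complex.ofReal_mul, Finset.sum_mul,
    Finset.mul_sum]
  refine Finset.sum_congr rfl fun x _ => ?_
  rw [integral_finsetSum _ fun z _ => hi x z]
  refine Finset.sum_congr rfl fun z _ => ?_
  have hle : (x.1 ∩ z.1).card ≤ M := by
    conv_rhs => rw [← x.2]
    exact Finset.card_le_card Finset.inter_subset_left
  rw [integral_const_mul, integral_braket_pow_mul, G, of_apply]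
  have hch : (M + d - 1 - (x.1 ∩ z.1).card + (x.1ᶜ ∩ z.1ᶜ ∩ ∅).card).choose (d - 1) =
      (M - (x.1 ∩ z.1).card + d - 1).choose (M - (x.1 ∩ z.1).card) := by
    rw [Finset.inter_empty, Finset.card_empty,
      show M + d - 1 - (x.1 ∩ z.1).card + 0 = M - (x.1 ∩ z.1).card + d - 1 by omega]
    exact Nat.choose_symm_of_eq_add (by omega)
  rw [hch]
  have hpow : braket θ η ^ M = braket θ η ^ (x.1 ∩ z.1).card *
      braket θ η ^ (M - (x.1 ∩ z.1).card) := by rw [← pow_add, Nat.add_sub_cancel' hle]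
  rw [hpow]
  push_cast
  ring

/-- Symmetry in both indices allows two successive contractions with product vectors to determine
the matrix. -/
theorem ext_of_star_pw_dotProduct {d M : ℕ} [NeZero d] {A B : Matrix (Conf d M) (Conf d M) ℂ}
    (hAr : ∀ a, IsSymmetric (A a)) (hBr : ∀ a, IsSymmetric (B a))
    (hAl : ∀ a', IsSymmetric fun a => A a a') (hBl : ∀ a', IsSymmetric fun a => B a a')
    (h : ∀ θ η : Fin d → ℂ, star (pw θ) ⬝ᵥ (A *ᵥ pw η) = star (pw θ) ⬝ᵥ (B *ᵥ pw η)) : A = B := by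
  have h1 : ∀ η : Fin d → ℂ, A *ᵥ pw η = B *ᵥ pw η := by
    intro η
    have hs : ∀ {A : Matrix (Conf d M) (Conf d M) ℂ}, (∀ a', IsSymmetric fun a => A a a') →
        IsSymmetric (A *ᵥ pw η) := by
      intro A hA π a
      simp only [mulVec, dotProduct]
      exact Finset.sum_congr rfl fun a' _ => congrArg (· * _) (hA a' π a)
    refine (hs hAl).ext_of_contract (hs hBl) fun θ => ?_
    have := h (star θ) η
    simpa [dotProduct, pw] using this
  ext a a'
  refine congrFun ((hAr a).ext_of_contract (hBr a) fun η => ?_) a'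
  have := congrFun (h1 η) a
  simpa [mulVec, dotProduct, mul_comm] using this

theorem conjTranspose_chiMat_mul_chiMat {d M N : ℕ} (β : Str N M → ℝ) (Φ : Conf d (N - M) → ℂ)
    (a a' : Conf d M) : ((chiMat β Φ)ᴴ * chiMat β Φ) a a' =
      ∑ b, conj (chi β Φ (a, b)) * chi β Φ (a', b) := by
  simp [Matrix.mul_apply, chiMat]

theorem continuous_chi_pw {d M N : ℕ} (β : Str N M → ℝ) (p : Conf d M × Conf d N) :
    Continuous fun φ : PureState d => chi β (pw (vec φ)) p := by
  simp only [chi_apply, special]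
  exact continuous_finsetSum _ fun x _ => continuous_const.mul (continuous_const.mul
    (continuous_pw_apply _))

theorem integrable_chiMat {d M N : ℕ} [NeZero d] (β : Str N M → ℝ) (a a' : Conf d M) :
    Integrable (fun φ : PureState d => ((chiMat β (pw (vec φ)))ᴴ *
      (chiMat β (pw (vec φ)) : Matrix (Conf d N) _ _)) a a') (uniformPure d) := by
  simp_rw [conjTranspose_chiMat_mul_chiMat]
  exact integrable_uniformPure (continuous_finsetSum _ fun b _ =>
    (Complex.continuous_conj.comp (continuous_chi_pw β (a, b))).mul (continuous_chi_pw β (a', b)))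

theorem sum_conjTranspose_chiMat_mul_chiMat {d M N : ℕ} [NeZero d] (β : Str N M → ℝ) :
    (nrm d M * nrm d M) • ∑ c, (chiMat β fun e => bell (N - M) e c)ᴴ *
      (chiMat β (fun e => bell (N - M) e c) : Matrix (Conf d N) _ _) =
      (quad d (∅ : Finset (Fin N)) β : ℂ) • symProj d M := by
  have hentry : ∀ a a', (∑ c, (chiMat β fun e => bell (N - M) e c)ᴴ *
      (chiMat β (fun e => bell (N - M) e c) : Matrix (Conf d N) (Conf d M) ℂ)) a a' =
      ∫ φ, ((chiMat β (pw (vec φ)))ᴴ * (chiMat β (pw (vec φ)) : Matrix (Conf d N) _ _)) a a'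
        ∂(uniformPure d) := by
    intro a a'
    rw [Matrix.sum_apply]
    simp_rw [conjTranspose_chiMat_mul_chiMat]
    rw [Finset.sum_comm, integral_finsetSum]
    swap
    · exact fun b _ => integrable_uniformPure
        ((Complex.continuous_conj.comp (continuous_chi_pw β (a, b))).mul
          (continuous_chi_pw β (a', b)))
    exact Finset.sum_congr rfl fun b _ => sum_conj_chi_bell_mul_chi_bell β (a, b) (a', b)
  refine ext_of_star_pw_dotProduct ?_ ?_ ?_ ?_ fun θ η => ?_
  · intro a π a'
    simp only [Matrix.smul_apply, Matrix.sum_apply, conjTranspose_chiMat_mul_chiMat]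
    congr 1
    exact Finset.sum_congr rfl fun c _ => Finset.sum_congr rfl fun b _ =>
      congrArg _ (inSymmetric_chi β _ b π a')
  · intro a π a'
    simp only [Matrix.smul_apply, symProj, of_apply, bell_comm a]
    rw [show bell M (a' ∘ π) a = bell M a' a from bell_comp_left a π a']
  · intro a' π a
    simp only [Matrix.smul_apply, Matrix.sum_apply, conjTranspose_chiMat_mul_chiMat]
    congr 1
    exact Finset.sum_congr rfl fun c _ => Finset.sum_congr rfl fun b _ =>
      congrArg (conj · * _) (inSymmetric_chi β _ b π a)
  · intro a' π a
    simp only [Matrix.smul_apply, symProj, of_apply]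
    rw [show bell M (a ∘ π) a' = bell M a a' from bell_comp_left a' π a]
  · have hP : symProj d M *ᵥ pw η = pw η := by
      ext a
      simp only [mulVec, dotProduct, symProj, of_apply, bell_comm a]
      simp_rw [mul_assoc, mul_comm _ (pw η _)]
      rw [← Finset.mul_sum, sum_pw_mul_bell, mul_inv_cancel_left₀ (nrm_ne_zero d M)]
    rw [smul_mulVec, smul_mulVec, hP, dotProduct_smul, dotProduct_smul, star_pw_dotProduct_pw]
    have hL : star (pw θ) ⬝ᵥ ((∑ c, (chiMat β fun e => bell (N - M) e c)ᴴ *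
        (chiMat β (fun e => bell (N - M) e c) : Matrix (Conf d N) (Conf d M) ℂ)) *ᵥ pw η) =
        ∫ φ, star (pw θ) ⬝ᵥ (((chiMat β (pw (vec φ)))ᴴ *
          (chiMat β (pw (vec φ)) : Matrix (Conf d N) (Conf d M) ℂ)) *ᵥ pw η)
          ∂(uniformPure d) := by
      simp only [dotProduct, mulVec, hentry]
      rw [integral_finsetSum _ fun a _ => (integrable_finsetSum _ fun a' _ =>
        (integrable_chiMat β a a').mul_const _).const_mul _]
      refine Finset.sum_congr rfl fun a _ => ?_
      rw [integral_const_mul, integral_finsetSum _ fun a' _ =>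
        (integrable_chiMat β a a').mul_const _]
      simp_rw [integral_mul_const]
    have hpt : ∀ φ : PureState d, star (pw θ) ⬝ᵥ (((chiMat β (pw (vec φ)))ᴴ *
        (chiMat β (pw (vec φ)) : Matrix (Conf d N) (Conf d M) ℂ)) *ᵥ pw η) =
        (nrm d M)⁻¹ * (nrm d M)⁻¹ * ∑ b, conj (∑ x, (β x : ℂ) * mix x.1 θ (vec φ) b) *
          (∑ z, (β z : ℂ) * mix z.1 η (vec φ) b) := by
      intro φ
      rw [← mulVec_mulVec, dotProduct_mulVec, vecMul_conjTranspose, star_star, Finset.mul_sum,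
        dotProduct]
      refine Finset.sum_congr rfl fun b _ => ?_
      rw [Pi.star_apply, chiMat_pw_mulVec_pw, chiMat_pw_mulVec_pw, Complex.star_def, map_mul,
        map_inv₀, conj_nrm]
      ring
    rw [hL]
    simp_rw [hpt]
    rw [integral_const_mul, quad_empty_eq, smul_eq_mul, smul_eq_mul, ← mul_inv,
      mul_inv_cancel_left₀ (mul_ne_zero (nrm_ne_zero d M) (nrm_ne_zero d M))]

/-- The Kraus operators of the cloning map with coefficients `β`. -/
noncomputable def cloneKraus {d M N : ℕ} [NeZero d] (β : Str N M → ℝ) :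
    Conf d (N - M) ⊕ Conf d M → Matrix (Conf d N) (Conf d M) ℂ
  | .inl c => nrm d M • chiMat β (fun e => bell (N - M) e c)
  -- Inputs orthogonal to the symmetric subspace are sent to a fixed basis state; this restores
  -- trace preservation and is invisible to `R_y`.
  | .inr a₀ => vecMulVec (Pi.single 0 1) ((1 - symProj d M) a₀)

theorem sum_conjTranspose_cloneKraus_mul {d M N : ℕ} [NeZero d] {β : Str N M → ℝ}
    (hβ : quad d (∅ : Finset (Fin N)) β = 1) :
    ∑ j, (cloneKraus (d := d) β j)ᴴ * cloneKraus β j = 1 := by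
  have h1 := sum_conjTranspose_chiMat_mul_chiMat (d := d) β
  rw [hβ, Complex.ofReal_one, one_smul] at h1
  have h2 : ∑ a₀ : Conf d M, (vecMulVec (Pi.single (0 : Conf d N) (1 : ℂ))
      ((1 - symProj d M) a₀))ᴴ * vecMulVec (Pi.single (0 : Conf d N) (1 : ℂ))
      ((1 - symProj d M) a₀) = (1 - symProj d M)ᴴ * (1 - symProj d M) := by
    ext a a'
    simp only [Matrix.sum_apply, Matrix.mul_apply, conjTranspose_apply, vecMulVec_apply,
      Pi.single_apply]
    refine Finset.sum_congr rfl fun a₀ _ => ?_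
    rw [Finset.sum_eq_single 0]
    · simp
    · intro b _ hb
      simp [hb]
    · simp
  have h3 : (1 - symProj d M)ᴴ * (1 - symProj d M) = 1 - symProj d M := by
    rw [conjTranspose_sub, conjTranspose_one, conjTranspose_symProj, Matrix.mul_sub,
      Matrix.sub_mul, Matrix.sub_mul, symProj_mul_self]
    simp
  rw [Fintype.sum_sum_type]
  simp only [cloneKraus]
  rw [h2, h3]
  have h4 : ∀ c, (nrm d M • chiMat β fun e => bell (N - M) e c)ᴴ *
      (nrm d M • chiMat β (fun e => bell (N - M) e c) : Matrix (Conf d N) (Conf d M) ℂ) =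
      (nrm d M * nrm d M) • ((chiMat β fun e => bell (N - M) e c)ᴴ *
        chiMat β (fun e => bell (N - M) e c)) := by
    intro c
    rw [conjTranspose_smul, Matrix.smul_mul, Matrix.mul_smul, smul_smul, Complex.star_def, conj_nrm]
  simp_rw [h4]
  rw [← Finset.smul_sum, h1]
  simp

theorem sum_star_bell_dotProduct_bell (d n : ℕ) [NeZero d] :
    ∑ c : Conf d n, star (fun e => bell n e c) ⬝ᵥ (fun e => bell n e c) = 1 := by
  simp only [dotProduct, Pi.star_apply, Complex.star_def, conj_bell]
  rw [Finset.sum_comm]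
  have h : ∀ e : Conf d n, ∑ c, bell n e c * bell n e c =
      ∫ φ, conj (pw (vec φ) e) * pw (vec φ) e ∂(uniformPure d) := by
    intro e
    rw [integral_conj_pw_mul_pw, ← sum_bell_mul_bell]
    exact Finset.sum_congr rfl fun c _ => by rw [bell_comm c]
  simp_rw [h]
  rw [← integral_finsetSum]
  · have : ∀ φ : PureState d, ∑ e : Conf d n, conj (pw (vec φ) e) * pw (vec φ) e = 1 := by
      intro φ
      have := star_pw_dotProduct_pw (n := n) (vec φ) (vec φ)
      rwa [braket_vec_self, one_pow] at this
    simp_rw [this]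
    simp
  · intro e _
    have h1 := continuous_pw_apply (d := d) e
    exact integrable_uniformPure ((Complex.continuous_conj.comp h1).mul h1)

theorem trace_mul_choi_krausMap {m n J : Type*} [Fintype m] [Fintype n] [Fintype J]
    [DecidableEq m] (K : J → Matrix n m ℂ) (A : Matrix (m × n) (m × n) ℂ) :
    (A * choi (krausMap K)).trace =
      ∑ j, star (fun p : m × n => K j p.2 p.1) ⬝ᵥ (A *ᵥ fun p : m × n => K j p.2 p.1) := by
  have h : ∀ p q, choi (krausMap K) p q = ∑ j, K j p.2 p.1 * star (K j q.2 q.1) := by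
    intro p q
    simp only [choi, krausMap, of_apply, LinearMap.coe_mk, AddHom.coe_mk, Matrix.sum_apply]
    refine Finset.sum_congr rfl fun j _ => ?_
    simp only [Matrix.mul_apply, single_apply, conjTranspose_apply]
    rw [Finset.sum_eq_single q.1]
    · rw [Finset.sum_eq_single p.1]
      · simp
      · intro a _ ha
        simp [Ne.symm ha]
      · simp
    · intro a _ ha
      simp [Ne.symm ha]
    · simp
  simp only [trace, diag_apply, Matrix.mul_apply, h, dotProduct, mulVec, Finset.mul_sum,
    Pi.star_apply]
  symm
  rw [Finset.sum_comm]
  refine Finset.sum_congr rfl fun p _ => ?_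
  rw [Finset.sum_comm]
  exact Finset.sum_congr rfl fun q _ => Finset.sum_congr rfl fun j _ => by ring

/-- Each operator from the first family contributes `βᵀ G_y β` times the squared norm of its Bell
column, and these norms sum to one. The second family contributes nothing, because `R_y = R_y R_∅`.
-/
theorem fidelity_krausMap_cloneKraus {d M N : ℕ} [NeZero d] (β : Str N M → ℝ)
    (y : Finset (Fin N)) : fidelity (krausMap (cloneKraus (d := d) β)) y = quad d y β := by
  have h := choose_mul_fidelity (krausMap (cloneKraus (d := d) β)) y
  rw [trace_mul_choi_krausMap, Fintype.sum_sum_type] at h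
  have h1 : ∀ c, star (fun p : Conf d M × Conf d N => cloneKraus β (.inl c) p.2 p.1) ⬝ᵥ
      (R_op d M y *ᵥ fun p : Conf d M × Conf d N => cloneKraus β (.inl c) p.2 p.1) =
      ((M + d - 1).choose M : ℂ) * ((quad d y β : ℂ) *
        (star (fun e => bell (N - M) e c) ⬝ᵥ fun e => bell (N - M) e c)) := by
    intro c
    have hk : (fun p : Conf d M × Conf d N => cloneKraus β (.inl c) p.2 p.1) =
        nrm d M • chi β (fun e => bell (N - M) e c) := rfl
    rw [hk, star_smul, mulVec_smul, smul_dotProduct, dotProduct_smul,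
      star_chi_dotProduct_R_op y β (bell_comp_left c), Complex.star_def, conj_nrm, smul_eq_mul,
      smul_eq_mul, ← mul_assoc, nrm_mul_self]
  have h2 : ∀ a₀, (R_op d M y *ᵥ fun p : Conf d M × Conf d N =>
      cloneKraus β (.inr a₀) p.2 p.1) = 0 := by
    intro a₀
    rw [← R_op_mul_R_op_empty, ← mulVec_mulVec]
    have h3 : (R_op d M (∅ : Finset (Fin N)) *ᵥ fun p : Conf d M × Conf d N =>
      cloneKraus β (.inr a₀) p.2 p.1) = 0 := by
      ext ⟨a, b⟩
      rw [R_op_empty_mulVec, Finset.mul_sum]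
      simp only [cloneKraus, vecMulVec_apply]
      have h4 : ((1 - symProj d M) * symProj d M) a₀ a = 0 := by
        rw [Matrix.sub_mul, symProj_mul_self]
        simp
      rw [Matrix.mul_apply] at h4
      simp only [symProj, of_apply, Pi.zero_apply] at h4 ⊢
      rw [← mul_zero ((Pi.single 0 1 : Conf d N → ℂ) b), ← h4, Finset.mul_sum]
      refine Finset.sum_congr rfl fun a' _ => ?_
      rw [bell_comm a]
      ring
    rw [h3, mulVec_zero]
  simp_rw [h1, h2, dotProduct_zero] at h
  rw [Finset.sum_const_zero, add_zero, ← Finset.mul_sum, ← Finset.mul_sum,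
    sum_star_bell_dotProduct_bell, mul_one, ← Complex.ofReal_natCast, ← Complex.ofReal_mul,
    Complex.ofReal_re] at h
  refine mul_left_cancel₀ ?_ h
  have := choose_ne_zero d M
  exact_mod_cast this

/-! ### The action of the unitary group and of its Lie algebra -/

theorem tensor_mul_tensor {d n : ℕ} (A B : Fin n → Matrix (Fin d) (Fin d) ℂ) :
    tensor A * tensor B = tensor fun k => A k * B k := by
  ext b b'
  simp only [tensor, Matrix.mul_apply, of_apply]
  rw [prod_sum_fun]
  exact Finset.sum_congr rfl fun c _ => Finset.prod_mul_distrib.symm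

/-- The operator `A` acting on the site `k`. -/
def siteOp {d n : ℕ} (k : Fin n) (A : Matrix (Fin d) (Fin d) ℂ) :
    Matrix (Conf d n) (Conf d n) ℂ :=
  tensor (Function.update (fun _ => 1) k A)

theorem siteOp_apply {d n : ℕ} (k : Fin n) (A : Matrix (Fin d) (Fin d) ℂ) (b b' : Conf d n) :
    siteOp k A b b' = (∏ l ∈ Finset.univ.erase k, (1 : Matrix (Fin d) (Fin d) ℂ) (b l) (b' l)) *
      A (b k) (b' k) := by
  rw [siteOp, tensor, of_apply, ← Finset.prod_erase_mul _ _ (Finset.mem_univ k),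
    Function.update_self]
  congr 1
  refine Finset.prod_congr rfl fun l hl => ?_
  rw [Function.update_of_ne (Finset.ne_of_mem_erase hl)]

theorem siteOp_mul_same {d n : ℕ} (k : Fin n) (A B : Matrix (Fin d) (Fin d) ℂ) :
    siteOp k A * siteOp k B = siteOp k (A * B) := by
  rw [siteOp, siteOp, siteOp, tensor_mul_tensor]
  congr 1
  ext l : 1
  by_cases h : l = k
  · subst h; simp
  · simp [h]

theorem siteOp_mul_comm {d n : ℕ} {k l : Fin n} (hkl : k ≠ l) (A B : Matrix (Fin d) (Fin d) ℂ) :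
    siteOp k A * siteOp l B = siteOp l B * siteOp k A := by
  rw [siteOp, siteOp, tensor_mul_tensor, tensor_mul_tensor]
  congr 1
  ext j : 1
  by_cases h : j = k
  · subst h; simp [hkl]
  · simp [h]

/-- The sum over all sites of the operator `A`. -/
def siteSum (n : ℕ) {d : ℕ} : Matrix (Fin d) (Fin d) ℂ →ₗ[ℂ] Matrix (Conf d n) (Conf d n) ℂ where
  toFun A := ∑ k, siteOp k A
  map_add' A B := by
    rw [← Finset.sum_add_distrib]
    refine Finset.sum_congr rfl fun k _ => ?_
    ext b b'
    simp only [siteOp_apply, Matrix.add_apply, mul_add]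
  map_smul' c A := by
    rw [RingHom.id_apply, Finset.smul_sum]
    refine Finset.sum_congr rfl fun k _ => ?_
    ext b b'
    simp only [siteOp_apply, Matrix.smul_apply, smul_eq_mul, mul_left_comm]

theorem siteSum_eq {n d : ℕ} (A : Matrix (Fin d) (Fin d) ℂ) :
    siteSum n A = ∑ k, siteOp k A := rfl

theorem siteSum_commutator {n d : ℕ} (A B : Matrix (Fin d) (Fin d) ℂ) :
    siteSum n A * siteSum n B - siteSum n B * siteSum n A = siteSum n (A * B - B * A) := by
  rw [map_sub]
  simp only [siteSum_eq]
  rw [Finset.sum_mul_sum, Finset.sum_mul_sum, Finset.sum_comm (γ := Fin n)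
    (f := fun i j => siteOp i B * siteOp j A), ← Finset.sum_sub_distrib, ← Finset.sum_sub_distrib]
  refine Finset.sum_congr rfl fun k _ => ?_
  rw [← Finset.sum_sub_distrib, Finset.sum_eq_single k]
  · rw [siteOp_mul_same, siteOp_mul_same]
  · intro l _ hl
    rw [siteOp_mul_comm (Ne.symm hl), sub_self]
  · simp

theorem conjTranspose_siteSum {n d : ℕ} (A : Matrix (Fin d) (Fin d) ℂ) :
    (siteSum n A)ᴴ = siteSum n Aᴴ := by
  simp only [siteSum_eq, conjTranspose_sum]
  refine Finset.sum_congr rfl fun k _ => ?_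
  ext b b'
  simp only [conjTranspose_apply, siteOp_apply, star_mul', star_prod]
  congr 1
  refine Finset.prod_congr rfl fun l _ => ?_
  rw [← conjTranspose_apply, conjTranspose_one]

/-- The generators of the representation `Ū^{⊗ M} ⊗ U^{⊗ N}`. -/
noncomputable def lieOp (M N : ℕ) {d : ℕ} :
    Matrix (Fin d) (Fin d) ℂ →ₗ[ℂ] Matrix (Conf d M × Conf d N) (Conf d M × Conf d N) ℂ where
  toFun A := (1 : Matrix (Conf d M) (Conf d M) ℂ) ⊗ₖ siteSum N A -
    siteSum M Aᵀ ⊗ₖ (1 : Matrix (Conf d N) (Conf d N) ℂ)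
  map_add' A B := by
    rw [map_add, transpose_add, map_add, kronecker_add, add_kronecker]
    abel
  map_smul' c A := by
    rw [map_smul, transpose_smul, map_smul, kronecker_smul, smul_kronecker, RingHom.id_apply,
      smul_sub]

theorem lieOp_eq {M N d : ℕ} (A : Matrix (Fin d) (Fin d) ℂ) :
    lieOp M N A = (1 : Matrix (Conf d M) (Conf d M) ℂ) ⊗ₖ siteSum N A -
      siteSum M Aᵀ ⊗ₖ (1 : Matrix (Conf d N) (Conf d N) ℂ) := rfl

theorem kronecker_sub_right {m n : Type*} (A : Matrix m m ℂ) (B C : Matrix n n ℂ) :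
    A ⊗ₖ (B - C) = A ⊗ₖ B - A ⊗ₖ C := by
  ext p q
  simp [mul_sub]

theorem kronecker_sub_left {m n : Type*} (A B : Matrix m m ℂ) (C : Matrix n n ℂ) :
    (A - B) ⊗ₖ C = A ⊗ₖ C - B ⊗ₖ C := by
  ext p q
  simp [sub_mul]

theorem lieOp_commutator {M N d : ℕ} (A B : Matrix (Fin d) (Fin d) ℂ) :
    lieOp M N A * lieOp M N B - lieOp M N B * lieOp M N A = lieOp M N (A * B - B * A) := by
  have h1 := siteSum_commutator (n := N) A B
  have h2 := siteSum_commutator (n := M) Bᵀ Aᵀ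
  rw [← transpose_mul, ← transpose_mul, ← transpose_sub] at h2
  rw [lieOp_eq (A * B - B * A), ← h1, ← h2]
  simp only [lieOp_eq, Matrix.mul_sub, Matrix.sub_mul, ← mul_kronecker_mul, Matrix.one_mul,
    Matrix.mul_one, kronecker_sub_right, kronecker_sub_left]
  abel

theorem conjTranspose_lieOp {M N d : ℕ} (A : Matrix (Fin d) (Fin d) ℂ) :
    (lieOp M N A)ᴴ = lieOp M N Aᴴ := by
  rw [lieOp_eq, lieOp_eq, conjTranspose_sub, conjTranspose_kronecker, conjTranspose_kronecker,
    conjTranspose_siteSum, conjTranspose_siteSum, conjTranspose_one, conjTranspose_one]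
  rfl

/-! ### Covariance under unitaries and its infinitesimal form. -/

/-- The representation `Ū^{⊗ M} ⊗ U^{⊗ N}`. -/
noncomputable def unitaryRep (M N : ℕ) {d : ℕ} (U : Matrix (Fin d) (Fin d) ℂ) :
    Matrix (Conf d M × Conf d N) (Conf d M × Conf d N) ℂ :=
  tensor (fun _ => U.map conj) ⊗ₖ tensor fun _ => U

/-- The action of unitary matrices on pure states. -/
noncomputable def rotate {d : ℕ} (U : Matrix (Fin d) (Fin d) ℂ) (hU : Uᴴ * U = 1)
    (ψ : PureState d) : PureState d :=
  ⟨WithLp.toLp 2 (U *ᵥ vec ψ), by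
    have h1 : star (U *ᵥ vec ψ) ⬝ᵥ (U *ᵥ vec ψ) = 1 := by
      rw [star_mulVec, dotProduct_mulVec, vecMul_vecMul, hU, vecMul_one]
      exact braket_vec_self ψ
    have h2 : ((‖WithLp.toLp 2 (U *ᵥ vec ψ)‖ ^ 2 : ℝ) : ℂ) = 1 := by
      rw [EuclideanSpace.norm_sq_eq, ← h1, dotProduct, Complex.ofReal_sum]
      refine Finset.sum_congr rfl fun s _ => ?_
      rw [← Complex.normSq_eq_norm_sq, ← Complex.mul_conj, mul_comm]
      rfl
    have h3 : ‖WithLp.toLp 2 (U *ᵥ vec ψ)‖ ^ 2 = 1 := by exact_mod_cast h2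
    rw [mem_sphere_zero_iff_norm]
    exact (pow_eq_one_iff_of_nonneg (norm_nonneg _) two_ne_zero).mp h3⟩

theorem vec_rotate {d : ℕ} (U : Matrix (Fin d) (Fin d) ℂ) (hU : Uᴴ * U = 1) (ψ : PureState d) :
    vec (rotate U hU ψ) = U *ᵥ vec ψ := rfl

theorem integral_rotate {d : ℕ} (U : Matrix (Fin d) (Fin d) ℂ) (hU : Uᴴ * U = 1)
    {f : PureState d → ℂ} (hf : Continuous f) :
    ∫ ψ, f (rotate U hU ψ) ∂(uniformPure d) = ∫ ψ, f ψ ∂(uniformPure d) := by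
  have hU' : U * Uᴴ = 1 := mul_eq_one_comm.mp hU
  let T : EuclideanSpace ℂ (Fin d) ≃ₗ[ℝ] EuclideanSpace ℂ (Fin d) :=
    { toFun := fun x => WithLp.toLp 2 (U *ᵥ x.ofLp)
      invFun := fun x => WithLp.toLp 2 (Uᴴ *ᵥ x.ofLp)
      map_add' := fun x y => by simp [mulVec_add]
      map_smul' := fun c x => by
        ext s
        simp [mulVec_smul]
      left_inv := fun x => by simp [hU]
      right_inv := fun x => by simp [hU'] }
  have hT : ∀ x, ‖T x‖ = ‖x‖ := by
    intro x
    have h : ∀ z : EuclideanSpace ℂ (Fin d),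
        ((‖z‖ ^ 2 : ℝ) : ℂ) = star z.ofLp ⬝ᵥ z.ofLp := by
      intro z
      rw [EuclideanSpace.norm_sq_eq, dotProduct, Complex.ofReal_sum]
      refine Finset.sum_congr rfl fun s _ => ?_
      rw [← Complex.normSq_eq_norm_sq, ← Complex.mul_conj, mul_comm]
      rfl
    have h2 : ((‖T x‖ ^ 2 : ℝ) : ℂ) = ((‖x‖ ^ 2 : ℝ) : ℂ) := by
      rw [h, h]
      change star (U *ᵥ x.ofLp) ⬝ᵥ (U *ᵥ x.ofLp) = _
      rw [star_mulVec, dotProduct_mulVec, vecMul_vecMul, hU, vecMul_one]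
    have h3 : ‖T x‖ ^ 2 = ‖x‖ ^ 2 := by exact_mod_cast h2
    exact (sq_eq_sq₀ (norm_nonneg _) (norm_nonneg _)).mp h3
  exact integral_comp_isometry ⟨T, hT⟩ (rotate U hU) (fun ψ => rfl) f hf

theorem mul_proj {d : ℕ} (U : Matrix (Fin d) (Fin d) ℂ) (hU : Uᴴ * U = 1) (ψ : PureState d) :
    U * proj ψ = proj (rotate U hU ψ) * U := by
  have h : ∀ ψ : PureState d, proj ψ = vecMulVec (vec ψ) (star (vec ψ)) := fun ψ => rfl
  rw [h, h, vec_rotate, mul_vecMulVec, vecMulVec_mul, star_mulVec, vecMul_vecMul, hU, vecMul_one]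

theorem map_conj_mul_transpose_proj {d : ℕ} (U : Matrix (Fin d) (Fin d) ℂ) (hU : Uᴴ * U = 1)
    (ψ : PureState d) :
    U.map conj * (proj ψ)ᵀ = (proj (rotate U hU ψ))ᵀ * U.map conj := by
  have h : ∀ ψ : PureState d, (proj ψ)ᵀ = (proj ψ).map conj := by
    intro ψ
    ext s t
    simp [proj, mul_comm]
  rw [h, h, ← Matrix.map_mul, ← Matrix.map_mul, mul_proj U hU]

theorem unitaryRep_mul_kernel {d M N : ℕ} (U : Matrix (Fin d) (Fin d) ℂ) (hU : Uᴴ * U = 1)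
    (y : Finset (Fin N)) (ψ : PureState d) :
    unitaryRep M N U * ((copies M ψ)ᵀ ⊗ₖ projOn y ψ) =
      ((copies M (rotate U hU ψ))ᵀ ⊗ₖ projOn y (rotate U hU ψ)) * unitaryRep M N U := by
  have h1 : ∀ ψ : PureState d, (copies M ψ)ᵀ = tensor fun _ => (proj ψ)ᵀ := fun ψ => rfl
  rw [unitaryRep, ← mul_kronecker_mul, ← mul_kronecker_mul, h1, h1, projOn, projOn,
    tensor_mul_tensor, tensor_mul_tensor, tensor_mul_tensor, tensor_mul_tensor,
    map_conj_mul_transpose_proj U hU]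
  congr 2
  ext n : 1
  split_ifs
  · rw [mul_proj U hU]
  · simp

/-- Conjugation by the representation rotates `ψ` in the kernel, and the average over `ψ` is
invariant under this rotation. -/
theorem unitaryRep_mul_R_op {d M N : ℕ} [NeZero d] (U : Matrix (Fin d) (Fin d) ℂ)
    (hU : Uᴴ * U = 1) (y : Finset (Fin N)) :
    unitaryRep M N U * R_op d M y = R_op d M y * unitaryRep M N U := by
  have hl : ∀ p q, (unitaryRep M N U * R_op d M y) p q = ((M + d - 1).choose M : ℂ) *
      ∫ ψ, (unitaryRep M N U * ((copies M ψ)ᵀ ⊗ₖ projOn y ψ)) p q ∂(uniformPure d) := by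
    intro p q
    simp only [Matrix.mul_apply]
    rw [integral_finsetSum _ fun r _ =>
      (integrable_uniformPure (continuous_kernel_apply y r q)).const_mul _, Finset.mul_sum]
    refine Finset.sum_congr rfl fun r _ => ?_
    rw [integral_const_mul, R_op, of_apply, mul_left_comm]
  have hr : ∀ p q, (R_op d M y * unitaryRep M N U) p q = ((M + d - 1).choose M : ℂ) *
      ∫ ψ, (((copies M ψ)ᵀ ⊗ₖ projOn y ψ) * unitaryRep M N U) p q ∂(uniformPure d) := by
    intro p q
    simp only [Matrix.mul_apply]
    rw [integral_finsetSum _ fun r _ =>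
      (integrable_uniformPure (continuous_kernel_apply y p r)).mul_const _, Finset.mul_sum]
    refine Finset.sum_congr rfl fun r _ => ?_
    rw [integral_mul_const, R_op, of_apply, mul_assoc]
  ext p q
  rw [hl, hr]
  simp_rw [unitaryRep_mul_kernel U hU]
  rw [integral_rotate U hU (f := fun ψ => (((copies M ψ)ᵀ ⊗ₖ projOn y ψ) * unitaryRep M N U) p q)]
  simp only [Matrix.mul_apply]
  exact continuous_finsetSum _ fun r _ => (continuous_kernel_apply y p r).mul continuous_const

theorem tensor_mulVec_pw {d n : ℕ} (U : Matrix (Fin d) (Fin d) ℂ) (φ : Fin d → ℂ) :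
    (tensor fun _ : Fin n => U) *ᵥ pw φ = pw (U *ᵥ φ) := by
  ext b
  simp only [mulVec, dotProduct, tensor, of_apply, pw]
  rw [prod_sum_fun]
  exact Finset.sum_congr rfl fun c _ => Finset.prod_mul_distrib.symm

/-- The Bell state is an average of `ψ̄^{⊗M} ⊗ ψ^{⊗M}`, so it is invariant under `Ū^{⊗M} ⊗ U^{⊗M}`;
only `Φ` is rotated. -/
theorem unitaryRep_mulVec_special {d M N : ℕ} [NeZero d] (U : Matrix (Fin d) (Fin d) ℂ)
    (hU : Uᴴ * U = 1) (x : Str N M) {Φ : Conf d (N - M) → ℂ} (hΦ : IsSymmetric Φ) :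
    unitaryRep M N U *ᵥ special Φ x = special ((tensor fun _ => U) *ᵥ Φ) x := by
  have hΦ' := hΦ.mem_span
  clear hΦ
  induction hΦ' using Submodule.span_induction with
  | zero => simp [special_zero]
  | add _ _ _ _ h1 h2 => simp only [special_add, mulVec_add, h1, h2]
  | smul c _ _ h1 => simp only [special_smul, mulVec_smul, h1]
  | mem _ h =>
    obtain ⟨φ, rfl⟩ := h
    rw [tensor_mulVec_pw]
    have hsp : ∀ (φ : Fin d → ℂ) (a : Conf d M) (b : Conf d N), special (pw φ) x (a, b) =
        nrm d M * ∫ ψ, pw (star (vec ψ)) a * mix x.1 (vec ψ) φ b ∂(uniformPure d) := by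
      intro φ a b
      rw [special_pw, bell_eq_integral, mul_assoc, ← integral_mul_const]
      simp_rw [prod_restr x.1 x.2 b, mix_eq_mul, mul_assoc]
      rfl
    have hcont : ∀ (φ : Fin d → ℂ) (a : Conf d M) (b : Conf d N),
        Continuous fun ψ : PureState d => pw (star (vec ψ)) a * mix x.1 (vec ψ) φ b := by
      intro φ a b
      refine Continuous.mul ?_ (continuous_mix_apply x.1 φ b)
      simp only [pw, Pi.star_apply, Complex.star_def]
      fun_prop
    ext ⟨a, b⟩
    have hl : (unitaryRep M N U *ᵥ special (pw φ) x) (a, b) = nrm d M *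
        ∫ ψ, ((tensor fun _ => U.map conj) *ᵥ pw (star (vec ψ))) a *
          ((tensor fun _ => U) *ᵥ mix x.1 (vec ψ) φ) b ∂(uniformPure d) := by
      simp only [mulVec, dotProduct, unitaryRep, Fintype.sum_prod_type, kroneckerMap_apply,
        Finset.sum_mul_sum, hsp]
      rw [integral_finsetSum, Finset.mul_sum]
      · refine Finset.sum_congr rfl fun a' _ => ?_
        rw [integral_finsetSum, Finset.mul_sum]
        · refine Finset.sum_congr rfl fun b' _ => ?_
          rw [mul_left_comm, ← integral_const_mul]
          congr 2
          ext ψ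
          ring
        · intro b' _
          refine ((integrable_uniformPure (hcont φ a' b')).const_mul
            (tensor (fun _ => U.map conj) a a' * tensor (fun _ => U) b b')).congr ?_
          exact Filter.Eventually.of_forall fun ψ => by ring
      · intro a' _
        refine integrable_finsetSum _ fun b' _ => ?_
        refine ((integrable_uniformPure (hcont φ a' b')).const_mul
          (tensor (fun _ => U.map conj) a a' * tensor (fun _ => U) b b')).congr ?_
        exact Filter.Eventually.of_forall fun ψ => by ring
    rw [hl, hsp, ← integral_rotate U hU (hcont _ a b)]
    congr 2
    ext ψ
    have h1 : U.map conj *ᵥ star (vec ψ) = star (vec (rotate U hU ψ)) := by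
      rw [vec_rotate]
      ext s
      simp [mulVec, dotProduct]
    rw [tensor_mulVec_pw, h1, tensor_mulVec_mix, mix]
    congr 1
    refine Finset.prod_congr rfl fun n _ => ?_
    split_ifs <;> rfl

/-- The path is `exp(tA)`. Derivatives are stated entrywise so that no matrix norm has to be fixed
outside the proof. -/
theorem exists_unitary_path {d : ℕ} {A : Matrix (Fin d) (Fin d) ℂ} (hA : Aᴴ = -A) :
    ∃ U : ℝ → Matrix (Fin d) (Fin d) ℂ, (∀ t, (U t)ᴴ * U t = 1) ∧ U 0 = 1 ∧
      ∀ i j, HasDerivAt (fun t => U t i j) (A i j) 0 := by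
  let _ : NormedRing (Matrix (Fin d) (Fin d) ℂ) := Matrix.linftyOpNormedRing
  let _ : NormedAlgebra ℝ (Matrix (Fin d) (Fin d) ℂ) := Matrix.linftyOpNormedAlgebra
  refine ⟨fun t => NormedSpace.exp (t • A), fun t => ?_, by simp, fun i j => ?_⟩
  · have h : (NormedSpace.exp (t • A))ᴴ = NormedSpace.exp (-(t • A)) := by
      rw [← Matrix.exp_conjTranspose, conjTranspose_smul, hA, star_trivial, smul_neg]
    have hc : Commute (-(t • A)) (t • A) := (Commute.refl (t • A)).neg_left
    rw [h, ← Matrix.exp_add_of_commute _ _ hc, neg_add_cancel,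
      NormedSpace.exp_zero]
  · have h := hasDerivAt_exp_smul_const (𝕂 := ℝ) A 0
    rw [zero_smul, NormedSpace.exp_zero, one_mul] at h
    have h1 := (hasDerivAt_pi.mp h i)
    exact hasDerivAt_pi.mp h1 j

theorem hasDerivAt_tensor {d n : ℕ} {A : Matrix (Fin d) (Fin d) ℂ}
    {U : ℝ → Matrix (Fin d) (Fin d) ℂ} (hU0 : U 0 = 1)
    (hU : ∀ i j, HasDerivAt (fun t => U t i j) (A i j) 0) (b b' : Conf d n) :
    HasDerivAt (fun t => tensor (fun _ => U t) b b') (siteSum n A b b') 0 := by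
  simp only [tensor, of_apply]
  refine (HasDerivAt.fun_finsetProd (u := Finset.univ) fun k _ =>
    hU (b k) (b' k)).congr_deriv ?_
  rw [siteSum_eq, Matrix.sum_apply]
  simp only [siteOp_apply, hU0, smul_eq_mul]

theorem hasDerivAt_unitaryRep {d M N : ℕ} {A : Matrix (Fin d) (Fin d) ℂ} (hA : Aᴴ = -A)
    {U : ℝ → Matrix (Fin d) (Fin d) ℂ} (hU0 : U 0 = 1)
    (hU : ∀ i j, HasDerivAt (fun t => U t i j) (A i j) 0) (p q : Conf d M × Conf d N) :
    HasDerivAt (fun t => unitaryRep M N (U t) p q) (lieOp M N A p q) 0 := by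
  have hV0 : (fun t => (U t).map conj) 0 = 1 := by
    simp only [hU0]
    exact Matrix.map_one _ (map_zero _) (map_one _)
  -- For skew-Hermitian `A` the conjugate is `-Aᵀ`; hence the sign and the transpose in the input
  -- part of `lieOp`.
  have hV : ∀ i j, HasDerivAt (fun t => (U t).map conj i j) ((-Aᵀ) i j) 0 := by
    intro i j
    have h : (-Aᵀ) i j = conj (A i j) := by
      have := congrFun (congrFun hA j) i
      rw [conjTranspose_apply] at this
      rw [Matrix.neg_apply, transpose_apply, ← Matrix.neg_apply, ← this]
      rfl
    rw [h]
    exact (hU i j).star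
  have h1 := hasDerivAt_tensor hV0 hV p.1 q.1
  have h2 := hasDerivAt_tensor hU0 hU p.2 q.2
  have h3 := h1.mul h2
  simp only [unitaryRep, kroneckerMap_apply]
  refine h3.congr_deriv ?_
  have h4 : ∀ n, tensor (fun _ : Fin n => (1 : Matrix (Fin d) (Fin d) ℂ)) = 1 := fun n => by
    ext b b'
    by_cases h : b = b'
    · subst h; simp [tensor]
    · obtain ⟨k, hk⟩ := Function.ne_iff.mp h
      rw [one_apply_ne h, tensor, of_apply]
      exact Finset.prod_eq_zero (Finset.mem_univ k) (one_apply_ne hk)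
  have hV0' : (U 0).map conj = 1 := hV0
  rw [hV0', hU0, h4, h4, lieOp_eq, map_neg, Matrix.sub_apply, kroneckerMap_apply,
    kroneckerMap_apply, Matrix.neg_apply]
  ring

/-- A linear map vanishing on skew-Hermitian matrices vanishes. -/
theorem linearMap_eq_of_skew {d : ℕ} {V : Type*} [AddCommGroup V] [Module ℂ V]
    (f g : Matrix (Fin d) (Fin d) ℂ →ₗ[ℂ] V) (h : ∀ A, Aᴴ = -A → f A = g A)
    (A : Matrix (Fin d) (Fin d) ℂ) : f A = g A := by
  have hI : (Complex.I : ℂ) * Complex.I = -1 := Complex.I_mul_I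
  have h1 := h (A - Aᴴ) (by rw [conjTranspose_sub, conjTranspose_conjTranspose, neg_sub])
  have h2 := h (Complex.I • (A + Aᴴ)) (by
    rw [conjTranspose_smul, conjTranspose_add, conjTranspose_conjTranspose, Complex.star_def,
      Complex.conj_I, neg_smul, add_comm])
  have hA : A = (2 : ℂ)⁻¹ • (A - Aᴴ) - ((2 : ℂ)⁻¹ * Complex.I) • (Complex.I • (A + Aᴴ)) := by
    rw [smul_smul, mul_assoc, hI]
    ext i j
    simp only [Matrix.sub_apply, Matrix.smul_apply, Matrix.add_apply, smul_eq_mul]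
    ring
  rw [hA, map_sub f, map_sub g, map_smul f, map_smul f, map_smul g, map_smul g, h1, h2]

/-- Differentiating unitary covariance at the identity treats skew-Hermitian generators. Both sides
are complex linear in `A`, so the matrix units, which serve as raising and lowering operators, are
covered too. -/
theorem lieOp_mul_R_op {d M N : ℕ} [NeZero d] (y : Finset (Fin N))
    (A : Matrix (Fin d) (Fin d) ℂ) :
    lieOp M N A * R_op d M y = R_op d M y * lieOp M N A := by
  refine linearMap_eq_of_skew ((LinearMap.mulRight ℂ (R_op d M y)).comp (lieOp M N))
    ((LinearMap.mulLeft ℂ (R_op d M y)).comp (lieOp M N)) (fun A hA => ?_) A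
  obtain ⟨U, hUu, hU0, hU⟩ := exists_unitary_path hA
  simp only [LinearMap.comp_apply, LinearMap.mulRight_apply, LinearMap.mulLeft_apply]
  ext p q
  have h1 : HasDerivAt (fun t => (unitaryRep M N (U t) * R_op d M y) p q)
      ((lieOp M N A * R_op d M y) p q) 0 := by
    simp only [Matrix.mul_apply]
    exact HasDerivAt.fun_sum fun r _ => (hasDerivAt_unitaryRep hA hU0 hU p r).mul_const _
  have h2 : HasDerivAt (fun t => (R_op d M y * unitaryRep M N (U t)) p q)
      ((R_op d M y * lieOp M N A) p q) 0 := by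
    simp only [Matrix.mul_apply]
    exact HasDerivAt.fun_sum fun r _ => (hasDerivAt_unitaryRep hA hU0 hU r q).const_mul _
  have e : (fun t => (unitaryRep M N (U t) * R_op d M y) p q) =
      fun t => (R_op d M y * unitaryRep M N (U t)) p q :=
    funext fun t => by rw [unitaryRep_mul_R_op (U t) (hUu t) y]
  rw [e] at h1
  exact h1.unique h2

theorem lieOp_mulVec_special {d M N : ℕ} [NeZero d] (x : Str N M) {Φ : Conf d (N - M) → ℂ}
    (hΦ : IsSymmetric Φ) (A : Matrix (Fin d) (Fin d) ℂ) :
    lieOp M N A *ᵥ special Φ x = special (siteSum (N - M) A *ᵥ Φ) x := by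
  let f : Matrix (Fin d) (Fin d) ℂ →ₗ[ℂ] (Conf d M × Conf d N → ℂ) :=
    { toFun := fun A => lieOp M N A *ᵥ special Φ x
      map_add' := fun A B => by rw [map_add, add_mulVec]
      map_smul' := fun c A => by rw [map_smul, smul_mulVec]; rfl }
  let g : Matrix (Fin d) (Fin d) ℂ →ₗ[ℂ] (Conf d M × Conf d N → ℂ) :=
    { toFun := fun A => special (siteSum (N - M) A *ᵥ Φ) x
      map_add' := fun A B => by rw [map_add, add_mulVec, special_add]
      map_smul' := fun c A => by rw [map_smul, smul_mulVec, special_smul]; rfl }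
  refine linearMap_eq_of_skew f g (fun A hA => ?_) A
  obtain ⟨U, hUu, hU0, hU⟩ := exists_unitary_path hA
  change lieOp M N A *ᵥ special Φ x = special (siteSum (N - M) A *ᵥ Φ) x
  ext p
  have h1 : HasDerivAt (fun t => (unitaryRep M N (U t) *ᵥ special Φ x) p)
      ((lieOp M N A *ᵥ special Φ x) p) 0 := by
    simp only [mulVec, dotProduct]
    exact HasDerivAt.fun_sum fun r _ => (hasDerivAt_unitaryRep hA hU0 hU p r).mul_const _
  have h2 : HasDerivAt (fun t => special ((tensor fun _ => U t) *ᵥ Φ) x p)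
      (special (siteSum (N - M) A *ᵥ Φ) x p) 0 := by
    simp only [special, mulVec, dotProduct]
    exact (HasDerivAt.fun_sum fun r _ =>
      (hasDerivAt_tensor hU0 hU _ r).mul_const _).const_mul _
  simp_rw [fun t => unitaryRep_mulVec_special (U t) (hUu t) x hΦ] at h1
  exact h1.unique h2

/-! ### Weight sectors -/

/-- The weight of a basis state: the occupation numbers of the output minus those of the input. -/
def weight {d M N : ℕ} (p : Conf d M × Conf d N) (s : Fin d) : ℤ :=
  (Finset.univ.filter fun n => p.2 n = s).card - (Finset.univ.filter fun k => p.1 k = s).card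

theorem siteSum_single_self_apply {d n : ℕ} (s : Fin d) (b b' : Conf d n) :
    siteSum n (Matrix.single s s 1) b b' =
      ((Finset.univ.filter fun k => b k = s).card : ℂ) * (1 : Matrix _ _ ℂ) b b' := by
  rw [siteSum_eq, Matrix.sum_apply]
  have h : ∀ k, siteOp k (Matrix.single s s (1 : ℂ)) b b' =
      (if b k = s then 1 else 0) * (1 : Matrix _ _ ℂ) b b' := by
    intro k
    rw [siteOp_apply]
    by_cases hb : b = b'
    · subst hb
      simp [single_apply, eq_comm]
    · rw [one_apply_ne hb, mul_zero]
      obtain ⟨l, hl⟩ := Function.ne_iff.mp hb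
      by_cases hlk : l = k
      · subst hlk
        rw [single_apply, if_neg, mul_zero]
        rintro ⟨h1, h2⟩
        exact hl (h1.symm.trans h2)
      · rw [Finset.prod_eq_zero (Finset.mem_erase.mpr ⟨hlk, Finset.mem_univ l⟩)
          (show (1 : Matrix (Fin d) (Fin d) ℂ) (b l) (b' l) = 0 from one_apply_ne hl), zero_mul]
  simp_rw [h]
  rw [← Finset.sum_mul, Finset.sum_boole]

theorem lieOp_single_self_mulVec {d M N : ℕ} (s : Fin d) (v : Conf d M × Conf d N → ℂ)
    (p : Conf d M × Conf d N) :
    (lieOp M N (Matrix.single s s 1) *ᵥ v) p = (weight p s : ℂ) * v p := by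
  have h : lieOp M N (Matrix.single s s (1 : ℂ)) = diagonal fun p => (weight p s : ℂ) := by
    ext p q
    rw [lieOp_eq, transpose_single, Matrix.sub_apply, kroneckerMap_apply, kroneckerMap_apply,
      siteSum_single_self_apply, siteSum_single_self_apply]
    simp only [weight]
    by_cases h1 : p.1 = q.1 <;> by_cases h2 : p.2 = q.2
    · rw [show p = q from Prod.ext h1 h2]
      simp
    all_goals
      rw [diagonal_apply_ne _ (by rintro rfl; simp at h1 h2)]
      simp [h1, h2]
  rw [h, mulVec_diagonal]

/-- The vector `v` lies in the sector of weight `W`. -/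
def InSector {d M N : ℕ} (W : Fin d → ℤ) (v : Conf d M × Conf d N → ℂ) : Prop :=
  ∀ p, v p ≠ 0 → weight p = W

theorem InSector.lieOp_single_self {d M N : ℕ} {W : Fin d → ℤ} {v : Conf d M × Conf d N → ℂ}
    (hv : InSector W v) (s : Fin d) :
    lieOp M N (Matrix.single s s 1) *ᵥ v = (W s : ℂ) • v := by
  ext p
  rw [lieOp_single_self_mulVec, Pi.smul_apply, smul_eq_mul]
  by_cases hp : v p = 0
  · simp [hp]
  · rw [hv p hp]

theorem InSector.of_lieOp {d M N : ℕ} {W : Fin d → ℤ} {v : Conf d M × Conf d N → ℂ}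
    (h : ∀ s, lieOp M N (Matrix.single s s 1) *ᵥ v = (W s : ℂ) • v) : InSector W v := by
  intro p hp
  ext s
  have := congrFun (h s) p
  rw [lieOp_single_self_mulVec, Pi.smul_apply, smul_eq_mul] at this
  exact_mod_cast mul_right_cancel₀ hp this

/-- The matrix unit `E_ij` is a root vector: its commutator with `E_ss` shifts the weight at `i` up
and at `j` down. -/
theorem InSector.lieOp_single {d M N : ℕ} {W : Fin d → ℤ} {v : Conf d M × Conf d N → ℂ}
    (hv : InSector W v) (i j : Fin d) :
    InSector (W + Pi.single i 1 - Pi.single j 1) (lieOp M N (Matrix.single i j 1) *ᵥ v) := by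
  refine InSector.of_lieOp fun s => ?_
  have h := congrArg (· *ᵥ v) (lieOp_commutator (M := M) (N := N) (Matrix.single s s (1 : ℂ))
    (Matrix.single i j 1))
  simp only [sub_mulVec, ← mulVec_mulVec, hv.lieOp_single_self s, mulVec_smul] at h
  have hc : Matrix.single s s (1 : ℂ) * Matrix.single i j 1 -
      Matrix.single i j 1 * Matrix.single s s 1 =
      (((if s = i then 1 else 0) - (if s = j then 1 else 0) : ℂ)) • Matrix.single i j (1 : ℂ) := by
    by_cases h1 : s = i <;> by_cases h2 : s = j
    · subst h1; subst h2; simp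
    · subst h1; simp [h2, single_mul_single_of_ne, Ne.symm h2]
    · subst h2; simp [h1, single_mul_single_of_ne]
    · simp [h1, h2, single_mul_single_of_ne, Ne.symm h2]
  rw [hc, map_smul, smul_mulVec, sub_eq_iff_eq_add] at h
  rw [h, ← add_smul]
  congr 1
  simp only [Pi.sub_apply, Pi.add_apply, Pi.single_apply]
  push_cast
  ring

/-- The adjoint of `E_ij` is `E_ji`, and `[E_ji, E_ij] = E_jj - E_ii` acts on the sector as the
scalar `W_j - W_i`. -/
theorem lieOp_norm_identity {d M N : ℕ} {W : Fin d → ℤ} {v : Conf d M × Conf d N → ℂ}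
    (hv : InSector W v) (i j : Fin d) :
    star (lieOp M N (Matrix.single i j 1) *ᵥ v) ⬝ᵥ (lieOp M N (Matrix.single i j 1) *ᵥ v) =
      star (lieOp M N (Matrix.single j i 1) *ᵥ v) ⬝ᵥ (lieOp M N (Matrix.single j i 1) *ᵥ v) +
      ((W j - W i : ℤ) : ℂ) * (star v ⬝ᵥ v) := by
  have hadj : ∀ i j : Fin d, star (lieOp M N (Matrix.single i j (1 : ℂ)) *ᵥ v) ⬝ᵥ
      (lieOp M N (Matrix.single i j 1) *ᵥ v) =
      star v ⬝ᵥ ((lieOp M N (Matrix.single j i 1) * lieOp M N (Matrix.single i j 1)) *ᵥ v) := by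
    intro i j
    rw [star_mulVec, conjTranspose_lieOp, conjTranspose_single, star_one, ← dotProduct_mulVec,
      mulVec_mulVec]
  rw [hadj, hadj]
  have h := lieOp_commutator (M := M) (N := N) (Matrix.single j i (1 : ℂ)) (Matrix.single i j 1)
  rw [sub_eq_iff_eq_add] at h
  rw [h, add_mulVec, dotProduct_add, single_mul_single_same, single_mul_single_same, map_sub,
    sub_mulVec, mul_one, hv.lieOp_single_self, hv.lieOp_single_self, ← sub_smul, dotProduct_smul,
    add_comm]
  push_cast
  rfl

theorem lieOp_single_mulVec_ne_zero {d M N : ℕ} {W : Fin d → ℤ} {v : Conf d M × Conf d N → ℂ}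
    (hv : InSector W v) (hv0 : v ≠ 0) {i j : Fin d} (hij : W i < W j) :
    lieOp M N (Matrix.single i j 1) *ᵥ v ≠ 0 := by
  intro h
  have h1 := lieOp_norm_identity hv i j
  rw [h, star_zero, zero_dotProduct] at h1
  have h2 : 0 ≤ star (lieOp M N (Matrix.single j i 1) *ᵥ v) ⬝ᵥ
      (lieOp M N (Matrix.single j i 1) *ᵥ v) := dotProduct_star_self_nonneg _
  have h3 : 0 < star v ⬝ᵥ v := dotProduct_star_self_pos_iff.mpr hv0
  have h4 : (0 : ℂ) < ((W j - W i : ℤ) : ℂ) := by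
    have : (0 : ℤ) < W j - W i := by omega
    exact_mod_cast this
  exact absurd h1 (add_pos_of_nonneg_of_pos h2 (mul_pos h4 h3)).ne

theorem siteSum_single_mulVec_eq_zero {d n : ℕ} {Φ : Conf d n → ℂ} {i j : Fin d}
    (hΦ : ∀ b, (∃ k, b k = j) → Φ b = 0) : siteSum n (Matrix.single i j 1) *ᵥ Φ = 0 := by
  ext b
  simp only [mulVec, dotProduct, siteSum_eq, Matrix.sum_apply, Pi.zero_apply]
  refine Finset.sum_eq_zero fun b' _ => ?_
  by_cases hb : ∃ k, b' k = j
  · rw [hΦ b' hb, mul_zero]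
  · push Not at hb
    rw [Finset.sum_eq_zero, zero_mul]
    intro k _
    rw [siteOp_apply, single_apply, if_neg, mul_zero]
    rintro ⟨-, h⟩
    exact hb k h.symm

/-! ### Positivity of the cloning operator -/

-- An entry is a positive constant times a number of permutations, so `R_y` is entrywise
-- nonnegative. Because of the transpose, the input of `q` is grouped with the output of `p`.
open scoped Nat in
theorem R_op_apply {d M N : ℕ} [NeZero d] (y : Finset (Fin N)) (p q : Conf d M × Conf d N) :
    R_op d M y p q = ((M + d - 1).choose M : ℂ) * ((if ∀ n ∉ y, p.2 n = q.2 n then 1 else 0) *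
      (((d - 1)! : ℂ) / ((Fintype.card (Fin M ⊕ y) + d - 1)! : ℂ) *
        ((Finset.univ.filter fun π : Equiv.Perm (Fin M ⊕ y) =>
          Sum.elim q.1 (fun n : y => p.2 n) ∘ π = Sum.elim p.1 (fun n : y => q.2 n)).card : ℂ))) := by
  rw [← integral_prod_mul_prod_conj, ← integral_const_mul, R_op, of_apply]
  congr 1
  refine integral_congr_ae (.of_forall fun ψ => ?_)
  have h : projOn y ψ p.2 q.2 = (if ∀ n ∉ y, p.2 n = q.2 n then 1 else 0) *
      ((∏ n : y, vec ψ (p.2 n)) * ∏ n : y, conj (vec ψ (q.2 n))) := by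
    rw [Finset.prod_coe_sort y fun n => vec ψ (p.2 n),
      Finset.prod_coe_sort y fun n => conj (vec ψ (q.2 n)), ← Finset.prod_mul_distrib,
      projOn, tensor, of_apply, ← Finset.prod_compl_mul_prod y]
    congr 1
    · split_ifs with h
      · refine Finset.prod_eq_one fun n hn => ?_
        rw [Finset.mem_compl] at hn
        rw [if_neg hn, h n hn, one_apply_eq]
      · push Not at h
        obtain ⟨n, hn, hne⟩ := h
        refine Finset.prod_eq_zero (Finset.mem_compl.mpr hn) ?_
        rw [if_neg hn, one_apply_ne hne]
    · refine Finset.prod_congr rfl fun n hn => ?_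
      rw [if_pos hn]
      rfl
  simp only [kroneckerMap_apply, transpose_apply]
  rw [h, copies_apply, pw, Fintype.prod_sum_type, Fintype.prod_sum_type]
  simp only [Sum.elim_inl, Sum.elim_inr]
  ring

theorem R_op_apply_nonneg {d M N : ℕ} [NeZero d] (y : Finset (Fin N))
    (p q : Conf d M × Conf d N) : 0 ≤ R_op d M y p q := by
  rw [R_op_apply]
  have h : (0 : ℂ) ≤ if ∀ n ∉ y, p.2 n = q.2 n then 1 else 0 := by
    split_ifs
    · exact zero_le_one
    · exact le_rfl
  have h0 : ∀ n : ℕ, (0 : ℂ) ≤ n := fun n => Nat.cast_nonneg n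
  refine mul_nonneg (h0 _) (mul_nonneg h (mul_nonneg ?_ (h0 _)))
  rw [div_eq_mul_inv]
  refine mul_nonneg (h0 _) ?_
  have := h0 ((Fintype.card (Fin M ⊕ y) + d - 1).factorial)
  exact inv_nonneg_of_nonneg this

/-- An input and a tested output site with a common value may change together to any value: the
transposition of the two sites is counted in the entry. These moves later connect the sectors. -/
theorem R_op_apply_update_ne_zero {d M N : ℕ} [NeZero d] {y : Finset (Fin N)} {n : Fin N}
    (hn : n ∈ y) {k : Fin M} {a : Conf d M} {b : Conf d N} (hab : a k = b n) (t : Fin d) :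
    R_op d M y (a, b) (Function.update a k t, Function.update b n t) ≠ 0 := by
  rw [R_op_apply, if_pos, one_mul]
  · refine mul_ne_zero (choose_ne_zero d M) (mul_ne_zero (div_ne_zero ?_ ?_) ?_)
    · exact_mod_cast Nat.factorial_ne_zero _
    · exact_mod_cast Nat.factorial_ne_zero _
    · rw [Nat.cast_ne_zero, ← Nat.pos_iff_ne_zero, Finset.card_pos]
      refine ⟨Equiv.swap (Sum.inl k) (Sum.inr ⟨n, hn⟩), ?_⟩
      rw [Finset.mem_filter]
      refine ⟨Finset.mem_univ _, funext fun i => ?_⟩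
      rcases i with l | m
      · by_cases hl : l = k
        · subst hl
          simp only [Function.comp_apply, Equiv.swap_apply_left, Sum.elim_inr, Sum.elim_inl, hab]
        · rw [Function.comp_apply, Equiv.swap_apply_of_ne_of_ne
            (fun h => hl (Sum.inl_injective h)) Sum.inl_ne_inr, Sum.elim_inl, Sum.elim_inl]
          exact Function.update_of_ne hl _ _
      · by_cases hm : m = ⟨n, hn⟩
        · subst hm
          simp only [Function.comp_apply, Equiv.swap_apply_right, Sum.elim_inr, Sum.elim_inl,
            Function.update_self]
        · rw [Function.comp_apply, Equiv.swap_apply_of_ne_of_ne Sum.inr_ne_inl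
            (fun h => hm (Sum.inr_injective h)), Sum.elim_inr, Sum.elim_inr]
          exact (Function.update_of_ne (fun h => hm (Subtype.ext h)) _ _).symm
  · intro m hm
    have : m ≠ n := fun h => hm (h ▸ hn)
    simp [this]

theorem proj_conjTranspose {d : ℕ} (ψ : PureState d) : (proj ψ)ᴴ = proj ψ := by
  ext i j
  simp [proj, mul_comm]

theorem proj_mul_proj {d : ℕ} (ψ : PureState d) : proj ψ * proj ψ = proj ψ := by
  ext i j
  rw [Matrix.mul_apply]
  have := braket_vec_self ψ
  calc ∑ k, proj ψ i k * proj ψ k j = ψ.1 i * braket (vec ψ) (vec ψ) * conj (ψ.1 j) := by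
        rw [braket, Finset.mul_sum, Finset.sum_mul]
        refine Finset.sum_congr rfl fun k _ => ?_
        simp only [proj, of_apply]
        ring
    _ = proj ψ i j := by rw [this, mul_one]; rfl

theorem conjTranspose_tensor {d n : ℕ} (A : Fin n → Matrix (Fin d) (Fin d) ℂ) :
    (tensor A)ᴴ = tensor fun k => (A k)ᴴ := by
  ext b b'
  simp [tensor, conjTranspose_apply]

theorem posSemidef_kernel {d M N : ℕ} (y : Finset (Fin N)) (ψ : PureState d) :
    ((copies M ψ)ᵀ ⊗ₖ projOn y ψ).PosSemidef := by
  have h1 : (copies M ψ)ᴴ = copies M ψ := by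
    rw [copies, conjTranspose_tensor, proj_conjTranspose]
  have h2 : (projOn y ψ)ᴴ = projOn y ψ := by
    rw [projOn, conjTranspose_tensor]
    congr 1
    ext n
    split_ifs
    · rw [proj_conjTranspose]
    · rw [conjTranspose_one]
  have h3 : copies M ψ * copies M ψ = copies M ψ := by
    rw [copies, tensor_mul_tensor, proj_mul_proj]
  have h4 : projOn y ψ * projOn y ψ = projOn y ψ := by
    rw [projOn, tensor_mul_tensor]
    congr 1
    ext n
    split_ifs
    · rw [proj_mul_proj]
    · rw [mul_one]
  have h5 : ((copies M ψ)ᵀ ⊗ₖ projOn y ψ)ᴴ * ((copies M ψ)ᵀ ⊗ₖ projOn y ψ) =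
      (copies M ψ)ᵀ ⊗ₖ projOn y ψ := by
    have h6 : (copies M ψ)ᵀᴴ = (copies M ψ)ᵀ := congrArg transpose h1
    rw [conjTranspose_kronecker, ← mul_kronecker_mul, h6, h2, ← transpose_mul, h3, h4]
  rw [← h5]
  exact posSemidef_conjTranspose_mul_self _

theorem posSemidef_R_op {d M N : ℕ} [NeZero d] (y : Finset (Fin N)) :
    (R_op d M y).PosSemidef := by
  refine PosSemidef.of_dotProduct_mulVec_nonneg ?_ fun v => ?_
  · ext p q
    rw [conjTranspose_apply, R_op, of_apply, of_apply, star_mul', star_natCast,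
      Complex.star_def, ← integral_conj]
    congr 2
    ext ψ
    have := congrFun (congrFun (posSemidef_kernel (M := M) y ψ).1 p) q
    exact this
  · have h : star v ⬝ᵥ (R_op d M y *ᵥ v) = ((M + d - 1).choose M : ℂ) *
        ∫ ψ, star v ⬝ᵥ (((copies M ψ)ᵀ ⊗ₖ projOn y ψ) *ᵥ v) ∂(uniformPure d) := by
      simp only [dotProduct]
      rw [integral_finsetSum, Finset.mul_sum]
      · refine Finset.sum_congr rfl fun p _ => ?_
        rw [integral_const_mul, R_op_mulVec]
        ring
      · refine fun p _ => (integrable_uniformPure ?_)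
        refine continuous_const.mul ?_
        simp only [mulVec, dotProduct]
        exact continuous_finsetSum _ fun q _ =>
          (continuous_kernel_apply y p q).mul continuous_const
    rw [h]
    refine mul_nonneg (Nat.cast_nonneg _) ?_
    exact integral_nonneg fun ψ => (posSemidef_kernel y ψ).dotProduct_mulVec_nonneg v

theorem posSemidef_R_total {d M N : ℕ} [NeZero d] {α : Finset (Fin N) → ℝ} (hα : ∀ x, 0 ≤ α x) :
    (R_total d M α).PosSemidef :=
  posSemidef_sum _ fun x _ => (posSemidef_R_op x).smul (by exact_mod_cast hα x)

theorem R_total_apply_nonneg {d M N : ℕ} [NeZero d] {α : Finset (Fin N) → ℝ}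
    (hα : ∀ x, 0 ≤ α x) (p q : Conf d M × Conf d N) : 0 ≤ R_total d M α p q := by
  rw [R_total, Matrix.sum_apply]
  refine Finset.sum_nonneg fun x _ => ?_
  rw [Matrix.smul_apply, smul_eq_mul]
  exact mul_nonneg (by exact_mod_cast hα x) (R_op_apply_nonneg x p q)

theorem R_total_apply_update_ne_zero {d M N : ℕ} [NeZero d] {α : Finset (Fin N) → ℝ}
    (hα : ∀ x, 0 ≤ α x) {n : Fin N} (hn : ∃ x, n ∈ x ∧ 0 < α x) {k : Fin M} {a : Conf d M}
    {b : Conf d N} (hab : a k = b n) (t : Fin d) :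
    R_total d M α (a, b) (Function.update a k t, Function.update b n t) ≠ 0 := by
  obtain ⟨y, hny, hy⟩ := hn
  refine ne_of_gt ?_
  rw [R_total, Matrix.sum_apply]
  refine Finset.sum_pos' (fun x _ => ?_) ⟨y, Finset.mem_univ _, ?_⟩
  · rw [Matrix.smul_apply, smul_eq_mul]
    exact mul_nonneg (by exact_mod_cast hα x) (R_op_apply_nonneg x _ _)
  · rw [Matrix.smul_apply, smul_eq_mul]
    exact mul_pos (by exact_mod_cast hy)
      (lt_of_le_of_ne (R_op_apply_nonneg _ _ _) (R_op_apply_update_ne_zero hny hab t).symm)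

theorem lieOp_mul_R_total {d M N : ℕ} [NeZero d] (α : Finset (Fin N) → ℝ)
    (A : Matrix (Fin d) (Fin d) ℂ) :
    lieOp M N A * R_total d M α = R_total d M α * lieOp M N A := by
  rw [R_total, Finset.mul_sum, Finset.sum_mul]
  refine Finset.sum_congr rfl fun x _ => ?_
  rw [mul_smul_comm, smul_mul_assoc, lieOp_mul_R_op]

theorem R_total_mul_R_op_empty {d M N : ℕ} [NeZero d] (α : Finset (Fin N) → ℝ) :
    R_total d M α * R_op d M ∅ = R_total d M α := by
  rw [R_total, Finset.sum_mul]
  refine Finset.sum_congr rfl fun x _ => ?_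
  rw [smul_mul_assoc, R_op_mul_R_op_empty]

theorem star_chi_dotProduct_R_total {d M N : ℕ} [NeZero d] (α : Finset (Fin N) → ℝ)
    (β : Str N M → ℝ) {Φ : Conf d (N - M) → ℂ} (hΦ : IsSymmetric Φ) :
    star (chi β Φ) ⬝ᵥ (R_total d M α *ᵥ chi β Φ) =
      ((∑ y, α y * quad d y β : ℝ) : ℂ) * (star Φ ⬝ᵥ Φ) := by
  rw [R_total, sum_mulVec, dotProduct_sum, Complex.ofReal_sum, Finset.sum_mul]
  refine Finset.sum_congr rfl fun y _ => ?_
  rw [smul_mulVec, dotProduct_smul, star_chi_dotProduct_R_op y β hΦ, smul_eq_mul,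
    Complex.ofReal_mul, mul_assoc]

/-! ### The quadratic programme -/

theorem G_nonneg {d M N : ℕ} (y : Finset (Fin N)) (x z : Str N M) : 0 ≤ G d y x z := by
  rw [G, of_apply]
  positivity

theorem G_empty_self {d M N : ℕ} [NeZero d] (x : Str N M) : G d ∅ x x = 1 := by
  have h := NeZero.pos d
  rw [G, of_apply, Finset.inter_self, x.2, Finset.inter_empty, Finset.card_empty, add_zero,
    show M + d - 1 - M = d - 1 by omega, Nat.choose_self, Nat.cast_one, inv_one]

theorem G_self_pos {d M N : ℕ} [NeZero d] (y : Finset (Fin N)) (x : Str N M) :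
    0 < G d y x x := by
  have h := NeZero.pos d
  rw [G, of_apply, Finset.inter_self, x.2, inv_pos, Nat.cast_pos]
  exact Nat.choose_pos (by omega)

theorem quad_eq_sum {d M N : ℕ} (y : Finset (Fin N)) (β : Str N M → ℝ) :
    quad d y β = ∑ x, ∑ z, β x * (G d y x z * β z) := by
  simp only [quad, dotProduct, mulVec, Finset.mul_sum]

theorem quad_nonneg {d M N : ℕ} (y : Finset (Fin N)) {β : Str N M → ℝ} (hβ : ∀ x, 0 ≤ β x) :
    0 ≤ quad d y β := by
  rw [quad_eq_sum]
  exact Finset.sum_nonneg fun x _ => Finset.sum_nonneg fun z _ =>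
    mul_nonneg (hβ x) (mul_nonneg (G_nonneg y x z) (hβ z))

theorem G_self_mul_sq_le_quad {d M N : ℕ} (y : Finset (Fin N)) {β : Str N M → ℝ}
    (hβ : ∀ x, 0 ≤ β x) (x : Str N M) : G d y x x * β x ^ 2 ≤ quad d y β := by
  rw [quad_eq_sum]
  have h0 : ∀ x z, 0 ≤ β x * (G d y x z * β z) := fun x z =>
    mul_nonneg (hβ x) (mul_nonneg (G_nonneg y x z) (hβ z))
  calc G d y x x * β x ^ 2 = β x * (G d y x x * β x) := by ring
    _ ≤ ∑ z, β x * (G d y x z * β z) :=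
        Finset.single_le_sum (fun z _ => h0 x z) (Finset.mem_univ x)
    _ ≤ _ := Finset.single_le_sum (f := fun x => ∑ z, β x * (G d y x z * β z))
        (fun x _ => Finset.sum_nonneg fun z _ => h0 x z) (Finset.mem_univ x)

theorem quad_smul {d M N : ℕ} (y : Finset (Fin N)) (c : ℝ) (β : Str N M → ℝ) :
    quad d y (c • β) = c ^ 2 * quad d y β := by
  rw [quad, quad, mulVec_smul, smul_dotProduct, dotProduct_smul, smul_eq_mul, smul_eq_mul]
  ring

theorem continuous_quad {d M N : ℕ} (y : Finset (Fin N)) :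
    Continuous (quad d y : (Str N M → ℝ) → ℝ) := by
  have : (quad d y : (Str N M → ℝ) → ℝ) = fun β => ∑ x, ∑ z, β x * (G d y x z * β z) :=
    funext fun β => quad_eq_sum y β
  rw [this]
  fun_prop

/-- The entries of `G_∅` are nonnegative with unit diagonal, so feasible vectors lie in the unit
cube and compactness applies. The final conjunct is the homogeneous form of the bound, obtained by
rescaling. -/
theorem exists_isGreatest_quad {d M N : ℕ} [NeZero d] (hMN : M < N) {α : Finset (Fin N) → ℝ}
    (hα : ∀ x, 0 ≤ α x) (hα1 : ∑ x, α x = 1) :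
    ∃ lam : ℝ, 0 < lam ∧ IsGreatest {t : ℝ | ∃ β : Str N M → ℝ, (∀ x, 0 ≤ β x) ∧
        quad d ∅ β ≤ 1 ∧ t = ∑ y, α y * quad d y β} lam ∧
      ∀ β : Str N M → ℝ, (∀ x, 0 ≤ β x) → ∑ y, α y * quad d y β ≤ lam * quad d ∅ β := by
  let S : Set (Str N M → ℝ) := {β | (∀ x, 0 ≤ β x) ∧ quad d ∅ β ≤ 1}
  let Q : (Str N M → ℝ) → ℝ := fun β => ∑ y, α y * quad d y β
  have hSc : IsClosed S := by
    refine IsClosed.inter ?_ (isClosed_le (continuous_quad ∅) continuous_const)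
    exact isClosed_Ici (a := (0 : Str N M → ℝ))
  have hS : IsCompact S := by
    refine (isCompact_Icc (a := (0 : Str N M → ℝ)) (b := 1)).of_isClosed_subset hSc ?_
    rintro β ⟨hβ, hq⟩
    refine ⟨hβ, fun x => ?_⟩
    have := G_self_mul_sq_le_quad (d := d) ∅ hβ x
    rw [G_empty_self, one_mul] at this
    exact (sq_le_one_iff₀ (hβ x)).mp (this.trans hq)
  have hQ : Continuous Q := by
    refine continuous_finsetSum _ fun y _ => continuous_const.mul (continuous_quad y)
  obtain ⟨x₀, hx₀⟩ : ∃ x : Finset (Fin N), x.card = M := by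
    obtain ⟨x, -, hx⟩ := Finset.exists_subset_card_eq
      (s := (Finset.univ : Finset (Fin N))) (n := M) (by rw [Finset.card_univ, Fintype.card_fin]; omega)
    exact ⟨x, hx⟩
  -- A single special state is feasible and has positive value, so the maximum is positive.
  let e : Str N M → ℝ := Pi.single ⟨x₀, hx₀⟩ 1
  have he : ∀ x, 0 ≤ e x := fun x => by
    simp only [e, Pi.single_apply]
    split_ifs <;> norm_num
  have hquad : ∀ y, quad d y e = G d y ⟨x₀, hx₀⟩ ⟨x₀, hx₀⟩ := fun y => by
    simp only [quad, e, mulVec_single, single_dotProduct]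
    simp
  have heS : e ∈ S := ⟨he, by rw [hquad, G_empty_self]⟩
  obtain ⟨β₀, hβ₀, hmax⟩ := hS.exists_isMaxOn ⟨e, heS⟩ hQ.continuousOn
  have hpos : 0 < Q β₀ := by
    refine lt_of_lt_of_le ?_ (hmax heS)
    obtain ⟨y, -, hy⟩ : ∃ y ∈ Finset.univ, 0 < α y :=
      Finset.exists_lt_of_sum_lt (by rw [hα1]; simp)
    refine Finset.sum_pos' (fun y _ => mul_nonneg (hα y) (quad_nonneg y he))
      ⟨y, Finset.mem_univ y, mul_pos hy ?_⟩
    rw [hquad]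
    exact G_self_pos y _
  refine ⟨Q β₀, hpos, ⟨⟨β₀, hβ₀.1, hβ₀.2, rfl⟩, ?_⟩, fun β hβ => ?_⟩
  · rintro t ⟨β, h1, h2, rfl⟩
    exact hmax (show β ∈ S from ⟨h1, h2⟩)
  · rcases (quad_nonneg (d := d) ∅ hβ).eq_or_lt with h | h
    · have hz : β = 0 := by
        ext x
        have := G_self_mul_sq_le_quad (d := d) ∅ hβ x
        rw [G_empty_self, one_mul, ← h] at this
        exact pow_eq_zero_iff two_ne_zero |>.mp (le_antisymm this (sq_nonneg _))
      simp [hz, quad]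
    · set q := quad d ∅ β with hq
      have hc : 0 ≤ (Real.sqrt q)⁻¹ := by positivity
      have hc2 : ((Real.sqrt q)⁻¹) ^ 2 = q⁻¹ := by
        rw [inv_pow, Real.sq_sqrt h.le]
      have hmem : (Real.sqrt q)⁻¹ • β ∈ S := by
        refine ⟨fun x => mul_nonneg hc (hβ x), ?_⟩
        rw [quad_smul, hc2, ← hq, inv_mul_cancel₀ h.ne']
      have h1 : Q ((Real.sqrt q)⁻¹ • β) ≤ Q β₀ := hmax hmem
      have h2 : Q ((Real.sqrt q)⁻¹ • β) = q⁻¹ * ∑ y, α y * quad d y β := by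
        simp only [Q, quad_smul, hc2, Finset.mul_sum]
        exact Finset.sum_congr rfl fun y _ => by ring
      rw [h2, inv_mul_le_iff₀ h] at h1
      linarith

/-! ### Sectors and the special states -/

/-- `R` commutes with the diagonal generators, so each of its columns stays in one weight sector. -/
theorem weight_eq_of_R_total_ne_zero {d M N : ℕ} [NeZero d] {α : Finset (Fin N) → ℝ}
    {p q : Conf d M × Conf d N} (h : R_total d M α p q ≠ 0) : weight p = weight q := by
  have h1 : InSector (weight q) (R_total d M α *ᵥ Pi.single q 1) := by
    refine InSector.of_lieOp fun s => ?_
    have h2 : InSector (weight q) (Pi.single q (1 : ℂ)) := fun p hp => by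
      by_contra hne
      exact hp (Pi.single_eq_of_ne (fun h => hne (by rw [h])) _)
    rw [mulVec_mulVec, lieOp_mul_R_total, ← mulVec_mulVec, h2.lieOp_single_self, mulVec_smul]
  refine h1 p ?_
  rw [mulVec_single_one]
  exact h

/-- The component of `v` in the sector of weight `W`. -/
def sectorPart {d M N : ℕ} (W : Fin d → ℤ) (v : Conf d M × Conf d N → ℂ) :
    Conf d M × Conf d N → ℂ :=
  fun p => if weight p = W then v p else 0

theorem inSector_sectorPart {d M N : ℕ} (W : Fin d → ℤ) (v : Conf d M × Conf d N → ℂ) :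
    InSector W (sectorPart W v) := fun p hp => by
  by_contra h
  exact hp (if_neg h)

theorem R_total_mulVec_sectorPart {d M N : ℕ} [NeZero d] (α : Finset (Fin N) → ℝ)
    (W : Fin d → ℤ) (v : Conf d M × Conf d N → ℂ) :
    R_total d M α *ᵥ sectorPart W v = sectorPart W (R_total d M α *ᵥ v) := by
  ext p
  simp only [sectorPart, mulVec, dotProduct]
  by_cases hp : weight p = W
  · rw [if_pos hp]
    refine Finset.sum_congr rfl fun q _ => ?_
    by_cases h : R_total d M α p q = 0
    · rw [h, zero_mul, zero_mul]
    · rw [if_pos ((weight_eq_of_R_total_ne_zero h).symm.trans hp)]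
  · rw [if_neg hp]
    refine Finset.sum_eq_zero fun q _ => ?_
    by_cases h : R_total d M α p q = 0
    · rw [h, zero_mul]
    · rw [if_neg fun hq => hp ((weight_eq_of_R_total_ne_zero h).trans hq), mul_zero]

theorem R_total_mulVec_sectorPart_eq_smul {d M N : ℕ} [NeZero d] {α : Finset (Fin N) → ℝ}
    {v : Conf d M × Conf d N → ℂ} {μ : ℂ} (hv : R_total d M α *ᵥ v = μ • v) (W : Fin d → ℤ) :
    R_total d M α *ᵥ sectorPart W v = μ • sectorPart W v := by
  rw [R_total_mulVec_sectorPart, hv]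
  ext p
  simp only [sectorPart, Pi.smul_apply, smul_eq_mul, mul_ite, mul_zero]

/-! ### Occupation numbers and positivity of special states inside a sector. -/

/-- The number of spins with value `s`. -/
def occ {d n : ℕ} (b : Conf d n) (s : Fin d) : ℕ := (Finset.univ.filter fun k => b k = s).card

theorem sum_occ {d n : ℕ} (b : Conf d n) : ∑ s, occ b s = n := by
  simp only [occ]
  rw [← Finset.card_eq_sum_card_fiberwise fun _ _ => Finset.mem_univ _, Finset.card_univ,
    Fintype.card_fin]

theorem occ_comp_perm {d n : ℕ} (b : Conf d n) (π : Equiv.Perm (Fin n)) :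
    occ (b ∘ π) = occ b := funext fun s => fiber_card_comp_perm b π s

theorem exists_perm_of_occ_eq {d n : ℕ} {a c : Conf d n} (h : occ a = occ c) :
    ∃ π : Equiv.Perm (Fin n), a ∘ π = c := exists_perm_of_fiber_card_eq a c fun s => congrFun h s

theorem occ_restr {d N k : ℕ} (x : Finset (Fin N)) (hx : x.card = k) (b : Conf d N) (s : Fin d) :
    occ (restr x hx b) s = (x.filter fun n => b n = s).card := by
  rw [occ, ← Finset.card_map (x.orderEmbOfFin hx).toEmbedding]
  congr 1
  ext n
  rw [Finset.mem_map, Finset.mem_filter]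
  constructor
  · rintro ⟨i, hi, rfl⟩
    exact ⟨Finset.orderEmbOfFin_mem x hx i, (Finset.mem_filter.mp hi).2⟩
  · rintro ⟨hn, hs⟩
    have : n ∈ Set.range (x.orderEmbOfFin hx) := by
      rw [Finset.range_orderEmbOfFin]
      exact hn
    obtain ⟨i, rfl⟩ := this
    exact ⟨i, Finset.mem_filter.mpr ⟨Finset.mem_univ _, hs⟩, rfl⟩

theorem weight_apply {d M N : ℕ} (p : Conf d M × Conf d N) (s : Fin d) :
    weight p s = (occ p.2 s : ℤ) - occ p.1 s := rfl

theorem sum_weight {d M N : ℕ} (p : Conf d M × Conf d N) : ∑ s, weight p s = (N : ℤ) - M := by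
  simp only [weight_apply]
  rw [Finset.sum_sub_distrib, ← Nat.cast_sum, ← Nat.cast_sum, sum_occ, sum_occ]

theorem occ_restr_add_occ_restr_compl {d M N : ℕ} (x : Str N M) (b : Conf d N) (s : Fin d) :
    occ (restr x.1 x.2 b) s + occ (restr x.1ᶜ (card_compl_str x) b) s = occ b s := by
  rw [occ_restr, occ_restr, occ, ← Finset.card_union_of_disjoint, ← Finset.filter_union,
    Finset.union_compl]
  exact Finset.disjoint_filter_filter disjoint_compl_right

open scoped Nat in
theorem bell_eq_card {d M : ℕ} [NeZero d] (a c : Conf d M) :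
    bell M a c = nrm d M * (((d - 1)! : ℂ) / ((M + d - 1)! : ℂ) *
      ((Finset.univ.filter fun π : Equiv.Perm (Fin M) => c ∘ π = a).card : ℂ)) := by
  rw [bell_eq_integral]
  simp_rw [mul_comm (∏ k, conj (vec _ (a k)))]
  rw [integral_prod_mul_prod_conj, Fintype.card_fin]

theorem bell_nonneg {d M : ℕ} [NeZero d] (a c : Conf d M) : 0 ≤ bell M a c := by
  rw [bell_eq_card, nrm, div_eq_mul_inv]
  have h0 : ∀ n : ℕ, (0 : ℂ) ≤ n := fun n => Nat.cast_nonneg n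
  refine mul_nonneg ?_ (mul_nonneg (mul_nonneg (h0 _) ?_) (h0 _))
  · exact_mod_cast Real.sqrt_nonneg _
  · exact inv_nonneg_of_nonneg (h0 _)

theorem bell_ne_zero_iff {d M : ℕ} [NeZero d] (a c : Conf d M) :
    bell M a c ≠ 0 ↔ occ a = occ c := by
  rw [bell_eq_card]
  constructor
  · intro h
    have h1 := right_ne_zero_of_mul (right_ne_zero_of_mul h)
    rw [Nat.cast_ne_zero, ← Nat.pos_iff_ne_zero, Finset.card_pos] at h1
    obtain ⟨π, hπ⟩ := h1
    rw [← (Finset.mem_filter.mp hπ).2, occ_comp_perm]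
  · intro h
    obtain ⟨π, hπ⟩ := exists_perm_of_occ_eq h.symm
    refine mul_ne_zero (nrm_ne_zero d M) (mul_ne_zero (div_ne_zero ?_ ?_) ?_)
    · exact_mod_cast Nat.factorial_ne_zero _
    · exact_mod_cast Nat.factorial_ne_zero _
    · rw [Nat.cast_ne_zero, ← Nat.pos_iff_ne_zero, Finset.card_pos]
      exact ⟨π, Finset.mem_filter.mpr ⟨Finset.mem_univ _, hπ⟩⟩

/-- The Bell factor forces the input and the sites of `x` to have equal occupation numbers; the
weight is what the remaining sites carry. -/
theorem weight_eq_of_special_ne_zero {d M N : ℕ} [NeZero d] {Φ : Conf d (N - M) → ℂ}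
    {x : Str N M} {p : Conf d M × Conf d N} (h : special Φ x p ≠ 0) :
    weight p = fun s => (occ (restr x.1ᶜ (card_compl_str x) p.2) s : ℤ) := by
  have h1 := (bell_ne_zero_iff _ _).mp (left_ne_zero_of_mul h)
  ext s
  rw [weight_apply, h1, ← occ_restr_add_occ_restr_compl x p.2 s]
  push_cast
  ring

/-- The unnormalised symmetric state with occupation numbers `W`. -/
def sectorState {d : ℕ} (n : ℕ) (W : Fin d → ℤ) : Conf d n → ℂ :=
  fun e => if (fun s => (occ e s : ℤ)) = W then 1 else 0

theorem isSymmetric_sectorState {d n : ℕ} (W : Fin d → ℤ) : IsSymmetric (sectorState n W) :=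
  fun π b => by simp only [sectorState, occ_comp_perm]

theorem sectorState_nonneg {d n : ℕ} (W : Fin d → ℤ) (e : Conf d n) : 0 ≤ sectorState n W e := by
  rw [sectorState]
  split_ifs
  · exact zero_le_one
  · exact le_rfl

theorem special_nonneg {d M N : ℕ} [NeZero d] {Φ : Conf d (N - M) → ℂ} (hΦ : ∀ e, 0 ≤ Φ e)
    (x : Str N M) (p : Conf d M × Conf d N) : 0 ≤ special Φ x p :=
  mul_nonneg (bell_nonneg _ _) (hΦ _)

theorem chi_nonneg {d M N : ℕ} [NeZero d] {β : Str N M → ℝ} (hβ : ∀ x, 0 ≤ β x)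
    {Φ : Conf d (N - M) → ℂ} (hΦ : ∀ e, 0 ≤ Φ e) (p : Conf d M × Conf d N) : 0 ≤ chi β Φ p := by
  rw [chi_apply]
  exact Finset.sum_nonneg fun x _ => mul_nonneg (by exact_mod_cast hβ x) (special_nonneg hΦ x p)

theorem inSector_chi_sectorState {d M N : ℕ} [NeZero d] (β : Str N M → ℝ) (W : Fin d → ℤ) :
    InSector W (chi β (sectorState (N - M) W)) := by
  intro p hp
  rw [chi_apply] at hp
  obtain ⟨x, -, hx⟩ := Finset.exists_ne_zero_of_sum_ne_zero hp
  have h := right_ne_zero_of_mul hx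
  rw [weight_eq_of_special_ne_zero h]
  by_contra hne
  exact right_ne_zero_of_mul h (if_neg hne)

/-- Nonnegative weight means that the output contains every spin value at least as often as the
input. Choosing that many sites for each value and taking their union gives `x`. -/
theorem exists_special_sectorState_ne_zero {d M N : ℕ} [NeZero d] {p : Conf d M × Conf d N}
    (hp : ∀ s, 0 ≤ weight p s) :
    ∃ x : Str N M, special (sectorState (N - M) (weight p)) x p ≠ 0 := by
  have h1 : ∀ s, ∃ t ⊆ Finset.univ.filter fun n => p.2 n = s, t.card = occ p.1 s := fun s =>
    Finset.exists_subset_card_eq (by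
      have := hp s
      rw [weight_apply] at this
      simp only [occ] at this ⊢
      omega)
  choose t ht htc using h1
  have hmem : ∀ {s n}, n ∈ t s → p.2 n = s := fun {s n} hn => (Finset.mem_filter.mp (ht s hn)).2
  have hx : (Finset.univ.biUnion t).card = M := by
    rw [Finset.card_biUnion]
    · simp_rw [htc]
      exact sum_occ p.1
    · intro s _ s' _ hss
      exact Finset.disjoint_left.mpr fun n hn hn' => hss ((hmem hn).symm.trans (hmem hn'))
  have hf : ∀ s, (Finset.univ.biUnion t).filter (fun n => p.2 n = s) = t s := by
    intro s
    ext n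
    simp only [Finset.mem_filter, Finset.mem_biUnion, Finset.mem_univ, true_and]
    constructor
    · rintro ⟨⟨s', hs'⟩, hn⟩
      rwa [← hn, hmem hs']
    · exact fun hn => ⟨⟨s, hn⟩, hmem hn⟩
  let x : Str N M := ⟨Finset.univ.biUnion t, hx⟩
  have hb : bell M p.1 (restr x.1 x.2 p.2) ≠ 0 := by
    rw [bell_ne_zero_iff]
    ext s
    rw [occ_restr, hf, htc]
  refine ⟨x, mul_ne_zero hb ?_⟩
  rw [sectorState, if_pos]
  · exact one_ne_zero
  · ext s
    have h2 := congrFun ((bell_ne_zero_iff _ _).mp hb) s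
    have h3 := occ_restr_add_occ_restr_compl x p.2 s
    rw [weight_apply, h2]
    omega

/-- The uniform superposition of special states is positive throughout a sector. -/
theorem chi_one_sectorState_pos {d M N : ℕ} [NeZero d] {p : Conf d M × Conf d N}
    (hp : ∀ s, 0 ≤ weight p s) :
    0 < chi (1 : Str N M → ℝ) (sectorState (N - M) (weight p)) p := by
  obtain ⟨x, hx⟩ := exists_special_sectorState_ne_zero (d := d) (M := M) (N := N) hp
  rw [chi_apply]
  have h0 : ∀ x : Str N M, 0 ≤ special (sectorState (N - M) (weight p)) x p := fun x =>
    special_nonneg (sectorState_nonneg _) x p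
  refine Finset.sum_pos' (fun x _ => ?_) ⟨x, Finset.mem_univ x, ?_⟩
  · simpa using h0 x
  · simpa using lt_of_le_of_ne (h0 x) hx.symm

/-! ### Eigenvalue bound -/

theorem dotProduct_R_total_mulVec_chi_le {d M N : ℕ} [NeZero d] {α : Finset (Fin N) → ℝ}
    {lam : ℝ} (hlam : ∀ β : Str N M → ℝ, (∀ x, 0 ≤ β x) →
      ∑ y, α y * quad d y β ≤ lam * quad d ∅ β) {β : Str N M → ℝ} (hβ : ∀ x, 0 ≤ β x)
    {Φ : Conf d (N - M) → ℂ} (hΦ : IsSymmetric Φ) :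
    star (chi β Φ) ⬝ᵥ (R_total d M α *ᵥ chi β Φ) ≤ (lam : ℂ) * (star (chi β Φ) ⬝ᵥ chi β Φ) := by
  rw [star_chi_dotProduct_R_total α β hΦ, star_chi_dotProduct_chi β hΦ, ← mul_assoc]
  refine mul_le_mul_of_nonneg_right ?_ (dotProduct_star_self_nonneg _)
  exact_mod_cast hlam β hβ

/-- The Rayleigh bound holds for `w` and, by invariance of the cone, for `Rw`. Add to these the
inequality `⟨λw - Rw, R(λw - Rw)⟩ ≥ 0`: the terms in `⟨w, Rw⟩` and `⟨Rw, R Rw⟩` cancel, leaving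
`λ‖Rw‖² ≤ λ³‖w‖²`. -/
theorem dotProduct_mulVec_chi_self_le {d M N : ℕ} [NeZero d] {α : Finset (Fin N) → ℝ}
    (hα : ∀ x, 0 ≤ α x) {lam : ℝ} (hpos : 0 < lam) (hlam : ∀ β : Str N M → ℝ, (∀ x, 0 ≤ β x) →
      ∑ y, α y * quad d y β ≤ lam * quad d ∅ β) {β : Str N M → ℝ} (hβ : ∀ x, 0 ≤ β x)
    {Φ : Conf d (N - M) → ℂ} (hΦ : IsSymmetric Φ) :
    star (R_total d M α *ᵥ chi β Φ) ⬝ᵥ (R_total d M α *ᵥ chi β Φ) ≤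
      (lam : ℂ) ^ 2 * (star (chi β Φ) ⬝ᵥ chi β Φ) := by
  obtain ⟨γ, hγ, hR⟩ := exists_R_total_mulVec_chi (d := d) hα hβ
  have h1 := dotProduct_R_total_mulVec_chi_le hlam hβ hΦ
  have h2 := dotProduct_R_total_mulVec_chi_le hlam hγ hΦ
  rw [← hR Φ hΦ] at h2
  have hpsd := posSemidef_R_total (d := d) (M := M) hα
  set R := R_total d M α
  have hH : Rᴴ = R := hpsd.1
  set w := chi β Φ
  have h3 := hpsd.dotProduct_mulVec_nonneg ((lam : ℂ) • w - R *ᵥ w)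
  have h4 : star w ⬝ᵥ (R *ᵥ (R *ᵥ w)) = star (R *ᵥ w) ⬝ᵥ (R *ᵥ w) := by
    rw [star_mulVec, hH, ← dotProduct_mulVec]
  have hs : star ((lam : ℂ) • w) = (lam : ℂ) • star w := by
    rw [star_smul, Complex.star_def, Complex.conj_ofReal]
  rw [mulVec_sub, mulVec_smul, star_sub, hs, sub_dotProduct, dotProduct_sub, dotProduct_sub,
    smul_dotProduct, smul_dotProduct, dotProduct_smul, dotProduct_smul, h4] at h3
  simp only [smul_eq_mul] at h3
  have hl : (0 : ℂ) < lam := by exact_mod_cast hpos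
  have h6 := mul_le_mul_of_nonneg_left h1 (mul_nonneg hl.le hl.le)
  have h7 : (lam : ℂ) * (star (R *ᵥ w) ⬝ᵥ (R *ᵥ w)) ≤
      (lam : ℂ) * ((lam : ℂ) ^ 2 * (star w ⬝ᵥ w)) := by
    rw [← sub_nonneg]
    have h8 := add_nonneg h3 (add_nonneg (sub_nonneg.mpr h6) (sub_nonneg.mpr h2))
    refine h8.trans_eq ?_
    ring
  exact le_of_mul_le_mul_left h7 hl

theorem dotProduct_pow_mulVec_chi_self_le {d M N : ℕ} [NeZero d] {α : Finset (Fin N) → ℝ}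
    (hα : ∀ x, 0 ≤ α x) {lam : ℝ} (hpos : 0 < lam) (hlam : ∀ β : Str N M → ℝ, (∀ x, 0 ≤ β x) →
      ∑ y, α y * quad d y β ≤ lam * quad d ∅ β) {Φ : Conf d (N - M) → ℂ} (hΦ : IsSymmetric Φ)
    (k : ℕ) {β : Str N M → ℝ} (hβ : ∀ x, 0 ≤ β x) :
    star ((R_total d M α ^ k) *ᵥ chi β Φ) ⬝ᵥ ((R_total d M α ^ k) *ᵥ chi β Φ) ≤
      ((lam : ℂ) ^ 2) ^ k * (star (chi β Φ) ⬝ᵥ chi β Φ) := by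
  induction k generalizing β with
  | zero => simp
  | succ k ih =>
    obtain ⟨γ, hγ, hR⟩ := exists_R_total_mulVec_chi (d := d) hα hβ
    have h := dotProduct_mulVec_chi_self_le hα hpos hlam hβ hΦ
    rw [hR Φ hΦ] at h
    rw [pow_succ (R_total d M α), ← mulVec_mulVec, hR Φ hΦ, pow_succ ((lam : ℂ) ^ 2), mul_assoc]
    refine (ih hγ).trans (mul_le_mul_of_nonneg_left h ?_)
    exact_mod_cast pow_nonneg (sq_nonneg lam) k

/-- For a matrix with nonnegative entries the triangle inequality gives `|μ| |v| ≤ R|v|` entrywise,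
and domination by `u` persists under further applications of `R`. -/
theorem norm_pow_mul_norm_le {n : Type*} [Fintype n] [DecidableEq n] {R : Matrix n n ℂ}
    (hR : ∀ p q, 0 ≤ R p q) {v u : n → ℂ} {μ : ℂ} (hv : R *ᵥ v = μ • v)
    (hvu : ∀ p, ((‖v p‖ : ℝ) : ℂ) ≤ u p) (k : ℕ) (p : n) :
    ((‖μ‖ ^ k * ‖v p‖ : ℝ) : ℂ) ≤ ((R ^ k) *ᵥ u) p := by
  induction k generalizing p with
  | zero => simpa using hvu p
  | succ k ih =>
    have h1 : ‖μ‖ * ‖v p‖ ≤ ∑ q, ‖R p q‖ * ‖v q‖ := by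
      rw [← norm_mul, ← smul_eq_mul, ← Pi.smul_apply, ← hv]
      simp_rw [← norm_mul]
      exact norm_sum_le _ _
    have h2 : ‖μ‖ ^ (k + 1) * ‖v p‖ ≤ ∑ q, ‖R p q‖ * (‖μ‖ ^ k * ‖v q‖) := by
      calc ‖μ‖ ^ (k + 1) * ‖v p‖ = ‖μ‖ ^ k * (‖μ‖ * ‖v p‖) := by ring
        _ ≤ ‖μ‖ ^ k * ∑ q, ‖R p q‖ * ‖v q‖ := by gcongr
        _ = _ := by
          rw [Finset.mul_sum]
          exact Finset.sum_congr rfl fun q _ => by ring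
    rw [pow_succ' R, ← mulVec_mulVec]
    refine (Complex.real_le_real.mpr h2).trans ?_
    rw [Complex.ofReal_sum]
    refine Finset.sum_le_sum fun q _ => ?_
    rw [Complex.ofReal_mul, Complex.norm_of_nonneg' (hR p q)]
    exact mul_le_mul_of_nonneg_left (ih q) (hR p q)

theorem norm_le_of_pow_le {x c C lam : ℝ} (hlam : 0 < lam) (hc : 0 < c)
    (h : ∀ k : ℕ, x ^ k * c ≤ C * lam ^ k) : x ≤ lam := by
  by_contra hlt
  push Not at hlt
  have h1 : 1 < x / lam := (one_lt_div hlam).mpr hlt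
  obtain ⟨k, hk⟩ := pow_unbounded_of_one_lt (C / c) h1
  rw [div_pow, div_lt_div_iff₀ hc (pow_pos hlam k)] at hk
  exact absurd (h k) (not_le.mpr hk)

/-- The cone vector `u` is positive on the whole sector, so a multiple of it dominates `|v|`. The
entries of `R^k u` grow at most like `λ^k`, which `|μ|^k` cannot outgrow. -/
theorem norm_le_of_inSector {d M N : ℕ} [NeZero d] {α : Finset (Fin N) → ℝ}
    (hα : ∀ x, 0 ≤ α x) {lam : ℝ} (hpos : 0 < lam) (hlam : ∀ β : Str N M → ℝ, (∀ x, 0 ≤ β x) →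
      ∑ y, α y * quad d y β ≤ lam * quad d ∅ β) {W : Fin d → ℤ} (hW : ∀ s, 0 ≤ W s)
    {v : Conf d M × Conf d N → ℂ} (hvW : InSector W v) (hv0 : v ≠ 0) {μ : ℂ}
    (hv : R_total d M α *ᵥ v = μ • v) : ‖μ‖ ≤ lam := by
  set u := chi (1 : Str N M → ℝ) (sectorState (N - M) W) with hu
  have hu0 : ∀ p, 0 ≤ u p := chi_nonneg (fun _ => zero_le_one) (sectorState_nonneg W)
  have hupos : ∀ p, v p ≠ 0 → 0 < u p := fun p hp => by
    have h := hvW p hp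
    rw [hu, ← h]
    exact chi_one_sectorState_pos (by rw [h]; exact hW)
  have hure : ∀ p, ((u p).re : ℂ) = u p := fun p =>
    (Complex.eq_re_of_ofReal_le (r := 0) (by simpa using hu0 p)).symm
  -- The sum of the ratios bounds each of them; where `v` vanishes the term is zero, whatever `u` is
  -- there.
  let C : ℝ := ∑ p, ‖v p‖ / (u p).re
  have hre0 : ∀ p, 0 ≤ (u p).re := fun p => (Complex.nonneg_iff.mp (hu0 p)).1
  have hterm : ∀ p, 0 ≤ ‖v p‖ / (u p).re := fun p => div_nonneg (norm_nonneg _) (hre0 p)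
  have hC : ∀ p, ((‖v p‖ : ℝ) : ℂ) ≤ ((C : ℂ) • u) p := by
    intro p
    rw [Pi.smul_apply, smul_eq_mul, ← hure p, ← Complex.ofReal_mul]
    refine Complex.real_le_real.mpr ?_
    by_cases hp : v p = 0
    · rw [hp, norm_zero]
      exact mul_nonneg (Finset.sum_nonneg fun q _ => hterm q) (hre0 p)
    · have h := (Complex.pos_iff.mp (hupos p hp)).1
      rw [← div_le_iff₀ h]
      exact Finset.single_le_sum (f := fun p => ‖v p‖ / (u p).re) (fun q _ => hterm q)
        (Finset.mem_univ p)
  obtain ⟨p, hp⟩ := Function.ne_iff.mp hv0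
  have hp' : 0 < ‖v p‖ := norm_pos_iff.mpr hp
  set n0 := Real.sqrt (star u ⬝ᵥ u).re with hn0
  refine norm_le_of_pow_le (c := ‖v p‖) (C := C * n0) hpos hp' fun k => ?_
  have h1 := norm_pow_mul_norm_le (R_total_apply_nonneg hα) hv hC k p
  have h2 := dotProduct_pow_mulVec_chi_self_le hα hpos hlam
    (isSymmetric_sectorState (n := N - M) W) k (β := 1) fun _ => zero_le_one
  rw [← hu] at h2
  set w := (R_total d M α ^ k) *ᵥ u with hw
  rw [mulVec_smul, Pi.smul_apply, smul_eq_mul] at h1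
  have h3 : (w p).re ≤ lam ^ k * n0 := by
    have h4 : (star w ⬝ᵥ w).re ≤ (lam ^ 2) ^ k * (star u ⬝ᵥ u).re := by
      have := (Complex.le_def.mp h2).1
      rwa [← Complex.ofReal_pow, ← Complex.ofReal_pow, Complex.re_ofReal_mul] at this
    have h5 : (w p).re ^ 2 ≤ (star w ⬝ᵥ w).re := by
      rw [dotProduct, Complex.re_sum]
      refine le_trans ?_ (Finset.single_le_sum (f := fun q => (star w q * w q).re)
        (fun q _ => ?_) (Finset.mem_univ p))
      · simp only [Pi.star_apply, Complex.star_def, Complex.mul_re, Complex.conj_re,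
          Complex.conj_im]
        nlinarith [sq_nonneg (w p).im]
      · simp only [Pi.star_apply, Complex.star_def, Complex.mul_re, Complex.conj_re,
          Complex.conj_im]
        nlinarith [sq_nonneg (w q).im, sq_nonneg (w q).re]
    have h6 : (lam ^ k * n0) ^ 2 = (lam ^ 2) ^ k * (star u ⬝ᵥ u).re := by
      rw [mul_pow, hn0, Real.sq_sqrt (Complex.nonneg_iff.mp (dotProduct_star_self_nonneg u)).1]
      ring
    refine le_of_sq_le_sq ?_ (by positivity)
    rw [h6]
    exact h5.trans h4
  have h7 := (Complex.le_def.mp h1).1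
  rw [Complex.re_ofReal_mul, Complex.ofReal_re] at h7
  have hC0 : 0 ≤ C := Finset.sum_nonneg fun q _ => hterm q
  calc ‖μ‖ ^ k * ‖v p‖ ≤ C * (w p).re := h7
    _ ≤ C * (lam ^ k * n0) := by gcongr
    _ = C * n0 * lam ^ k := by ring

/-- How far a weight is from being nonnegative. -/
def deficiency {d : ℕ} (W : Fin d → ℤ) : ℕ := ∑ s, (-W s).toNat

/-- The weights sum to `N - M > 0`, so a negative one is accompanied by a positive one. Moving a
unit between them commutes with `R`, and the norm identity keeps the image nonzero. -/
theorem exists_raise {d M N : ℕ} [NeZero d] (hMN : M < N) (α : Finset (Fin N) → ℝ)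
    {W : Fin d → ℤ} {v : Conf d M × Conf d N → ℂ} (hvW : InSector W v) (hv0 : v ≠ 0) {μ : ℂ}
    (hv : R_total d M α *ᵥ v = μ • v) {j : Fin d} (hj : W j < 0) :
    ∃ i, 0 < W i ∧ deficiency (W + Pi.single j 1 - Pi.single i 1) < deficiency W ∧
      InSector (W + Pi.single j 1 - Pi.single i 1) (lieOp M N (Matrix.single j i 1) *ᵥ v) ∧
      lieOp M N (Matrix.single j i 1) *ᵥ v ≠ 0 ∧
      R_total d M α *ᵥ (lieOp M N (Matrix.single j i 1) *ᵥ v) =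
        μ • (lieOp M N (Matrix.single j i 1) *ᵥ v) := by
  obtain ⟨i, hi⟩ : ∃ i, 0 < W i := by
    obtain ⟨p, hp⟩ := Function.ne_iff.mp hv0
    have h1 := sum_weight p
    rw [hvW p hp] at h1
    have h2 : ∑ s : Fin d, (0 : ℤ) < ∑ s, W s := by
      rw [h1, Finset.sum_const_zero]
      omega
    obtain ⟨i, -, hi⟩ := Finset.exists_lt_of_sum_lt h2
    exact ⟨i, hi⟩
  have hij : i ≠ j := by
    rintro rfl
    omega
  refine ⟨i, hi, ?_, hvW.lieOp_single j i, lieOp_single_mulVec_ne_zero hvW hv0 (hj.trans hi), ?_⟩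
  -- The positive weight at `i` stays nonnegative after losing one unit, so only the negative part
  -- at `j` changes.
  · refine Finset.sum_lt_sum (fun s _ => ?_) ⟨j, Finset.mem_univ j, ?_⟩
    · simp only [Pi.sub_apply, Pi.add_apply, Pi.single_apply]
      split_ifs with h1 h2 h2
      · exact absurd (h2.symm.trans h1) hij
      · omega
      · subst h2; omega
      · omega
    · simp only [Pi.sub_apply, Pi.add_apply, Pi.single_eq_same, Pi.single_eq_of_ne hij.symm]
      omega
  · rw [mulVec_mulVec, ← lieOp_mul_R_total, ← mulVec_mulVec, hv, mulVec_smul]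

/-- A nonzero sector component of the eigenvector is raised until its deficiency is zero, where the
Perron–Frobenius bound applies. -/
theorem norm_eigenvalue_le {d M N : ℕ} [NeZero d] (hMN : M < N) {α : Finset (Fin N) → ℝ}
    (hα : ∀ x, 0 ≤ α x) {lam : ℝ} (hpos : 0 < lam) (hlam : ∀ β : Str N M → ℝ, (∀ x, 0 ≤ β x) →
      ∑ y, α y * quad d y β ≤ lam * quad d ∅ β)
    {v : Conf d M × Conf d N → ℂ} (hv0 : v ≠ 0) {μ : ℂ}
    (hv : R_total d M α *ᵥ v = μ • v) : ‖μ‖ ≤ lam := by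
  have key : ∀ (k : ℕ) (W : Fin d → ℤ) (v : Conf d M × Conf d N → ℂ), deficiency W = k →
      InSector W v → v ≠ 0 → R_total d M α *ᵥ v = μ • v → ‖μ‖ ≤ lam := by
    intro k
    induction k using Nat.strong_induction_on with
    | _ k ih =>
      intro W v hk hvW hv0 hv
      by_cases hW : ∀ s, 0 ≤ W s
      · exact norm_le_of_inSector hα hpos hlam hW hvW hv0 hv
      · push Not at hW
        obtain ⟨j, hj⟩ := hW
        obtain ⟨i, -, h1, h2, h3, h4⟩ := exists_raise hMN α hvW hv0 hv hj
        exact ih _ (hk ▸ h1) _ _ rfl h2 h3 h4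
  obtain ⟨p, hp⟩ := Function.ne_iff.mp hv0
  refine key _ (weight p) (sectorPart (weight p) v) rfl (inSector_sectorPart _ _) ?_
    (R_total_mulVec_sectorPart_eq_smul hv _)
  refine Function.ne_iff.mpr ⟨p, ?_⟩
  rw [sectorPart, if_pos rfl]
  exact hp

theorem posSemidef_smul_one_sub_R_total {d M N : ℕ} [NeZero d] (hMN : M < N)
    {α : Finset (Fin N) → ℝ} (hα : ∀ x, 0 ≤ α x) {lam : ℝ} (hpos : 0 < lam)
    (hlam : ∀ β : Str N M → ℝ, (∀ x, 0 ≤ β x) → ∑ y, α y * quad d y β ≤ lam * quad d ∅ β) :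
    ((lam : ℂ) • (1 : Matrix (Conf d M × Conf d N) (Conf d M × Conf d N) ℂ) -
      R_total d M α).PosSemidef := by
  have hH : ((lam : ℂ) • (1 : Matrix (Conf d M × Conf d N) (Conf d M × Conf d N) ℂ) -
      R_total d M α).IsHermitian := by
    rw [IsHermitian, conjTranspose_sub, conjTranspose_smul, conjTranspose_one,
      (posSemidef_R_total hα).1.eq, Complex.star_def, Complex.conj_ofReal]
  rw [hH.posSemidef_iff_eigenvalues_nonneg]
  intro i
  have h := hH.mulVec_eigenvectorBasis i
  set v : Conf d M × Conf d N → ℂ := (hH.eigenvectorBasis i).ofLp with hv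
  set ν := hH.eigenvalues i
  have hv0 : v ≠ 0 := by
    intro h0
    have := hH.eigenvectorBasis.orthonormal.ne_zero i
    apply this
    ext p
    exact congrFun h0 p
  have h1 : R_total d M α *ᵥ v = ((lam - ν : ℝ) : ℂ) • v := by
    rw [sub_mulVec, smul_mulVec, one_mulVec] at h
    rw [Complex.ofReal_sub, sub_smul, ← sub_eq_iff_eq_add.mpr (sub_eq_iff_eq_add'.mp h)]
    ext p
    simp
  have h2 := norm_eigenvalue_le hMN hα hpos hlam hv0 h1
  rw [Complex.norm_real, Real.norm_eq_abs] at h2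
  have := (le_abs_self _).trans h2
  simp only [Pi.zero_apply]
  linarith

/-- A vector on which the quadratic form of the positive operator `λ - R` vanishes lies in its
kernel. -/
theorem R_total_mulVec_chi_of_isMax {d M N : ℕ} [NeZero d] (hMN : M < N)
    {α : Finset (Fin N) → ℝ} (hα : ∀ x, 0 ≤ α x) {lam : ℝ} (hpos : 0 < lam)
    (hlam : ∀ β : Str N M → ℝ, (∀ x, 0 ≤ β x) → ∑ y, α y * quad d y β ≤ lam * quad d ∅ β)
    {β : Str N M → ℝ} (hβ : ∑ y, α y * quad d y β = lam * quad d ∅ β)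
    {Φ : Conf d (N - M) → ℂ} (hΦ : IsSymmetric Φ) :
    R_total d M α *ᵥ chi β Φ = (lam : ℂ) • chi β Φ := by
  have h := posSemidef_smul_one_sub_R_total hMN hα hpos hlam
  have h1 := (h.dotProduct_mulVec_zero_iff (chi β Φ)).mp (by
    rw [sub_mulVec, dotProduct_sub, star_chi_dotProduct_R_total α β hΦ, hβ, smul_mulVec,
      one_mulVec, dotProduct_smul, star_chi_dotProduct_chi β hΦ, smul_eq_mul,
      Complex.ofReal_mul, mul_assoc, sub_self])
  rw [sub_mulVec, smul_mulVec, one_mulVec, sub_eq_zero] at h1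
  exact h1.symm

/-! ### Upper bound on the fidelity -/

open scoped MatrixOrder in
theorem trace_mul_nonneg {n : Type*} [Fintype n] [DecidableEq n] {A B : Matrix n n ℂ}
    (hA : A.PosSemidef) (hB : B.PosSemidef) : 0 ≤ (A * B).trace := by
  obtain ⟨C, rfl⟩ := CStarAlgebra.nonneg_iff_eq_star_mul_self.mp hB.nonneg
  rw [star_eq_conjTranspose, ← Matrix.mul_assoc, trace_mul_comm, ← Matrix.mul_assoc]
  exact (hA.mul_mul_conjTranspose_same C).trace_nonneg

/-- Compressing `λ - R` by the projector `R_∅` gives `λ R_∅ - R ≥ 0`, whose trace against the Choi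
matrix is nonnegative. The compression is essential: trace preservation normalises the pairing with
`R_∅`, giving the same dimension factor as in the fidelities. -/
theorem sum_mul_fidelity_le {d M N : ℕ} [NeZero d] {α : Finset (Fin N) → ℝ} {lam : ℝ}
    (h : ((lam : ℂ) • (1 : Matrix (Conf d M × Conf d N) (Conf d M × Conf d N) ℂ) -
      R_total d M α).PosSemidef)
    (hα : ∀ x, 0 ≤ α x)
    {E : Matrix (Conf d M) (Conf d M) ℂ →ₗ[ℂ] Matrix (Conf d N) (Conf d N) ℂ}
    (hE : IsChannel E) : ∑ y, α y * fidelity E y ≤ lam := by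
  have hP := posSemidef_R_op (d := d) (M := M) (N := N) ∅
  have hH : (R_op d M (∅ : Finset (Fin N)))ᴴ = R_op d M ∅ := hP.1
  have h1 := h.mul_mul_conjTranspose_same (R_op d M (∅ : Finset (Fin N)))
  have h2 : R_op d M (∅ : Finset (Fin N)) * ((lam : ℂ) • 1 - R_total d M α) *
      (R_op d M ∅)ᴴ = (lam : ℂ) • R_op d M ∅ - R_total d M α := by
    have h3 : R_op d M ∅ * R_total d M α = R_total d M α := by
      have := congrArg conjTranspose (R_total_mul_R_op_empty (d := d) (M := M) α)
      rwa [conjTranspose_mul, hH, (posSemidef_R_total hα).1.eq] at this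
    rw [hH, Matrix.mul_sub, Matrix.sub_mul, h3, R_total_mul_R_op_empty, mul_smul_comm, mul_one,
      smul_mul_assoc, R_op_mul_R_op_empty]
  rw [h2] at h1
  have h3 := (Complex.nonneg_iff.mp (trace_mul_nonneg h1 (posSemidef_choi hE))).1
  have hc : (0 : ℝ) < ((M + d - 1).choose M : ℝ) := by
    have := NeZero.pos d
    exact_mod_cast Nat.choose_pos (by omega)
  have h4 : ((((lam : ℂ) • R_op d M ∅ - R_total d M α) * choi E).trace).re =
      ((M + d - 1).choose M : ℝ) * (lam - ∑ y, α y * fidelity E y) := by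
    rw [Matrix.sub_mul, trace_sub, Complex.sub_re, smul_mul_assoc, trace_smul, smul_eq_mul,
      Complex.re_ofReal_mul, ← choose_mul_fidelity, fidelity_empty hE, mul_one, R_total,
      Finset.sum_mul, trace_sum, Complex.re_sum, mul_sub, mul_comm lam, Finset.mul_sum]
    congr 1
    refine Finset.sum_congr rfl fun y _ => ?_
    rw [smul_mul_assoc, trace_smul, smul_eq_mul, Complex.re_ofReal_mul, ← choose_mul_fidelity]
    ring
  rw [h4] at h3
  have := nonneg_of_mul_nonneg_right h3 hc
  linarith

/-! ### Irreducibility of the cloning operator on the sectors -/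

/-- Configurations connected through nonzero entries of the cloning operator. -/
def Reach {d M N : ℕ} (α : Finset (Fin N) → ℝ) : Conf d M × Conf d N → Conf d M × Conf d N → Prop :=
  Relation.ReflTransGen fun p q => R_total d M α p q ≠ 0

theorem Reach.weight_eq {d M N : ℕ} [NeZero d] {α : Finset (Fin N) → ℝ}
    {p q : Conf d M × Conf d N} (h : Reach α p q) : weight p = weight q := by
  induction h with
  | refl => rfl
  | tail _ h ih => exact ih.trans (weight_eq_of_R_total_ne_zero h)

theorem reach_update {d M N : ℕ} [NeZero d] {α : Finset (Fin N) → ℝ} (hα : ∀ x, 0 ≤ α x)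
    (hN : ∀ n, ∃ x, n ∈ x ∧ 0 < α x) {a : Conf d M} {b : Conf d N} {k : Fin M} {n : Fin N}
    (h : a k = b n) (t : Fin d) :
    Reach α (a, b) (Function.update a k t, Function.update b n t) :=
  Relation.ReflTransGen.single (R_total_apply_update_ne_zero hα (hN n) h t)

theorem exists_eq_of_weight_nonneg {d M N : ℕ} {a : Conf d M} {b : Conf d N}
    (h : ∀ s, 0 ≤ weight (a, b) s) (k : Fin M) : ∃ n, a k = b n := by
  have h1 := h (a k)
  have h2 : 0 < occ a (a k) :=
    Finset.card_pos.mpr ⟨k, Finset.mem_filter.mpr ⟨Finset.mem_univ k, rfl⟩⟩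
  rw [weight_apply] at h1
  simp only at h1
  have h3 : 0 < occ b (a k) := by omega
  obtain ⟨n, hn⟩ := Finset.card_pos.mp h3
  exact ⟨n, (Finset.mem_filter.mp hn).2.symm⟩

/-- Input sites are changed one at a time. Nonnegative weight, conserved by the moves, always
supplies an output site sharing the value to be changed. -/
theorem exists_reach_left {d M N : ℕ} [NeZero d] {α : Finset (Fin N) → ℝ} (hα : ∀ x, 0 ≤ α x)
    (hN : ∀ n, ∃ x, n ∈ x ∧ 0 < α x) {a : Conf d M} {b : Conf d N}
    (h : ∀ s, 0 ≤ weight (a, b) s) (a' : Conf d M) : ∃ b', Reach α (a, b) (a', b') := by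
  have key : ∀ S : Finset (Fin M), ∃ b', Reach α (a, b) (S.piecewise a' a, b') := by
    intro S
    induction S using Finset.induction_on with
    | empty =>
      rw [Finset.piecewise_empty]
      exact ⟨b, Relation.ReflTransGen.refl⟩
    | insert k S hk ih =>
      obtain ⟨b', hb'⟩ := ih
      obtain ⟨n, hn⟩ := exists_eq_of_weight_nonneg (by rw [← hb'.weight_eq]; exact h) k
      rw [Finset.piecewise_insert]
      exact ⟨_, hb'.trans (reach_update hα hN hn (a' k))⟩
  obtain ⟨b', hb'⟩ := key Finset.univ
  rw [Finset.piecewise_univ] at hb'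
  exact ⟨b', hb'⟩

/-- The input site `k` is a scratch register: the pair `k, m` takes the value at `n`, then the pair
`k, n` takes the old value at `m`, which also restores `k`. -/
theorem reach_swap_of_eq {d M N : ℕ} [NeZero d] {α : Finset (Fin N) → ℝ} (hα : ∀ x, 0 ≤ α x)
    (hN : ∀ n, ∃ x, n ∈ x ∧ 0 < α x) {a : Conf d M} {b : Conf d N} {k : Fin M} {m : Fin N}
    (h : a k = b m) (n : Fin N) : Reach α (a, b) (a, b ∘ Equiv.swap m n) := by
  have h1 := reach_update hα hN h (b n)
  have h2 : Function.update a k (b n) k = Function.update b m (b n) n := by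
    rw [Function.update_self]
    by_cases hmn : n = m
    · subst hmn
      rw [Function.update_self]
    · rw [Function.update_of_ne hmn]
  have h3 := h1.trans (reach_update hα hN h2 (b m))
  rw [Function.update_idem, ← h, Function.update_eq_self, h, ← Equiv.comp_swap_eq_update,
    Equiv.swap_comm] at h3
  exact h3

/-- If neither site shares the value of `k`, a third site `l` does. The pair `k, l` temporarily
takes the value at `m`, the swap is performed, and the pair is reset. -/
theorem reach_swap {d M N : ℕ} [NeZero d] {α : Finset (Fin N) → ℝ} (hα : ∀ x, 0 ≤ α x)
    (hN : ∀ n, ∃ x, n ∈ x ∧ 0 < α x) {a : Conf d M} {b : Conf d N} (k : Fin M)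
    (h : ∀ s, 0 ≤ weight (a, b) s) (m n : Fin N) : Reach α (a, b) (a, b ∘ Equiv.swap m n) := by
  obtain ⟨l, hl⟩ := exists_eq_of_weight_nonneg h k
  by_cases hlm : l = m
  · subst hlm
    exact reach_swap_of_eq hα hN hl n
  by_cases hln : l = n
  · subst hln
    rw [Equiv.swap_comm]
    exact reach_swap_of_eq hα hN hl m
  have h1 := reach_update hα hN hl (b m)
  have h2 : Function.update a k (b m) k = Function.update b l (b m) m := by
    rw [Function.update_self, Function.update_of_ne (Ne.symm hlm)]
  have h3 := h1.trans (reach_swap_of_eq hα hN h2 n)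
  have h4 : Function.update a k (b m) k = (Function.update b l (b m) ∘ Equiv.swap m n) l := by
    rw [Function.update_self, Function.comp_apply, Equiv.swap_apply_of_ne_of_ne hlm hln,
      Function.update_self]
  have h5 := h3.trans (reach_update hα hN h4 (a k))
  have h6 : Function.update (Function.update b l (b m) ∘ Equiv.swap m n) l (a k) =
      b ∘ Equiv.swap m n := by
    ext i
    congr 1
    by_cases hi : i = l
    · subst hi
      rw [Function.update_self, Function.comp_apply, Equiv.swap_apply_of_ne_of_ne hlm hln, hl]
    · rw [Function.update_of_ne hi, Function.comp_apply, Function.comp_apply, Function.update_of_ne]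
      intro hs
      apply hi
      rw [← Equiv.swap_apply_of_ne_of_ne hlm hln] at hs
      exact (Equiv.swap m n).injective hs
  rwa [Function.update_idem, Function.update_eq_self, h6] at h5

theorem reach_comp_perm {d M N : ℕ} [NeZero d] {α : Finset (Fin N) → ℝ} (hα : ∀ x, 0 ≤ α x)
    (hN : ∀ n, ∃ x, n ∈ x ∧ 0 < α x) {a : Conf d M} (k : Fin M) (π : Equiv.Perm (Fin N))
    {b : Conf d N} (h : ∀ s, 0 ≤ weight (a, b) s) : Reach α (a, b) (a, b ∘ π) := by
  induction π using Equiv.Perm.swap_induction_on generalizing b with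
  | one => exact Relation.ReflTransGen.refl
  | swap_mul f m n _ ih =>
    have h1 := reach_swap hα hN k h m n
    exact h1.trans (ih (by rw [← h1.weight_eq]; exact h))

/-- Once the inputs agree, equal weights force equal output occupations, so a permutation of the
output sites completes the path. -/
theorem reach_of_weight_eq {d M N : ℕ} [NeZero d] (hM : 1 ≤ M) {α : Finset (Fin N) → ℝ}
    (hα : ∀ x, 0 ≤ α x) (hN : ∀ n, ∃ x, n ∈ x ∧ 0 < α x) {p q : Conf d M × Conf d N}
    (hp : ∀ s, 0 ≤ weight p s) (hpq : weight p = weight q) : Reach α p q := by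
  obtain ⟨b', hb'⟩ := exists_reach_left (a := p.1) (b := p.2) hα hN hp q.1
  have h : occ b' = occ q.2 := by
    ext s
    have := congrFun (hb'.weight_eq.symm.trans hpq) s
    rw [weight_apply, weight_apply] at this
    simp only at this
    omega
  obtain ⟨π, hπ⟩ := exists_perm_of_occ_eq h
  have h2 := reach_comp_perm hα hN (a := q.1) ⟨0, hM⟩ π (b := b') (by
    rw [← hb'.weight_eq]; exact hp)
  rw [hπ] at h2
  exact hb'.trans h2

/-- If a nonnegative eigenvector vanishes at `r`, row `r` of the eigenvalue equation is a vanishing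
sum of nonnegative terms; the zero spreads along nonzero entries. -/
theorem Reach.eq_zero {d M N : ℕ} [NeZero d] {α : Finset (Fin N) → ℝ} (hα : ∀ x, 0 ≤ α x)
    {w : Conf d M × Conf d N → ℂ} (hw : ∀ p, 0 ≤ w p) {μ : ℂ}
    (hR : R_total d M α *ᵥ w = μ • w) {p q : Conf d M × Conf d N} (h : Reach α p q)
    (hp : w p = 0) : w q = 0 := by
  induction h with
  | refl => exact hp
  | @tail r q _ hrq ih =>
    have h1 := congrFun hR r
    rw [Pi.smul_apply, ih, smul_zero, mulVec, dotProduct, Finset.sum_eq_zero_iff_of_nonneg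
      fun q _ => mul_nonneg (R_total_apply_nonneg hα r q) (hw q)] at h1
    exact (mul_eq_zero.mp (h1 q (Finset.mem_univ q))).resolve_left hrq

/-! ### Uniqueness of the maximum eigenvectors -/

theorem mulVec_ofReal_comp_re {n : Type*} [Fintype n] {R : Matrix n n ℂ}
    (hR : ∀ p q, 0 ≤ R p q) {lam : ℝ} {v : n → ℂ} (hv : R *ᵥ v = (lam : ℂ) • v) :
    (R *ᵥ fun p => ((v p).re : ℂ)) = (lam : ℂ) • fun p => ((v p).re : ℂ) := by
  ext p
  have h := congrArg Complex.re (congrFun hv p)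
  rw [Pi.smul_apply, smul_eq_mul, Complex.re_ofReal_mul, mulVec, dotProduct, Complex.re_sum] at h
  rw [Pi.smul_apply, smul_eq_mul, ← Complex.ofReal_mul, ← h, Complex.ofReal_sum, mulVec, dotProduct]
  refine Finset.sum_congr rfl fun q _ => ?_
  have him := (Complex.nonneg_iff.mp (hR p q)).2
  rw [Complex.mul_re, ← him, zero_mul, sub_zero, Complex.ofReal_mul]
  congr 1
  exact Complex.ext rfl him.symm

/-- Subtract from `Re v` the multiple of `u` given by the smallest ratio. The result is a
nonnegative solution of the eigenvalue equation with a zero in the sector, so irreducibility makes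
it vanish. -/
theorem exists_re_eq_mul {d M N : ℕ} [NeZero d] (hM : 1 ≤ M) {α : Finset (Fin N) → ℝ}
    (hα : ∀ x, 0 ≤ α x) (hN : ∀ n, ∃ x, n ∈ x ∧ 0 < α x) {W : Fin d → ℤ} (hW : ∀ s, 0 ≤ W s)
    {lam : ℝ} {u v : Conf d M × Conf d N → ℂ} (hu0 : ∀ p, 0 ≤ u p)
    (hu : R_total d M α *ᵥ u = (lam : ℂ) • u) (hupos : ∀ p, weight p = W → 0 < u p)
    (huW : InSector W u) (hvW : InSector W v)
    (hv : R_total d M α *ᵥ v = (lam : ℂ) • v) : ∃ t : ℝ, ∀ p, ((v p).re : ℂ) = t * u p := by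
  classical
  by_cases hne : ∃ p : Conf d M × Conf d N, weight p = W
  · obtain ⟨p₀, hp₀⟩ := hne
    obtain ⟨p₁, hp₁, hmin⟩ := (Finset.univ.filter fun p : Conf d M × Conf d N =>
      weight p = W).exists_min_image (fun p => (v p).re / (u p).re) ⟨p₀, by simp [hp₀]⟩
    rw [Finset.mem_filter] at hp₁
    set t := (v p₁).re / (u p₁).re with ht
    have hure : ∀ p, ((u p).re : ℂ) = u p := fun p =>
      (Complex.eq_re_of_ofReal_le (r := 0) (by simpa using hu0 p)).symm
    have hvz : ∀ p, weight p ≠ W → v p = 0 := fun p hp => by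
      by_contra h
      exact hp (hvW p h)
    have huz : ∀ p, weight p ≠ W → u p = 0 := fun p hp => by
      by_contra h
      exact hp (huW p h)
    have hpos : ∀ p, weight p = W → 0 < (u p).re := fun p hp =>
      (Complex.pos_iff.mp (hupos p hp)).1
    let w : Conf d M × Conf d N → ℂ := (fun p => ((v p).re : ℂ)) - (t : ℂ) • u
    have hwre : ∀ p, w p = (((v p).re - t * (u p).re : ℝ) : ℂ) := fun p => by
      simp only [w, Pi.sub_apply, Pi.smul_apply, smul_eq_mul]
      rw [Complex.ofReal_sub, Complex.ofReal_mul, hure]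
    have hw0 : ∀ p, 0 ≤ w p := fun p => by
      rw [hwre]
      by_cases hp : weight p = W
      · have h := hmin p (by simp [hp])
        rw [le_div_iff₀ (hpos p hp)] at h
        exact_mod_cast sub_nonneg.mpr h
      · rw [hvz p hp, huz p hp]
        simp
    have hwR : R_total d M α *ᵥ w = (lam : ℂ) • w := by
      rw [mulVec_sub, mulVec_smul, hu, mulVec_ofReal_comp_re (R_total_apply_nonneg hα) hv,
        smul_sub, smul_comm]
    have hw1 : w p₁ = 0 := by
      rw [hwre, ht, div_mul_cancel₀ _ (hpos p₁ hp₁.2).ne', sub_self, Complex.ofReal_zero]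
    refine ⟨t, fun p => ?_⟩
    by_cases hp : weight p = W
    · have h := Reach.eq_zero hα hw0 hwR (reach_of_weight_eq hM hα hN
        (by rw [hp₁.2]; exact hW) (hp₁.2.trans hp.symm)) hw1
      exact sub_eq_zero.mp h
    · rw [hvz p hp, huz p hp]
      simp
  · push Not at hne
    refine ⟨0, fun p => ?_⟩
    have : v p = 0 := by
      by_contra h
      exact hne p (hvW p h)
    simp [this]

/-- A zero at one configuration would spread over the whole sector, whereas the norm of `χ_β(Φ)`
equals that of `Φ` and is nonzero. -/
theorem chi_sectorState_pos {d M N : ℕ} [NeZero d] (hM : 1 ≤ M) {α : Finset (Fin N) → ℝ}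
    (hα : ∀ x, 0 ≤ α x) (hN : ∀ n, ∃ x, n ∈ x ∧ 0 < α x) {lam : ℝ} {β : Str N M → ℝ}
    (hβ : ∀ x, 0 ≤ β x) (hβ1 : quad d ∅ β = 1)
    (hR : ∀ Φ : Conf d (N - M) → ℂ, IsSymmetric Φ →
      R_total d M α *ᵥ chi β Φ = (lam : ℂ) • chi β Φ) {p : Conf d M × Conf d N}
    (hp : ∀ s, 0 ≤ weight p s) : 0 < chi β (sectorState (N - M) (weight p)) p := by
  set W := weight p with hW
  have h0 := chi_nonneg (d := d) hβ (sectorState_nonneg (n := N - M) W)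
  refine lt_of_le_of_ne (h0 p) fun hz => ?_
  obtain ⟨x, hx⟩ := exists_special_sectorState_ne_zero (d := d) (M := M) (N := N) hp
  have hΦ : sectorState (N - M) W ≠ 0 := by
    intro h
    rw [← hW, h, special_zero] at hx
    exact hx rfl
  have hne : chi β (sectorState (N - M) W) ≠ 0 := by
    intro h
    have h1 := star_chi_dotProduct_chi (d := d) β (isSymmetric_sectorState (n := N - M) W)
    rw [h, hβ1, dotProduct_zero, Complex.ofReal_one, one_mul] at h1
    exact hΦ (dotProduct_star_self_eq_zero.mp h1.symm)
  obtain ⟨q, hq⟩ := Function.ne_iff.mp hne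
  have hqW := inSector_chi_sectorState β W q hq
  exact hq (Reach.eq_zero hα h0 (hR _ (isSymmetric_sectorState W))
    (reach_of_weight_eq hM hα hN hp hqW.symm) hz.symm)

theorem exists_eq_smul_chi_sectorState {d M N : ℕ} [NeZero d] (hM : 1 ≤ M)
    {α : Finset (Fin N) → ℝ} (hα : ∀ x, 0 ≤ α x) (hN : ∀ n, ∃ x, n ∈ x ∧ 0 < α x) {lam : ℝ}
    {β : Str N M → ℝ} (hβ : ∀ x, 0 ≤ β x) (hβ1 : quad d ∅ β = 1)
    (hR : ∀ Φ : Conf d (N - M) → ℂ, IsSymmetric Φ →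
      R_total d M α *ᵥ chi β Φ = (lam : ℂ) • chi β Φ) {W : Fin d → ℤ} (hW : ∀ s, 0 ≤ W s)
    {v : Conf d M × Conf d N → ℂ} (hvW : InSector W v)
    (hv : R_total d M α *ᵥ v = (lam : ℂ) • v) :
    ∃ c : ℂ, v = c • chi β (sectorState (N - M) W) := by
  have hupos : ∀ p : Conf d M × Conf d N, weight p = W →
      0 < chi β (sectorState (N - M) W) p := by
    rintro p rfl
    exact chi_sectorState_pos hM hα hN hβ hβ1 hR hW
  have h0 := chi_nonneg (d := d) hβ (sectorState_nonneg (n := N - M) W)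
  have huR := hR _ (isSymmetric_sectorState W)
  have huW := inSector_chi_sectorState (d := d) β W
  obtain ⟨t, ht⟩ := exists_re_eq_mul hM hα hN hW h0 huR hupos huW hvW hv
  -- The imaginary part of `v` is the real part of `-i v`, an eigenvector for the same eigenvalue.
  obtain ⟨t', ht'⟩ := exists_re_eq_mul hM hα hN hW h0 huR hupos huW
    (v := (-Complex.I) • v) (fun p hp => hvW p (right_ne_zero_of_mul hp)) (by
      rw [mulVec_smul, hv, smul_comm])
  refine ⟨t + t' * Complex.I, funext fun p => ?_⟩
  have h1 := ht' p
  have h2 : (((-Complex.I) • v) p).re = (v p).im := by simp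
  rw [h2] at h1
  rw [Pi.smul_apply, smul_eq_mul, add_mul, ← ht p, mul_right_comm, ← h1, Complex.re_add_im]

theorem lieOp_mulVec_chi {d M N : ℕ} [NeZero d] (β : Str N M → ℝ) {Φ : Conf d (N - M) → ℂ}
    (hΦ : IsSymmetric Φ) (A : Matrix (Fin d) (Fin d) ℂ) :
    lieOp M N A *ᵥ chi β Φ = chi β (siteSum (N - M) A *ᵥ Φ) := by
  rw [chi, mulVec_sum, chi]
  refine Finset.sum_congr rfl fun x _ => ?_
  rw [mulVec_smul, lieOp_mulVec_special x hΦ]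

/-- Suppose `W_s < 0` and raise `v` at `s`. By induction on the deficiency the image lies in a
sector of nonnegative weight, so it is a multiple of `χ_β` of a state with no spin of value `s`. The
lowering operator kills it; being the adjoint of the raising operator, it then forces the image
itself to be zero. -/
theorem nonneg_of_inSector {d M N : ℕ} [NeZero d] (hM : 1 ≤ M) (hMN : M < N)
    {α : Finset (Fin N) → ℝ} (hα : ∀ x, 0 ≤ α x) (hN : ∀ n, ∃ x, n ∈ x ∧ 0 < α x) {lam : ℝ}
    {β : Str N M → ℝ} (hβ : ∀ x, 0 ≤ β x) (hβ1 : quad d ∅ β = 1)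
    (hR : ∀ Φ : Conf d (N - M) → ℂ, IsSymmetric Φ →
      R_total d M α *ᵥ chi β Φ = (lam : ℂ) • chi β Φ) {W : Fin d → ℤ}
    {v : Conf d M × Conf d N → ℂ} (hvW : InSector W v) (hv0 : v ≠ 0)
    (hv : R_total d M α *ᵥ v = (lam : ℂ) • v) (s : Fin d) : 0 ≤ W s := by
  induction hk : deficiency W using Nat.strong_induction_on generalizing W v s with
  | _ k ih =>
    by_contra! hs
    obtain ⟨i, hi, h1, h2, h3, h4⟩ := exists_raise hMN α hvW hv0 hv hs
    have h5 := fun r => ih _ (hk ▸ h1) h2 h3 h4 r rfl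
    obtain ⟨c, hc⟩ := exists_eq_smul_chi_sectorState hM hα hN hβ hβ1 hR h5 h2 h4
    have his : s ≠ i := by
      rintro rfl
      omega
    have h6 : lieOp M N (Matrix.single i s 1) *ᵥ (lieOp M N (Matrix.single s i 1) *ᵥ v) = 0 := by
      rw [hc, mulVec_smul, lieOp_mulVec_chi β (isSymmetric_sectorState _),
        siteSum_single_mulVec_eq_zero]
      · rw [chi]
        simp [special_zero]
      · rintro b ⟨k, hk⟩
        refine if_neg fun hb => ?_
        have h7 := congrFun hb s
        have h8 : 0 < occ b s :=
          Finset.card_pos.mpr ⟨k, Finset.mem_filter.mpr ⟨Finset.mem_univ k, hk⟩⟩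
        simp only [Pi.sub_apply, Pi.add_apply, Pi.single_eq_same, Pi.single_eq_of_ne his] at h7
        omega
    apply h3
    rw [← dotProduct_star_self_eq_zero]
    rw [star_mulVec, conjTranspose_lieOp, conjTranspose_single, star_one, ← dotProduct_mulVec, h6,
      dotProduct_zero]

theorem exists_eq_chi_of_mulVec_eq {d M N : ℕ} [NeZero d] (hM : 1 ≤ M) (hMN : M < N)
    {α : Finset (Fin N) → ℝ} (hα : ∀ x, 0 ≤ α x) (hN : ∀ n, ∃ x, n ∈ x ∧ 0 < α x) {lam : ℝ}
    {β : Str N M → ℝ} (hβ : ∀ x, 0 ≤ β x) (hβ1 : quad d ∅ β = 1)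
    (hR : ∀ Φ : Conf d (N - M) → ℂ, IsSymmetric Φ →
      R_total d M α *ᵥ chi β Φ = (lam : ℂ) • chi β Φ)
    {v : Conf d M × Conf d N → ℂ} (hv : R_total d M α *ᵥ v = (lam : ℂ) • v) :
    ∃ Φ : Conf d (N - M) → ℂ, IsSymmetric Φ ∧ v = chi β Φ := by
  have h : ∀ W, ∃ c : ℂ, sectorPart W v = c • chi β (sectorState (N - M) W) := by
    intro W
    by_cases h0 : sectorPart W v = 0
    · exact ⟨0, by rw [h0, zero_smul]⟩
    · have hW := inSector_sectorPart W v
      have hvW := R_total_mulVec_sectorPart_eq_smul hv W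
      exact exists_eq_smul_chi_sectorState hM hα hN hβ hβ1 hR
        (nonneg_of_inSector hM hMN hα hN hβ hβ1 hR hW h0 hvW) hW hvW
  choose c hc using h
  -- `Φ` collects the coefficients of all sectors. At a fixed `p`, every nonvanishing Bell factor
  -- leaves on the other sites a configuration whose occupation numbers are the weight of `p`, so
  -- only the coefficient of that sector enters.
  refine ⟨fun e => c fun s => (occ e s : ℤ), fun π b => by simp only [occ_comp_perm], funext fun p => ?_⟩
  have h1 : v p = sectorPart (weight p) v p := (if_pos rfl).symm
  rw [h1, hc, Pi.smul_apply, smul_eq_mul, chi_apply, chi_apply, Finset.mul_sum]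
  refine Finset.sum_congr rfl fun x _ => ?_
  by_cases hb : bell M p.1 (restr x.1 x.2 p.2) = 0
  · simp [special, hb]
  · have hw := weight_eq_of_special_ne_zero (Φ := 1) (x := x) (p := p)
      (mul_ne_zero hb one_ne_zero)
    rw [special, special, sectorState, if_pos hw.symm, ← hw]
    ring

/-! ### Assembly of the main theorem. -/

theorem exists_isSymmetric_unit (d n : ℕ) [NeZero d] :
    ∃ Φ : Conf d n → ℂ, IsSymmetric Φ ∧ star Φ ⬝ᵥ Φ = 1 := by
  refine ⟨Pi.single (fun _ => 0) 1, fun π b => ?_, by simp [dotProduct, Pi.single_apply]⟩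
  have h : b ∘ π = (fun _ => 0) ↔ b = fun _ => 0 := by
    constructor
    · intro h
      ext k
      have := congrFun h (π.symm k)
      rw [Function.comp_apply, Equiv.apply_symm_apply] at this
      rw [this]
    · rintro rfl
      rfl
  simp only [Pi.single_apply, h]

end Cloning

open Cloning
theorem mainTheorem3 (d M N : ℕ) (hd : 1 ≤ d) (hM : 1 ≤ M) (hMN : M < N)
    (α : Finset (Fin N) → ℝ) (hα : ∀ x, 0 ≤ α x) (hα1 : ∑ x, α x = 1) :
    -- norms and fidelities of the states in the span of the special states
    (∀ (β : Str N M → ℝ) (Φ : Conf d (N - M) → ℂ), IsSymmetric Φ → star Φ ⬝ᵥ Φ = 1 →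
      star (chi β Φ) ⬝ᵥ chi β Φ = (quad d ∅ β : ℂ) ∧
      ∀ y : Finset (Fin N), star (chi β Φ) ⬝ᵥ (R_op d M y *ᵥ chi β Φ) = (quad d y β : ℂ)) ∧
    -- every normalised coefficient vector is realised by a cloning map
    (∀ β : Str N M → ℝ, (∀ x, 0 ≤ β x) → quad d ∅ β = 1 →
      ∃ E : Matrix (Conf d M) (Conf d M) ℂ →ₗ[ℂ] Matrix (Conf d N) (Conf d N) ℂ,
        IsChannel E ∧ ∀ y : Finset (Fin N), fidelity E y = quad d y β) ∧
    -- the maximum eigenvalue, the optimal fidelity and the quadratic programme agree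
    ∃ lam : ℝ,
      IsGreatest {t : ℝ | Module.End.HasEigenvalue (Matrix.toLin' (R_total d M α)) (t : ℂ)} lam ∧
      IsGreatest {t : ℝ |
        ∃ E : Matrix (Conf d M) (Conf d M) ℂ →ₗ[ℂ] Matrix (Conf d N) (Conf d N) ℂ,
          IsChannel E ∧ t = ∑ y, α y * fidelity E y} lam ∧
      IsGreatest {t : ℝ | ∃ β : Str N M → ℝ, (∀ x, 0 ≤ β x) ∧ quad d ∅ β ≤ 1 ∧
        t = ∑ y, α y * quad d y β} lam ∧
      -- every optimal coefficient vector gives maximum eigenvectors of R in the special span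
      ∀ β : Str N M → ℝ, (∀ x, 0 ≤ β x) → quad d ∅ β ≤ 1 → ∑ y, α y * quad d y β = lam →
        quad d ∅ β = 1 ∧
        (∀ Φ : Conf d (N - M) → ℂ, IsSymmetric Φ → star Φ ⬝ᵥ Φ = 1 →
          R_total d M α *ᵥ chi β Φ = (lam : ℂ) • chi β Φ) ∧
        -- and, if every output site is tested, all maximum eigenvectors are of this form
        ((∀ n : Fin N, ∃ x, n ∈ x ∧ 0 < α x) →
          ∀ v : Conf d M × Conf d N → ℂ, R_total d M α *ᵥ v = (lam : ℂ) • v →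
            ∃ Φ : Conf d (N - M) → ℂ, IsSymmetric Φ ∧ v = chi β Φ) := by
  have : NeZero d := ⟨by omega⟩
  obtain ⟨lam, hpos, hgreat, hlam⟩ := exists_isGreatest_quad (d := d) hMN hα hα1
  have hchannel : ∀ β : Str N M → ℝ, (∀ x, 0 ≤ β x) → quad d ∅ β = 1 →
      ∃ E : Matrix (Conf d M) (Conf d M) ℂ →ₗ[ℂ] Matrix (Conf d N) (Conf d N) ℂ,
        IsChannel E ∧ ∀ y : Finset (Fin N), fidelity E y = quad d y β := fun β _ hβ1 =>
    ⟨krausMap (cloneKraus β), isChannel_krausMap _ (sum_conjTranspose_cloneKraus_mul hβ1),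
      fidelity_krausMap_cloneKraus β⟩
  have hopt : ∀ β : Str N M → ℝ, (∀ x, 0 ≤ β x) → quad d ∅ β ≤ 1 →
      ∑ y, α y * quad d y β = lam → quad d ∅ β = 1 := fun β h0 h1 h2 => by
    -- At an optimum the homogeneous bound reads `λ ≤ λ βᵀ G_∅ β`, and `λ > 0` forces the constraint
    -- to be tight.
    have h3 := hlam β h0
    rw [h2] at h3
    exact le_antisymm h1 (by nlinarith)
  have heig : ∀ β : Str N M → ℝ, (∀ x, 0 ≤ β x) → quad d ∅ β ≤ 1 →
      ∑ y, α y * quad d y β = lam → ∀ Φ : Conf d (N - M) → ℂ, IsSymmetric Φ →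
      R_total d M α *ᵥ chi β Φ = (lam : ℂ) • chi β Φ := fun β h0 h1 h2 Φ hΦ =>
    R_total_mulVec_chi_of_isMax hMN hα hpos hlam (by rw [h2, hopt β h0 h1 h2, mul_one]) hΦ
  obtain ⟨β₀, hβ₀, hβ₁, hβ₂⟩ := hgreat.1
  refine ⟨fun β Φ hΦ h1 => ⟨?_, fun y => ?_⟩, hchannel, lam, ⟨?_, ?_⟩, ⟨?_, ?_⟩, hgreat,
    fun β h0 h1 h2 => ⟨hopt β h0 h1 h2, fun Φ hΦ _ => heig β h0 h1 h2 Φ hΦ,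
      fun hN v hv => exists_eq_chi_of_mulVec_eq hM hMN hα hN h0 (hopt β h0 h1 h2)
        (heig β h0 h1 h2) hv⟩⟩
  · rw [star_chi_dotProduct_chi β hΦ, h1, mul_one]
  · rw [star_chi_dotProduct_R_op y β hΦ, h1, mul_one]
  -- Any unit symmetric `Φ` yields an eigenvector: its image `χ` has norm one, hence is nonzero.
  · obtain ⟨Φ, hΦ, hΦ1⟩ := exists_isSymmetric_unit d (N - M)
    refine Module.End.hasEigenvalue_of_hasEigenvector (x := chi β₀ Φ)
      ⟨Module.End.mem_eigenspace_iff.mpr ?_, fun hz => ?_⟩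
    · rw [toLin'_apply, heig β₀ hβ₀ hβ₁ hβ₂.symm Φ hΦ]
    · have h := star_chi_dotProduct_chi (d := d) β₀ hΦ
      rw [hz, dotProduct_zero, hopt β₀ hβ₀ hβ₁ hβ₂.symm, hΦ1, Complex.ofReal_one, one_mul] at h
      exact zero_ne_one h
  · intro t ht
    obtain ⟨v, hv⟩ := Module.End.HasEigenvalue.exists_hasEigenvector ht
    have h := norm_eigenvalue_le hMN hα hpos hlam hv.2
      (by rw [← toLin'_apply]; exact hv.apply_eq_smul)
    rw [Complex.norm_real] at h
    exact (le_abs_self t).trans h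
  · obtain ⟨E, hE, hF⟩ := hchannel β₀ hβ₀ (hopt β₀ hβ₀ hβ₁ hβ₂.symm)
    refine ⟨E, hE, ?_⟩
    simp_rw [hF]
    exact hβ₂
  · rintro t ⟨E, hE, rfl⟩
    exact sum_mul_fidelity_le (posSemidef_smul_one_sub_R_total hMN hα hpos hlam) hα hE
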